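/- **Setting.** Let $\mathbb O$ be the complexified octonions, with $\mathbb C$-basis $1,i,j,k,e,ie,je,ke$, where $1,i,j,k$ are the quaternions and, for quaternions $u,v$, one has $u(ve)=(vu)e$, $(ue)v=(u\bar v)e$, $(ue)(ve)=-\bar v u$. Let $x\mapsto\bar x$ be the $\mathbb C$-linear conjugation, $\mathrm{Re}(x)$ the coefficient of $1$, $|x|^2=\sum_k x_k^2$, and $L_x\in\mathrm{Mat}_8(\mathbb C)$ the matrix of $y\mapsto xy$. Let $x_1,\dots,x_{27}$ be homogeneous coordinates on $\mathbb P^{26}$ over $\mathbb C$ and write $c=(x_1,\dots,x_8)$, $b=(x_9,\dots,x_{16})$, $a=(x_{17},\dots,x_{24})\in\mathbb O$, $(\lambda_1,\lambda_2,\lambda_3)=(x_{25},x_{26},x_{27})$, so that a point of $\mathbb P^{26}$ is the class of an octonionic hermitian matrix $$A=\begin{pmatrix}\lambda_1&c&\bar b\\ \bar c&\lambda_2&a\\ b&\bar a&\lambda_3\end{pmatrix}.$$ Put $$M_{\mathbb O}=\begin{pmatrix}\lambda_1I_8&L_c&{}^tL_b\\ {}^tL_c&\lambda_2I_8&L_a\\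 L_b&{}^tL_a&\lambda_3I_8\end{pmatrix},\qquad \mathrm{Det}=\lambda_1\lambda_2\lambda_3+2\,\mathrm{Re}(c(ab))-\lambda_2|b|^2-\lambda_1|a|^2-\lambda_3|c|^2,$$ $$S_{ODM}=\mathrm{Det}^2-4\,\phi(c,b,a)\,\mathrm{Det}-|[c,b,a]|^2,\quad \phi(c,b,a)=\tfrac12\mathrm{Re}\big((c\bar b-\bar b c)a\big),\quad [c,b,a]=(cb)a-c(ba),$$ and let $E_{ODM}$ be the cokernel of $M_{\mathbb O}:\mathbb C^{24}\otimes\mathcal O(-1)\to\mathbb C^{24}\otimes\mathcal O$ on $\mathbb P^{26}$. Let $SO_8=SO_8(\mathbb C)$ act on $\mathbb O=\mathbb C^8$ and let $SO_7\subset SO_8$ be the stabilizer of $1$. The group $SO_7\times SL_3$ acts on $\mathbb P^{26}$ on the left: $T_1\in SO_7$ applies $T_1$ to every entry of $A$, and $C\in SL_3(\mathbb C)$ sends $A$ to ${}^tC^{-1}A\,C^{-1}$. Let $\widetilde G$ be the group of all pairs $(T_1,T_2)\in SO_7\times SO_8$ satisfying the triality relation $T_2(uv)=T_1(u)\,T_2(v)$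 for all $u,v\in\mathbb O$. **Theorem.** 1. (Support) $S_{ODM}$ is a nonzero form of degree $6$. The support of $E_{ODM}$ is the hypersurface $S_{ODM}=0$; moreover $E_{ODM}$ is annihilated by the ideal sheaf of this hypersurface, i.e. it is a sheaf on the scheme $S_{ODM}=0$. 2. (Generic rank) $E_{ODM}$ has generic rank $4$ on the sextic: there is an open $U\subset\mathbb P^{26}$, with $U\cap\{S_{ODM}=0\}$ dense in $\{S_{ODM}=0\}$, such that at every point of $U\cap\{S_{ODM}=0\}$ the stalk of $E_{ODM}$ is free of rank $4$ over the local ring of the hypersurface $S_{ODM}=0$. 3. (Triality) For every $T_1\in SO_7$ there is $T_2\in SO_8$ with $(T_1,T_2)\in\widetilde G$ and $L_{T_1(z)}=T_2L_zT_2^{-1}$ for all $z\in\mathbb O$, and the elements of $\widetilde G$ above $T_1$ are exactly $(T_1,T_2)$ and $(T_1,-T_2)$. Thus $\widetilde G\to SO_7$ is surjective with kernel $\{\pm1\}$. 4. (Equivariance) $E_{ODM}$ is $SO_7\times SL_3$-equivariant in the following sense. For every $g\in SO_7\times SL_3$ one has $g^*E_{ODM}\cong E_{ODM}$. Moreover,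 these isomorphisms can be chosen coherently on the double cover $\widetilde G\times SL_3\to SO_7\times SL_3$, $((T_1,T_2),C)\mapsto(T_1,C)$: there are isomorphisms $\theta_g:g^*E_{ODM}\to E_{ODM}$ for $g\in\widetilde G\times SL_3$ with $\theta_{gh}=\theta_h\circ h^*\theta_g$, and they are induced by the representation $\rho((T_1,T_2),C)={}^tC^{-1}\otimes T_2$ on $\mathbb C^{24}=\mathbb C^3\otimes\mathbb O$: for every $v\in\mathbb C^{24}$, with class $[v]\in H^0(\mathbb P^{26},E_{ODM})$, one has $\theta_g(g^*[v])=[\rho(g)^{-1}v]$. -/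

import Mathlib

open CategoryTheory AlgebraicGeometry TopologicalSpace Opposite
open scoped Matrix

namespace SerreTwist

universe u

variable {A σ : Type u} [CommRing A] [SetLike σ A] [AddSubgroupClass σ A]
variable (𝒜 : ℕ → σ) [GradedRing 𝒜]

/-- The local ring `A_𝔭` of the graded ring at the homogeneous prime `x`. -/
abbrev Loc (x : ProjectiveSpectrum 𝒜) : Type u :=
  Localization.AtPrime x.asHomogeneousIdeal.toIdeal

/-- The degree zero part of `A_𝔭`. -/
abbrev HLoc (x : ProjectiveSpectrum 𝒜) : Type u :=
  HomogeneousLocalization.AtPrime 𝒜 x.asHomogeneousIdeal.toIdeal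

/-- `f` is given on `U` by one fraction `r / t` of homogeneous elements with
`deg r = deg t + n` and `t` nowhere zero on `U`. -/
def IsFraction (n : ℤ) {U : Opens (ProjectiveSpectrum.top 𝒜)} (f : ∀ x : U, Loc 𝒜 x.1) : Prop :=
  ∃ (i j : ℕ) (r : 𝒜 i) (t : 𝒜 j) (ht : ∀ x : U, t.1 ∉ x.1.asHomogeneousIdeal),
    (i : ℤ) = j + n ∧ ∀ x : U, f x = (Localization.mk r.1 ⟨t.1, ht x⟩ : Loc 𝒜 x.1)

/-- `IsFraction` is stable under restriction. -/
def isFractionPrelocal (n : ℤ) :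
    TopCat.PrelocalPredicate (fun x : ProjectiveSpectrum.top 𝒜 => Loc 𝒜 x) where
  pred f := IsFraction 𝒜 n f
  res := by
    rintro V U i f ⟨a, b, r, t, ht, h, w⟩
    exact ⟨a, b, r, t, fun x => ht (i x), h, fun x => w (i x)⟩

/-- `f` is locally a fraction of degree `n`. -/
def isLocallyFraction (n : ℤ) :
    TopCat.LocalPredicate (fun x : ProjectiveSpectrum.top 𝒜 => Loc 𝒜 x) :=
  (isFractionPrelocal 𝒜 n).sheafify

variable {𝒜} in
theorem exists_degree (n : ℤ) (x : ProjectiveSpectrum 𝒜) :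
    ∃ (i j : ℕ) (t : 𝒜 j), (i : ℤ) = j + n ∧ t.1 ∉ x.asHomogeneousIdeal := by
  obtain ⟨d, hd, t, ht, htx⟩ : ∃ d, 0 < d ∧ ∃ t ∈ 𝒜 d, t ∉ x.asHomogeneousIdeal := by
    by_contra! h
    exact x.not_irrelevant_le ((HomogeneousIdeal.irrelevant_le _).2 h)
  refine ⟨((n.natAbs * d : ℕ) + n).toNat, n.natAbs * d,
    ⟨t ^ n.natAbs, by simpa using SetLike.pow_mem_graded n.natAbs ht⟩, ?_, ?_⟩
  · have : n.natAbs ≤ n.natAbs * d := Nat.le_mul_of_pos_right _ hd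
    omega
  · exact fun h => htx (x.isPrime.mem_of_pow_mem _ h)

theorem add_mem' (n : ℤ) {U : Opens (ProjectiveSpectrum.top 𝒜)} {f g : ∀ x : U, Loc 𝒜 x.1}
    (hf : (isLocallyFraction 𝒜 n).pred f) (hg : (isLocallyFraction 𝒜 n).pred g) :
    (isLocallyFraction 𝒜 n).pred (fun x => f x + g x) := by
  intro x
  obtain ⟨V, hV, iV, a, b, r, t, ht, h, w⟩ := hf x
  obtain ⟨W, hW, iW, c, d, s, v, hv, h', w'⟩ := hg x
  refine ⟨V ⊓ W, ⟨hV, hW⟩, Opens.infLELeft _ _ ≫ iV, a + d, b + d,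
    ⟨v.1 * r.1 + t.1 * s.1, add_mem ?_ ?_⟩, ⟨t.1 * v.1, SetLike.mul_mem_graded t.2 v.2⟩,
    fun y hy => ?_, by push_cast; omega, fun y => ?_⟩
  · rw [add_comm a d]; exact SetLike.mul_mem_graded v.2 r.2
  · have : a + d = b + c := by omega
    rw [this]; exact SetLike.mul_mem_graded t.2 s.2
  · exact (y.1.isPrime.mem_or_mem hy).elim (ht ⟨y.1, y.2.1⟩) (hv ⟨y.1, y.2.2⟩)
  · have e1 := w ⟨y.1, y.2.1⟩
    have e2 := w' ⟨y.1, y.2.2⟩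
    refine (congrArg₂ (· + ·) e1 e2).trans ?_
    change Localization.mk _ _ + Localization.mk _ _ = Localization.mk _ _
    rw [Localization.add_mk]
    congr 1
    · simp only; ring

/-- The sections of `𝒪(n)` over `U`: families of elements of the local rings `A_𝔭` that are
locally fractions of degree `n`. -/
def sectionsSubgroup (n : ℤ) (U : Opens (ProjectiveSpectrum.top 𝒜)) :
    AddSubgroup (∀ x : U, Loc 𝒜 x.1) where
  carrier := {f | (isLocallyFraction 𝒜 n).pred f}
  zero_mem' := by
    intro x
    obtain ⟨i, j, t, h, ht⟩ := exists_degree n x.1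
    refine ⟨U ⊓ ProjectiveSpectrum.basicOpen 𝒜 t.1, ⟨x.2, ht⟩, Opens.infLELeft _ _,
      i, j, 0, t, fun y => y.2.2, h, fun y => ?_⟩
    exact (Localization.mk_zero _).symm
  add_mem' := by
    intro f g hf hg
    exact add_mem' 𝒜 n hf hg
  neg_mem' := by
    intro f hf x
    obtain ⟨V, hV, iV, a, b, r, t, ht, h, w⟩ := hf x
    refine ⟨V, hV, iV, a, b, -r, t, ht, h, fun y => ?_⟩
    refine (congrArg Neg.neg (w y)).trans ?_
    exact (Localization.neg_mk _ _)

theorem smul_mem' (n : ℤ) {U : Opens (ProjectiveSpectrum.top 𝒜)}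
    (a : (ProjectiveSpectrum.Proj.structureSheaf 𝒜).1.obj (op U))
    {f : ∀ x : U, Loc 𝒜 x.1} (hf : (isLocallyFraction 𝒜 n).pred f) :
    (isLocallyFraction 𝒜 n).pred (fun x => ((a.1 x).val : Loc 𝒜 x.1) * f x) := by
  intro x
  obtain ⟨V, hV, iV, b, r, t, ht, w⟩ := a.2 x
  obtain ⟨W, hW, iW, c, d, s, v, hv, h', w'⟩ := hf x
  refine ⟨V ⊓ W, ⟨hV, hW⟩, Opens.infLELeft _ _ ≫ iV, b + c, b + d,
    ⟨r.1 * s.1, SetLike.mul_mem_graded r.2 s.2⟩, ⟨t.1 * v.1, SetLike.mul_mem_graded t.2 v.2⟩,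
    fun y hy => ?_, by push_cast; omega, fun y => ?_⟩
  · exact (y.1.isPrime.mem_or_mem hy).elim (ht ⟨y.1, y.2.1⟩) (hv ⟨y.1, y.2.2⟩)
  · have e1 := congrArg HomogeneousLocalization.val (w ⟨y.1, y.2.1⟩)
    have e2 := w' ⟨y.1, y.2.2⟩
    refine (congrArg₂ (· * ·) e1 e2).trans ?_
    exact Localization.mk_mul _ _ _ _

/-- The group of sections of `𝒪(n)` over `U`. -/
abbrev Sections (n : ℤ) (U : Opens (ProjectiveSpectrum.top 𝒜)) : Type u :=
  sectionsSubgroup 𝒜 n U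

/-- Sections of `𝒪` act on sections of `𝒪(n)` by pointwise multiplication. -/
instance sectionsModule (n : ℤ) (U : Opens (ProjectiveSpectrum.top 𝒜)) :
    Module ((ProjectiveSpectrum.Proj.structureSheaf 𝒜).1.obj (op U)) (Sections 𝒜 n U) where
  smul a f := ⟨fun x => ((a.1 x).val : Loc 𝒜 x.1) * f.1 x, smul_mem' 𝒜 n a f.2⟩
  one_smul f := Subtype.ext <| funext fun x => by
    change ((1 : HLoc 𝒜 x.1).val : Loc 𝒜 x.1) * f.1 x = _
    rw [HomogeneousLocalization.val_one, one_mul]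
  mul_smul a b f := Subtype.ext <| funext fun x => by
    change ((a.1 x * b.1 x).val : Loc 𝒜 x.1) * f.1 x = (a.1 x).val * ((b.1 x).val * f.1 x)
    rw [HomogeneousLocalization.val_mul, mul_assoc]
  smul_zero a := Subtype.ext <| funext fun x => mul_zero _
  smul_add a f g := Subtype.ext <| funext fun x => mul_add _ _ _
  add_smul a b f := Subtype.ext <| funext fun x => by
    change ((a.1 x + b.1 x).val : Loc 𝒜 x.1) * f.1 x =
      (a.1 x).val * f.1 x + (b.1 x).val * f.1 x
    rw [HomogeneousLocalization.val_add, add_mul]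
  zero_smul f := Subtype.ext <| funext fun x => by
    change ((0 : HLoc 𝒜 x.1).val : Loc 𝒜 x.1) * f.1 x = 0
    rw [HomogeneousLocalization.val_zero, zero_mul]

/-- The presheaf of abelian groups `U ↦ Γ(U, 𝒪(n))`. -/
def presheafAb (n : ℤ) : TopCat.Presheaf Ab (ProjectiveSpectrum.top 𝒜) where
  obj U := AddCommGrpCat.of (Sections 𝒜 n U.unop)
  map {U V} i := AddCommGrpCat.ofHom
    { toFun := fun f => ⟨fun x => f.1 (i.unop x), (isLocallyFraction 𝒜 n).res i.unop f.1 f.2⟩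
      map_zero' := rfl
      map_add' := fun _ _ => rfl }

theorem isSheaf (n : ℤ) : (presheafAb 𝒜 n).IsSheaf := by
  rw [TopCat.Presheaf.isSheaf_iff_isSheaf_comp (forget Ab)]
  exact TopCat.Presheaf.isSheaf_of_iso
    (NatIso.ofComponents (fun _ => Iso.refl _) (by intros; rfl) :
      (TopCat.subsheafToTypes (isLocallyFraction 𝒜 n)).1 ≅ presheafAb 𝒜 n ⋙ forget Ab)
    (TopCat.subsheafToTypes (isLocallyFraction 𝒜 n)).property

instance (n : ℤ) (U : (Opens (Proj 𝒜))ᵒᵖ) :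
    Module ((Proj 𝒜).ringCatSheaf.obj.obj U) ((presheafAb 𝒜 n).obj U) :=
  sectionsModule 𝒜 n U.unop

/-- Serre's twisting sheaf `𝒪(n)` on `Proj 𝒜`. -/
noncomputable def twist (n : ℤ) : (Proj 𝒜).Modules where
  val := PresheafOfModules.ofPresheaf (presheafAb 𝒜 n) (fun _ _ _ _ _ => rfl)
  isSheaf := isSheaf 𝒜 n

theorem exists_mul_eq (d : ℕ) (f : 𝒜 d) {U : Opens (ProjectiveSpectrum.top 𝒜)}
    (s : Sections 𝒜 (-(d : ℤ)) U) :
    ∃ h : (ProjectiveSpectrum.Proj.structureSheaf 𝒜).1.obj (op U),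
      ∀ x : U, ((h.1 x).val : Loc 𝒜 x.1) = algebraMap A (Loc 𝒜 x.1) f.1 * s.1 x := by
  have key : ∀ x : U, ∃ (V : Opens (ProjectiveSpectrum.top 𝒜)) (_ : x.1 ∈ V) (_ : V ⟶ U)
      (j : ℕ) (a t : 𝒜 j) (ht : ∀ y : V, t.1 ∉ y.1.asHomogeneousIdeal), ∀ (y : V) (hy : y.1 ∈ U),
      ((HomogeneousLocalization.mk ⟨j, a, t, ht y⟩ : HLoc 𝒜 y.1).val : Loc 𝒜 y.1) =
        algebraMap A (Loc 𝒜 y.1) f.1 * s.1 ⟨y.1, hy⟩ := by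
    intro x
    obtain ⟨V, hV, iV, i, j, r, t, ht, h, w⟩ := s.2 x
    have hj : d + i = j := by omega
    refine ⟨V, hV, iV, j, ⟨f.1 * r.1, hj ▸ SetLike.mul_mem_graded f.2 r.2⟩, t, ht, fun y hy => ?_⟩
    refine Eq.trans ?_ (congrArg (algebraMap A (Loc 𝒜 y.1) f.1 * ·) (w y).symm)
    change Localization.mk _ _ = algebraMap A (Loc 𝒜 y.1) f.1 * Localization.mk _ _
    rw [← Localization.mk_one_eq_algebraMap, Localization.mk_mul, one_mul]
  choose V hV iV j a t ht w using key
  have hv : ∀ (x : U) (y : V x) (hy : y.1 ∈ U),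
      (HomogeneousLocalization.mk ⟨j ⟨y.1, hy⟩, a ⟨y.1, hy⟩, t ⟨y.1, hy⟩,
        ht ⟨y.1, hy⟩ ⟨y.1, hV ⟨y.1, hy⟩⟩⟩ : HLoc 𝒜 y.1) =
      HomogeneousLocalization.mk ⟨j x, a x, t x, ht x y⟩ := fun x y hy =>
    HomogeneousLocalization.val_injective _
      ((w ⟨y.1, hy⟩ ⟨y.1, hV ⟨y.1, hy⟩⟩ hy).trans (w x y hy).symm)
  refine ⟨⟨fun x => HomogeneousLocalization.mk ⟨j x, a x, t x, ht x ⟨x.1, hV x⟩⟩, fun x =>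
    ⟨V x, hV x, iV x, j x, a x, t x, ht x, fun y => hv x y ((iV x).le y.2)⟩⟩, fun x => ?_⟩
  exact w x ⟨x.1, hV x⟩ x.2

theorem structureSheaf_ext {U : Opens (ProjectiveSpectrum.top 𝒜)}
    {g h : (ProjectiveSpectrum.Proj.structureSheaf 𝒜).1.obj (op U)}
    (H : ∀ x : U, ((g.1 x).val : Loc 𝒜 x.1) = (h.1 x).val) : g = h :=
  Subtype.ext <| funext fun x => HomogeneousLocalization.val_injective _ (H x)

/-- Multiplication of a section of `𝒪(-d)` by a form `f` of degree `d`. -/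
noncomputable def mulSection (d : ℕ) (f : 𝒜 d) {U : Opens (ProjectiveSpectrum.top 𝒜)}
    (s : Sections 𝒜 (-(d : ℤ)) U) : (ProjectiveSpectrum.Proj.structureSheaf 𝒜).1.obj (op U) :=
  (exists_mul_eq 𝒜 d f s).choose

theorem mulSection_val (d : ℕ) (f : 𝒜 d) {U : Opens (ProjectiveSpectrum.top 𝒜)}
    (s : Sections 𝒜 (-(d : ℤ)) U) (x : U) :
    (((mulSection 𝒜 d f s).1 x).val : Loc 𝒜 x.1) = algebraMap A (Loc 𝒜 x.1) f.1 * s.1 x :=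
  (exists_mul_eq 𝒜 d f s).choose_spec x

/-- The structure sheaf of a scheme as a module over itself. -/
noncomputable abbrev structureModule (X : Scheme.{u}) : X.Modules :=
  SheafOfModules.unit X.ringCatSheaf

/-- `mulSection` as an additive map. -/
noncomputable def mulAddHom (d : ℕ) (f : 𝒜 d) (U : Opens (ProjectiveSpectrum.top 𝒜)) :
    Sections 𝒜 (-(d : ℤ)) U →+ (ProjectiveSpectrum.Proj.structureSheaf 𝒜).1.obj (op U) :=
  AddMonoidHom.mk' (fun s => mulSection 𝒜 d f s) fun s s' => structureSheaf_ext 𝒜 fun x => by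
    rw [mulSection_val]
    change _ = ((mulSection 𝒜 d f s).1 x + (mulSection 𝒜 d f s').1 x : HLoc 𝒜 x.1).val
    rw [HomogeneousLocalization.val_add, mulSection_val, mulSection_val]
    exact mul_add _ _ _

/-- Multiplication by a form `f` of degree `d` as a morphism `𝒪(-d) ⟶ 𝒪`. -/
noncomputable def mulHom (d : ℕ) (f : 𝒜 d) : twist 𝒜 (-(d : ℤ)) ⟶ structureModule (Proj 𝒜) where
  val := PresheafOfModules.homMk
    { app := fun U => AddCommGrpCat.ofHom (mulAddHom 𝒜 d f U.unop)
      naturality := fun U V i => by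
        refine AddCommGrpCat.hom_ext (AddMonoidHom.ext fun s => ?_)
        refine structureSheaf_ext 𝒜 fun x => ?_
        exact (mulSection_val 𝒜 d f _ x).trans (mulSection_val 𝒜 d f _ (i.unop x)).symm }
    (fun U r s => structureSheaf_ext 𝒜 fun x => by
      refine (mulSection_val 𝒜 d f (r • s) x).trans ?_
      refine Eq.trans ?_ (HomogeneousLocalization.val_mul (r.1 x)
        ((mulSection 𝒜 d f s).1 x : HLoc 𝒜 x.1)).symm
      refine Eq.trans ?_ (congrArg (_ * ·) (mulSection_val 𝒜 d f s x).symm)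
      exact mul_left_comm _ _ _)

end SerreTwist

namespace ProjSpace

open MvPolynomial

/-- The standard grading on `ℂ[x_1, …, x_n]`. -/
noncomputable abbrev grading (n : ℕ) : ℕ → Submodule ℂ (MvPolynomial (Fin n) ℂ) :=
  homogeneousSubmodule (Fin n) ℂ

noncomputable instance (n : ℕ) : GradedRing (grading n) :=
  (gradedAlgebra : GradedAlgebra (homogeneousSubmodule (Fin n) ℂ))

/-- `ℙ^(n-1)` with homogeneous coordinates `x_1, …, x_n`. -/
noncomputable abbrev P (n : ℕ) : Scheme := Proj (grading n)

/-- The substitution `x ↦ g x` as an endomorphism of the coordinate ring. -/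
noncomputable def subst {n : ℕ} (g : Matrix (Fin n) (Fin n) ℂ) :
    MvPolynomial (Fin n) ℂ →ₐ[ℂ] MvPolynomial (Fin n) ℂ :=
  aeval fun i => ∑ j, C (g i j) * X j

theorem subst_one {n : ℕ} : subst (1 : Matrix (Fin n) (Fin n) ℂ) = AlgHom.id ℂ _ := by
  ext1 i
  simp [subst, Matrix.one_apply]

theorem subst_mul {n : ℕ} (g h : Matrix (Fin n) (Fin n) ℂ) :
    subst (g * h) = (subst h).comp (subst g) := by
  ext1 i
  simp only [subst, AlgHom.comp_apply, aeval_X, map_sum, map_mul, algHom_C, algebraMap_eq,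
    Matrix.mul_apply, Finset.sum_mul, Finset.mul_sum]
  rw [Finset.sum_comm]
  simp only [mul_assoc]

theorem subst_mem {n : ℕ} (g : Matrix (Fin n) (Fin n) ℂ) {i : ℕ} {p : MvPolynomial (Fin n) ℂ}
    (hp : p ∈ grading n i) : subst g p ∈ grading n i := by
  have h := IsHomogeneous.aeval (n := 1) hp (fun k => ∑ j, C (g k j) * X j) fun k =>
    IsHomogeneous.sum _ _ _ fun j _ => by
      simpa using (isHomogeneous_C (Fin n) (g k j)).mul (isHomogeneous_X ℂ j)
  rw [one_mul] at h
  exact h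

/-- `subst` as a homomorphism of graded rings. -/
noncomputable def gradedSubst {n : ℕ} (g : Matrix (Fin n) (Fin n) ℂ) :
    grading n →+*ᵍ grading n where
  toRingHom := (subst g).toRingHom
  map_mem := subst_mem g

theorem irrelevant_le {n : ℕ} (g : GL (Fin n) ℂ) :
    HomogeneousIdeal.irrelevant (grading n) ≤
      (HomogeneousIdeal.irrelevant (grading n)).map (gradedSubst g.1) := by
  rw [HomogeneousIdeal.irrelevant_le]
  intro i hi p hp
  have h : subst g.1 (subst g⁻¹.1 p) = p := by
    rw [← AlgHom.comp_apply, ← subst_mul, ← Units.val_mul, inv_mul_cancel, Units.val_one,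
      subst_one, AlgHom.id_apply]
  have h2 : subst g⁻¹.1 p ∈ HomogeneousIdeal.irrelevant (grading n) :=
    HomogeneousIdeal.mem_irrelevant_of_mem _ hi (subst_mem _ hp)
  have h3 := Ideal.mem_map_of_mem (gradedSubst g.1) h2
  rw [← h]
  exact h3

/-- The morphism `[v] ↦ [g v]` of projective space. -/
noncomputable def projMap {n : ℕ} (g : GL (Fin n) ℂ) : P n ⟶ P n :=
  Proj.map (gradedSubst g.1) (irrelevant_le g)

theorem projMap_one {n : ℕ} : projMap (1 : GL (Fin n) ℂ) = 𝟙 _ := by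
  have h : gradedSubst (1 : GL (Fin n) ℂ).1 = GradedRingHom.id (grading n) :=
    DFunLike.ext _ _ fun p => DFunLike.congr_fun subst_one p
  rw [← Proj.map_id]
  unfold projMap
  congr 1

theorem projMap_mul {n : ℕ} (g h : GL (Fin n) ℂ) : projMap (g * h) = projMap h ≫ projMap g := by
  have e : gradedSubst (g * h).1 = (gradedSubst h.1).comp (gradedSubst g.1) :=
    DFunLike.ext _ _ fun p => DFunLike.congr_fun (subst_mul g.1 h.1) p
  unfold projMap
  rw [← Proj.map_comp _ _ (irrelevant_le g) (irrelevant_le h)]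
  congr 1

/-- The left action of `GL_n` on `ℙ^(n-1)`. -/
noncomputable def projAut (n : ℕ) : GL (Fin n) ℂ →* Aut (P n) where
  toFun g :=
    { hom := projMap g
      inv := projMap g⁻¹
      hom_inv_id := by rw [← projMap_mul, inv_mul_cancel, projMap_one]
      inv_hom_id := by rw [← projMap_mul, mul_inv_cancel, projMap_one] }
  map_one' := Iso.ext projMap_one
  map_mul' g h := Iso.ext (projMap_mul g h)

/-- The constant `a` as a global function on `ℙ^(n-1)`. -/
noncomputable def constSection (n : ℕ) (a : ℂ) :
    (ProjectiveSpectrum.Proj.structureSheaf (grading n)).1.obj (op ⊤) :=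
  ⟨fun x => HomogeneousLocalization.mk
      ⟨0, ⟨C a, isHomogeneous_C _ a⟩, 1, x.1.isPrime.one_notMem⟩,
    fun _ => ⟨⊤, trivial, 𝟙 _, 0, ⟨C a, isHomogeneous_C _ a⟩, 1,
      fun y => y.1.isPrime.one_notMem, fun _ => rfl⟩⟩

end ProjSpace

section stalks
universe u
variable {X : Scheme.{u}}

/-- The stalk of an `𝒪_X`-module is a module over the local ring. -/
noncomputable instance stalkModule (M : X.Modules) (x : X) :
    Module (X.presheaf.stalk x) (M.presheaf.stalk x) :=
  let N : PresheafOfModules.{u} (X.presheaf ⋙ forget₂ CommRingCat.{u} RingCat.{u}) := M.val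
  inferInstanceAs (Module (X.presheaf.stalk x) ↑(TopCat.Presheaf.stalk (C := Ab.{u}) N.presheaf x))

/-- A linearization of the sheaf of modules `E` with respect to a (left) action of the group `G` on
the scheme `X`: isomorphisms `g^* E ≅ E` with the cocycle condition that the isomorphism of `g h`
is `(g h)^* E = h^* g^* E ⟶ h^* E ⟶ E`. -/
structure Linearization {G : Type*} [Group G] (act : G →* Aut X) (E : X.Modules) where
  /-- The isomorphism attached to `g`. -/
  iso (g : G) : (Scheme.Modules.pullback (act g).hom).obj E ≅ E
  iso_mul (g h : G) : (iso (g * h)).hom =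
    (Scheme.Modules.pullbackCongr (congrArg Iso.hom (map_mul act g h))).hom.app E ≫
      (Scheme.Modules.pullbackComp (act h).hom (act g).hom).inv.app E ≫
        (Scheme.Modules.pullback (act h).hom).map (iso g).hom ≫ (iso h).hom

end stalks

namespace Octonion

open Matrix

section coordinates

variable {K : Type*}

/-- The point of `ℂ^27` with `x_1, …, x_8 = c`, `x_9, …, x_16 = b`, `x_17, …, x_24 = a` and
`x_25, x_26, x_27 = λ₁, λ₂, λ₃`. -/
def coords (c b a : Fin 8 → K) (l : Fin 3 → K) : Fin 27 → K := fun i =>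
  if h : i.1 < 8 then c ⟨i, h⟩
  else if h' : i.1 < 16 then b ⟨i - 8, by omega⟩
  else if h'' : i.1 < 24 then a ⟨i - 16, by omega⟩
  else l ⟨i - 24, by omega⟩

/-- The octonion `c = (x_1, …, x_8)`. -/
def cPart (v : Fin 27 → K) : Fin 8 → K := fun i => v ⟨i, by omega⟩

/-- The octonion `b = (x_9, …, x_16)`. -/
def bPart (v : Fin 27 → K) : Fin 8 → K := fun i => v ⟨8 + i, by omega⟩

/-- The octonion `a = (x_17, …, x_24)`. -/
def aPart (v : Fin 27 → K) : Fin 8 → K := fun i => v ⟨16 + i, by omega⟩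

/-- The scalars `(λ₁, λ₂, λ₃) = (x_25, x_26, x_27)`. -/
def lPart (v : Fin 27 → K) : Fin 3 → K := fun i => v ⟨24 + i, by omega⟩

theorem coords_parts (v : Fin 27 → K) : coords (cPart v) (bPart v) (aPart v) (lPart v) = v := by
  ext i
  simp only [coords, cPart, bPart, aPart, lPart]
  split_ifs <;> congr 1 <;> ext <;> simp <;> omega

theorem cPart_coords (c b a : Fin 8 → K) (l : Fin 3 → K) : cPart (coords c b a l) = c := by
  ext i; simp [coords, cPart]

theorem bPart_coords (c b a : Fin 8 → K) (l : Fin 3 → K) : bPart (coords c b a l) = b := by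
  ext i
  simp only [coords, bPart]
  rw [dif_neg (by omega), dif_pos (by omega)]
  congr 1; ext; simp

theorem aPart_coords (c b a : Fin 8 → K) (l : Fin 3 → K) : aPart (coords c b a l) = a := by
  ext i
  simp only [coords, aPart]
  rw [dif_neg (by omega), dif_neg (by omega), dif_pos (by omega)]
  congr 1; ext; simp

theorem lPart_coords (c b a : Fin 8 → K) (l : Fin 3 → K) : lPart (coords c b a l) = l := by
  ext i
  simp only [coords, lPart]
  rw [dif_neg (by omega), dif_neg (by omega), dif_neg (by omega)]
  congr 1; ext; simp

end coordinates

section ring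

variable {K : Type*} [CommRing K]

/-- Multiplication of (complexified) octonions `x = ∑ x_k e_k` in the basis
`1, i, j, k, e, ie, je, ke` obtained by doubling the quaternions, with
`u (v e) = (v u) e`, `(u e) v = (u v̄) e`, `(u e) (v e) = - v̄ u` for quaternions `u, v`. -/
def mul (x y : Fin 8 → K) : Fin 8 → K :=
  ![x 0 * y 0 - x 1 * y 1 - x 2 * y 2 - x 3 * y 3 - x 4 * y 4 - x 5 * y 5 - x 6 * y 6 - x 7 * y 7,
    x 0 * y 1 + x 1 * y 0 + x 2 * y 3 - x 3 * y 2 + x 4 * y 5 - x 5 * y 4 - x 6 * y 7 + x 7 * y 6,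
    x 0 * y 2 - x 1 * y 3 + x 2 * y 0 + x 3 * y 1 + x 4 * y 6 + x 5 * y 7 - x 6 * y 4 - x 7 * y 5,
    x 0 * y 3 + x 1 * y 2 - x 2 * y 1 + x 3 * y 0 + x 4 * y 7 - x 5 * y 6 + x 6 * y 5 - x 7 * y 4,
    x 0 * y 4 - x 1 * y 5 - x 2 * y 6 - x 3 * y 7 + x 4 * y 0 + x 5 * y 1 + x 6 * y 2 + x 7 * y 3,
    x 0 * y 5 + x 1 * y 4 - x 2 * y 7 + x 3 * y 6 - x 4 * y 1 + x 5 * y 0 - x 6 * y 3 + x 7 * y 2,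
    x 0 * y 6 + x 1 * y 7 + x 2 * y 4 - x 3 * y 5 - x 4 * y 2 + x 5 * y 3 + x 6 * y 0 - x 7 * y 1,
    x 0 * y 7 - x 1 * y 6 + x 2 * y 5 + x 3 * y 4 - x 4 * y 3 - x 5 * y 2 + x 6 * y 1 + x 7 * y 0]

/-- The octonion `r · 1`. -/
def scal (r : K) : Fin 8 → K := Pi.single 0 r

/-- The conjugate octonion. -/
def conj (x : Fin 8 → K) : Fin 8 → K := fun i => if i = 0 then x i else -x i

/-- The real part. -/
def re (x : Fin 8 → K) : K := x 0

/-- The square of the norm (a quadratic form, no complex conjugation). -/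
def normSq (x : Fin 8 → K) : K := ∑ i, x i ^ 2

/-- The matrix of `y ↦ x y` in the canonical basis. -/
def L (x : Fin 8 → K) : Matrix (Fin 8) (Fin 8) K := Matrix.of fun i j => mul x (Pi.single j 1) i

/-- The octonionic hermitian matrix `[[λ₁, c, b̄], [c̄, λ₂, a], [b, ā, λ₃]]` in `J_3(𝕆)` with
coordinates `v`. -/
def herm (v : Fin 27 → K) : Matrix (Fin 3) (Fin 3) (Fin 8 → K) :=
  !![scal (lPart v 0), cPart v, conj (bPart v);
     conj (cPart v), scal (lPart v 1), aPart v;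
     bPart v, conj (aPart v), scal (lPart v 2)]

/-- The coordinates of an octonionic hermitian matrix, inverse to `herm`. -/
def readOff (H : Matrix (Fin 3) (Fin 3) (Fin 8 → K)) : Fin 27 → K :=
  coords (H 0 1) (H 2 0) (H 1 2) (fun k => re (H k k))

theorem readOff_herm (v : Fin 27 → K) : readOff (herm v) = v := by
  conv_rhs => rw [← coords_parts v]
  simp only [readOff, herm]
  congr 1
  ext k
  fin_cases k <;> simp [re, scal]

end ring

theorem conj_conj (x : Fin 8 → ℂ) : conj (conj x) = x := by
  ext i; by_cases h : i = 0 <;> simp [conj, h]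

theorem conj_add (x y : Fin 8 → ℂ) : conj (x + y) = conj x + conj y := by
  ext i; by_cases h : i = 0 <;> simp [conj, h]; ring

theorem conj_smul (r : ℂ) (x : Fin 8 → ℂ) : conj (r • x) = r • conj x := by
  ext i; by_cases h : i = 0 <;> simp [conj, h]

theorem conj_scal (r : ℂ) : conj (scal r) = scal r := by
  ext i; by_cases h : i = 0 <;> simp [conj, scal, h]

/-- `conj` as a linear map. -/
def conjLin : (Fin 8 → ℂ) →ₗ[ℂ] (Fin 8 → ℂ) where
  toFun := conj
  map_add' := conj_add
  map_smul' := conj_smul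

theorem conj_eq_self {x : Fin 8 → ℂ} (h : conj x = x) : scal (re x) = x := by
  ext i
  by_cases hi : i = 0
  · subst hi; simp [scal, re]
  · have := congrFun h i
    simp only [conj, hi, if_false] at this
    have : x i = 0 := by linear_combination -(1 / 2) * this
    simp [scal, hi, this]

theorem herm_readOff {H : Matrix (Fin 3) (Fin 3) (Fin 8 → ℂ)} (hH : ∀ i j, H i j = conj (H j i)) :
    herm (readOff H) = H := by
  have h1 : ∀ k, scal (re (H k k)) = H k k := fun k => conj_eq_self (hH k k).symm
  ext i j : 2
  simp only [herm, readOff, cPart_coords, bPart_coords, aPart_coords, lPart_coords, h1]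
  fin_cases i <;> fin_cases j <;> simp [← hH]

theorem herm_conj (v : Fin 27 → ℂ) (i j : Fin 3) : herm v i j = conj (herm v j i) := by
  fin_cases i <;> fin_cases j <;> simp [herm, conj_conj, conj_scal]

/-- `ᵗC H C` for a complex matrix `C`. -/
noncomputable def congrMat (C : Matrix (Fin 3) (Fin 3) ℂ) (H : Matrix (Fin 3) (Fin 3) (Fin 8 → ℂ)) :
    Matrix (Fin 3) (Fin 3) (Fin 8 → ℂ) :=
  Matrix.of fun i j => ∑ k, ∑ l, (C k i * C l j) • H k l

theorem congrMat_apply (C : Matrix (Fin 3) (Fin 3) ℂ) (H : Matrix (Fin 3) (Fin 3) (Fin 8 → ℂ))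
    (i j : Fin 3) (m : Fin 8) :
    congrMat C H i j m = ∑ k, ∑ l, (C k i * C l j) * H k l m := by
  simp [congrMat]

theorem congrMat_conj (C : Matrix (Fin 3) (Fin 3) ℂ) {H : Matrix (Fin 3) (Fin 3) (Fin 8 → ℂ)}
    (hH : ∀ i j, H i j = conj (H j i)) (i j : Fin 3) :
    congrMat C H i j = conj (congrMat C H j i) := by
  change _ = conjLin _
  simp only [congrMat, Matrix.of_apply, map_sum, map_smul]
  rw [Finset.sum_comm]
  refine Finset.sum_congr rfl fun k _ => Finset.sum_congr rfl fun l _ => ?_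
  rw [mul_comm (C l i), hH]; rfl

theorem congrMat_congrMat (C D : Matrix (Fin 3) (Fin 3) ℂ) (H : Matrix (Fin 3) (Fin 3) (Fin 8 → ℂ)) :
    congrMat C (congrMat D H) = congrMat (D * C) H := by
  ext i j m
  simp only [congrMat_apply, Matrix.mul_apply, Fin.sum_univ_three]
  ring

theorem herm_add (v w : Fin 27 → ℂ) : herm (v + w) = herm v + herm w := by
  ext i j m
  fin_cases i <;> fin_cases j <;>
    simp [herm, scal, conj, cPart, bPart, aPart, lPart, Pi.single_apply] <;> split_ifs <;> ring

theorem herm_smul (r : ℂ) (v : Fin 27 → ℂ) : herm (r • v) = r • herm v := by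
  ext i j m
  fin_cases i <;> fin_cases j <;>
    simp [herm, scal, conj, cPart, bPart, aPart, lPart, Pi.single_apply]

theorem readOff_add (G H : Matrix (Fin 3) (Fin 3) (Fin 8 → ℂ)) :
    readOff (G + H) = readOff G + readOff H := by
  ext i
  simp only [readOff, coords, Pi.add_apply, re, Matrix.add_apply]
  split_ifs <;> rfl

theorem readOff_smul (r : ℂ) (H : Matrix (Fin 3) (Fin 3) (Fin 8 → ℂ)) :
    readOff (r • H) = r • readOff H := by
  ext i
  simp only [readOff, coords, Pi.smul_apply, re, Matrix.smul_apply]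
  split_ifs <;> rfl

/-- The operation `C.A = ᵗC A C` on coordinates. -/
noncomputable def actSL (C : Matrix (Fin 3) (Fin 3) ℂ) : Module.End ℂ (Fin 27 → ℂ) where
  toFun v := readOff (congrMat C (herm v))
  map_add' v w := by
    rw [herm_add, ← readOff_add]; congr 1
    ext i j m
    simp [congrMat, Finset.sum_add_distrib]
  map_smul' r v := by
    rw [herm_smul, RingHom.id_apply, ← readOff_smul]; congr 1
    ext i j m
    simp only [congrMat, Fin.sum_univ_three, Matrix.of_apply, Matrix.smul_apply, Pi.add_apply,
      Pi.smul_apply, smul_eq_mul]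
    ring

theorem actSL_one : actSL 1 = 1 := by
  refine LinearMap.ext fun v => ?_
  have : congrMat 1 (herm v) = herm v := by
    ext i j m
    simp [congrMat, Matrix.one_apply]
  change readOff (congrMat 1 (herm v)) = v
  rw [this, readOff_herm]

theorem actSL_mul (C D : Matrix (Fin 3) (Fin 3) ℂ) : actSL C * actSL D = actSL (D * C) := by
  refine LinearMap.ext fun v => ?_
  change readOff (congrMat C (herm (readOff (congrMat D (herm v))))) = _
  rw [herm_readOff (congrMat_conj D (herm_conj v)), congrMat_congrMat]
  rfl

/-- The underlying matrix of an element of `SL_n(ℂ)`. -/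
def mat {n : ℕ} : SpecialLinearGroup (Fin n) ℂ →* Matrix (Fin n) (Fin n) ℂ where
  toFun T := T.1
  map_one' := rfl
  map_mul' _ _ := rfl

theorem mat_inv_mul {n : ℕ} (T : SpecialLinearGroup (Fin n) ℂ) : mat T⁻¹ * mat T = 1 := by
  rw [← map_mul, inv_mul_cancel, map_one]

/-- `SO_8(ℂ)`, acting on the octonions `ℂ^8` with its quadratic form `normSq`. -/
def SO8 : Subgroup (SpecialLinearGroup (Fin 8) ℂ) where
  carrier := {T | mat T * (mat T)ᵀ = 1}
  one_mem' := by simp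
  mul_mem' {S T} hS hT := by
    rw [Set.mem_ofPred_eq] at *
    rw [map_mul, transpose_mul, Matrix.mul_assoc, ← Matrix.mul_assoc (mat T), hT, Matrix.one_mul,
      hS]
  inv_mem' {T} hT := by
    rw [Set.mem_ofPred_eq] at *
    have h : mat T⁻¹ = (mat T)ᵀ := by
      rw [← Matrix.mul_one (mat T⁻¹), ← hT, ← Matrix.mul_assoc, mat_inv_mul, Matrix.one_mul]
    rw [h, transpose_transpose]
    exact mul_eq_one_comm.1 hT

/-- The stabilizer of the octonion `1` in `SL_8(ℂ)`. -/
def stabOne : Subgroup (SpecialLinearGroup (Fin 8) ℂ) where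
  carrier := {T | mat T *ᵥ scal 1 = scal 1}
  one_mem' := by simp
  mul_mem' {S T} hS hT := by
    rw [Set.mem_ofPred_eq] at *
    rw [map_mul, ← Matrix.mulVec_mulVec, hT, hS]
  inv_mem' {T} hT := by
    rw [Set.mem_ofPred_eq] at *
    conv_lhs => rw [← hT]
    rw [Matrix.mulVec_mulVec, mat_inv_mul, Matrix.one_mulVec]

/-- `SO_7(ℂ)`, the stabilizer of the octonion `1` in `SO_8(ℂ)`. -/
def SO7 : Subgroup (SpecialLinearGroup (Fin 8) ℂ) := SO8 ⊓ stabOne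

theorem SO7_scal (T : SO7) (r : ℂ) : mat T.1 *ᵥ scal r = scal r := by
  have h : (scal r : Fin 8 → ℂ) = r • scal 1 := by
    ext i; by_cases hi : i = 0 <;> simp [scal, hi]
  have h2 : mat T.1 *ᵥ scal 1 = scal 1 := T.2.2
  rw [h, Matrix.mulVec_smul, h2]

theorem SO7_re (T : SO7) (x : Fin 8 → ℂ) : re (mat T.1 *ᵥ x) = re x := by
  have h1 : (mat T.1)ᵀ * mat T.1 = 1 := mul_eq_one_comm.1 T.2.1
  have h2 : (mat T.1)ᵀ *ᵥ scal 1 = scal 1 := by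
    conv_lhs => rw [← SO7_scal T 1, Matrix.mulVec_mulVec, h1, Matrix.one_mulVec]
  have h3 : ∀ y : Fin 8 → ℂ, re y = scal 1 ⬝ᵥ y := fun y => by simp [re, scal]
  rw [h3, h3, Matrix.dotProduct_mulVec, ← Matrix.mulVec_transpose, h2]

theorem SO7_conj (T : SO7) (x : Fin 8 → ℂ) : mat T.1 *ᵥ conj x = conj (mat T.1 *ᵥ x) := by
  have h : ∀ y : Fin 8 → ℂ, conj y = scal (2 * re y) - y := fun y => by
    ext i; by_cases hi : i = 0
    · subst hi; simp [conj, scal, re]; ring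
    · simp [conj, scal, hi]
  rw [h, h, Matrix.mulVec_sub, SO7_scal, SO7_re]

/-- The operation `T.A` on coordinates: `T` is applied to the octonions `c, b, a`. -/
noncomputable def actSO (T : Matrix (Fin 8) (Fin 8) ℂ) : Module.End ℂ (Fin 27 → ℂ) where
  toFun v := coords (T *ᵥ cPart v) (T *ᵥ bPart v) (T *ᵥ aPart v) (lPart v)
  map_add' v w := by
    ext i
    simp only [coords, Pi.add_apply]
    split_ifs
    · exact congrFun (Matrix.mulVec_add T (cPart v) (cPart w)) _
    · exact congrFun (Matrix.mulVec_add T (bPart v) (bPart w)) _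
    · exact congrFun (Matrix.mulVec_add T (aPart v) (aPart w)) _
    · rfl
  map_smul' r v := by
    ext i
    simp only [coords, Pi.smul_apply, RingHom.id_apply]
    split_ifs
    · exact congrFun (Matrix.mulVec_smul T r (cPart v)) _
    · exact congrFun (Matrix.mulVec_smul T r (bPart v)) _
    · exact congrFun (Matrix.mulVec_smul T r (aPart v)) _
    · rfl

theorem actSO_one : actSO 1 = 1 := by
  refine LinearMap.ext fun v => ?_
  change coords _ _ _ _ = v
  simp only [Matrix.one_mulVec, coords_parts]

theorem actSO_mul (S T : Matrix (Fin 8) (Fin 8) ℂ) : actSO S * actSO T = actSO (S * T) := by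
  refine LinearMap.ext fun v => ?_
  change coords (S *ᵥ cPart (coords _ _ _ _)) (S *ᵥ bPart (coords _ _ _ _))
    (S *ᵥ aPart (coords _ _ _ _)) (lPart (coords _ _ _ _)) = coords _ _ _ _
  simp only [cPart_coords, bPart_coords, aPart_coords, lPart_coords, Matrix.mulVec_mulVec]

theorem actSO_readOff (T : SO7) (H : Matrix (Fin 3) (Fin 3) (Fin 8 → ℂ)) :
    actSO (mat T.1) (readOff H) = readOff (Matrix.of fun i j => mat T.1 *ᵥ H i j) := by
  change coords _ _ _ _ = coords _ _ _ _
  simp only [readOff, cPart_coords, bPart_coords, aPart_coords, lPart_coords, Matrix.of_apply,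
    SO7_re]

theorem herm_actSO (T : SO7) (v : Fin 27 → ℂ) :
    herm (actSO (mat T.1) v) = Matrix.of fun i j => mat T.1 *ᵥ herm v i j := by
  change herm (coords _ _ _ _) = _
  ext i j : 2
  simp only [herm, cPart_coords, bPart_coords, aPart_coords, lPart_coords]
  fin_cases i <;> fin_cases j <;> simp [SO7_scal, SO7_conj]

theorem actSO_commute (T : SO7) (C : Matrix (Fin 3) (Fin 3) ℂ) :
    actSO (mat T.1) * actSL C = actSL C * actSO (mat T.1) := by
  refine LinearMap.ext fun v => ?_
  change actSO (mat T.1) (readOff (congrMat C (herm v))) =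
    readOff (congrMat C (herm (actSO (mat T.1) v)))
  rw [actSO_readOff, herm_actSO]
  congr 1
  ext i j : 2
  simp only [congrMat, Matrix.of_apply, ← Matrix.mulVecLin_apply, map_sum, map_smul]

/-- The representation of `SO_7` on `J_3(𝕆)`. -/
noncomputable def repSO : SO7 →* Module.End ℂ (Fin 27 → ℂ) where
  toFun T := actSO (mat T.1)
  map_one' := actSO_one
  map_mul' _ _ := (actSO_mul _ _).symm

/-- The representation of `SL_3` on `J_3(𝕆)`: `C` acts as `A ↦ C⁻¹.A`, which is a left action. -/
noncomputable def repSL : SpecialLinearGroup (Fin 3) ℂ →* Module.End ℂ (Fin 27 → ℂ) where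
  toFun C := actSL (mat C⁻¹)
  map_one' := by rw [inv_one, map_one, actSL_one]
  map_mul' C D := by rw [_root_.mul_inv_rev, map_mul, actSL_mul]

/-- The representation of `SO_7 × SL_3` on `J_3(𝕆)`. -/
noncomputable def rep : SO7 × SpecialLinearGroup (Fin 3) ℂ →* Module.End ℂ (Fin 27 → ℂ) :=
  MonoidHom.noncommCoprod repSO repSL fun T _ => actSO_commute T _

/-- `rep` as a homomorphism to `GL_27(ℂ)`. -/
noncomputable def repGL : SO7 × SpecialLinearGroup (Fin 3) ℂ →* GL (Fin 27) ℂ :=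
  ((LinearMap.toMatrixAlgEquiv' (R := ℂ) (n := Fin 27) :
    Module.End ℂ (Fin 27 → ℂ) →* Matrix (Fin 27) (Fin 27) ℂ).comp rep).toHomUnits

section forms

variable {K : Type*} [CommRing K] [Algebra ℂ K]

/-- `det_𝕆(A) = λ₁λ₂λ₃ + 2 Re(cab) - λ₂|b|² - λ₁|a|² - λ₃|c|²`. -/
def detO (v : Fin 27 → K) : K :=
  lPart v 0 * lPart v 1 * lPart v 2 + 2 * re (mul (cPart v) (mul (aPart v) (bPart v)))
    - lPart v 1 * normSq (bPart v) - lPart v 0 * normSq (aPart v) - lPart v 2 * normSq (cPart v)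

/-- `φ(c,b,a) = ½ Re((c b̄ - b̄ c) a)`. -/
noncomputable def phi (c b a : Fin 8 → K) : K :=
  (1 / 2 : ℂ) • re (mul (mul c (conj b) - mul (conj b) c) a)

/-- The associator `[c,b,a] = (cb)a - c(ba)`. -/
def assoc (c b a : Fin 8 → K) : Fin 8 → K := mul (mul c b) a - mul c (mul b a)

/-- `Det² - 4 φ(c,b,a) Det - |[c,b,a]|²`. -/
noncomputable def sexticForm (v : Fin 27 → K) : K :=
  detO v ^ 2 - 4 * phi (cPart v) (bPart v) (aPart v) * detO v
    - normSq (assoc (cPart v) (bPart v) (aPart v))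

end forms

/-- The block matrix `[[λ₁ I, L_c, ᵗL_b], [ᵗL_c, λ₂ I, L_a], [L_b, ᵗL_a, λ₃ I]]` of size 24. -/
def MO {K : Type*} [CommRing K] (v : Fin 27 → K) : Matrix (Fin 3 × Fin 8) (Fin 3 × Fin 8) K :=
  Matrix.comp (Fin 3) (Fin 3) (Fin 8) (Fin 8) K
    !![lPart v 0 • 1, L (cPart v), (L (bPart v))ᵀ;
       (L (cPart v))ᵀ, lPart v 1 • 1, L (aPart v);
       L (bPart v), (L (aPart v))ᵀ, lPart v 2 • 1]

/-- The polynomial `S_ODM ∈ ℂ[x_1, …, x_27]`. -/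
noncomputable def sextic : MvPolynomial (Fin 27) ℂ := sexticForm MvPolynomial.X

/-- The matrix `M_𝕆` over `ℂ[x_1, …, x_27]`. -/
noncomputable def MOGen : Matrix (Fin 3 × Fin 8) (Fin 3 × Fin 8) (MvPolynomial (Fin 27) ℂ) :=
  MO MvPolynomial.X

theorem L_mem {K : Type*} [CommRing K] [Algebra ℂ K] (S : Submodule ℂ K) {x : Fin 8 → K}
    (hx : ∀ k, x k ∈ S) (i j : Fin 8) : L x i j ∈ S := by
  have h : ∀ k m, x k * (Pi.single j 1 : Fin 8 → K) m ∈ S := fun k m => by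
    by_cases hm : m = j
    · subst hm; simpa using hx k
    · simp [hm]
  have h' : ∀ {a : K} (k m), a ∈ S → a - x k * (Pi.single j 1 : Fin 8 → K) m ∈ S :=
    fun k m ha => S.sub_mem ha (h k m)
  have h'' : ∀ {a : K} (k m), a ∈ S → a + x k * (Pi.single j 1 : Fin 8 → K) m ∈ S :=
    fun k m ha => S.add_mem ha (h k m)
  rw [L, Matrix.of_apply]
  generalize (Pi.single j 1 : Fin 8 → K) = y at h h' h'' ⊢
  fin_cases i <;> simp only [mul, Fin.zero_eta, Fin.mk_one, Fin.reduceFinMk, Matrix.cons_val] <;>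
    repeat first | exact h _ _ | apply h' | apply h''

theorem MO_mem {K : Type*} [CommRing K] [Algebra ℂ K] (S : Submodule ℂ K) {v : Fin 27 → K}
    (hv : ∀ k, v k ∈ S) (p q : Fin 3 × Fin 8) : MO v p q ∈ S := by
  have hc : ∀ i j, L (cPart v) i j ∈ S := L_mem S fun _ => hv _
  have hb : ∀ i j, L (bPart v) i j ∈ S := L_mem S fun _ => hv _
  have ha : ∀ i j, L (aPart v) i j ∈ S := L_mem S fun _ => hv _
  have hs : ∀ k i j, (lPart v k • (1 : Matrix (Fin 8) (Fin 8) K)) i j ∈ S := fun k i j => by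
    by_cases h : i = j
    · subst h; simpa [lPart] using hv _
    · simp [h]
  obtain ⟨p1, p2⟩ := p
  obtain ⟨q1, q2⟩ := q
  rw [MO, Matrix.comp_apply]
  have key : ∀ a0 a1 a2 m1 m2 m3 : Matrix (Fin 8) (Fin 8) K, (∀ i j, a0 i j ∈ S) →
      (∀ i j, a1 i j ∈ S) → (∀ i j, a2 i j ∈ S) → (∀ i j, m1 i j ∈ S) → (∀ i j, m2 i j ∈ S) →
      (∀ i j, m3 i j ∈ S) →
      (!![a0, m1, m2ᵀ; m1ᵀ, a1, m3; m2, m3ᵀ, a2] : Matrix (Fin 3) (Fin 3) _) p1 q1 p2 q2 ∈ S := by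
    intro a0 a1 a2 m1 m2 m3 h0 h1 h2 h3 h4 h5
    fin_cases p1 <;> fin_cases q1
    exacts [h0 _ _, h3 _ _, h4 _ _, h3 _ _, h1 _ _, h5 _ _, h4 _ _, h5 _ _, h2 _ _]
  exact key _ _ _ _ _ _ (hs 0) (hs 1) (hs 2) hc hb ha

theorem MOGen_mem (p q : Fin 3 × Fin 8) : MOGen p q ∈ ProjSpace.grading 27 1 :=
  MO_mem (ProjSpace.grading 27 1) (fun k => MvPolynomial.isHomogeneous_X ℂ k) p q

/-- The projective space `ℙ^26 = ℙ(J_3(𝕆))`. -/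
noncomputable abbrev P26 : Scheme := ProjSpace.P 27

open Limits

instance : HasFiniteBiproducts P26.Modules := Abelian.hasFiniteBiproducts

/-- The morphism `ℂ^24 ⊗ 𝒪(-1) ⟶ ℂ^24 ⊗ 𝒪` of sheaves on `ℙ^26` given by `M_𝕆`. -/
noncomputable def phiM :
    (⨁ fun _ : Fin 3 × Fin 8 => SerreTwist.twist (ProjSpace.grading 27) (-((1 : ℕ) : ℤ))) ⟶
      (⨁ fun _ : Fin 3 × Fin 8 => SerreTwist.structureModule P26) :=
  biproduct.matrix fun q p => SerreTwist.mulHom (ProjSpace.grading 27) 1 ⟨MOGen p q, MOGen_mem p q⟩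

/-- The sheaf `E_ODM`, the cokernel of `M_𝕆`. -/
noncomputable def EODM : P26.Modules := cokernel phiM

/-- The image in `Γ(ℙ^26, E_ODM)` of `v ∈ ℂ^24`, viewed as a constant section of `ℂ^24 ⊗ 𝒪`. -/
noncomputable def constClass (v : Fin 3 × Fin 8 → ℂ) : Γ(EODM, ⊤) :=
  ∑ p, (biproduct.ι (fun _ : Fin 3 × Fin 8 => SerreTwist.structureModule P26) p ≫
    cokernel.π phiM).app ⊤ (ProjSpace.constSection 27 (v p))

/-- The stalk at `x` of the ideal sheaf of the hypersurface `S_ODM = 0`. -/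
noncomputable def sexticIdeal (x : P26) : Ideal (P26.presheaf.stalk x) :=
  ((Ideal.span {algebraMap _ (SerreTwist.Loc (ProjSpace.grading 27) x) sextic}).comap
    (algebraMap (SerreTwist.HLoc (ProjSpace.grading 27) x) _)).comap
      (Proj.stalkIso (ProjSpace.grading 27) x).hom.hom

/-- The hypersurface `S_ODM = 0` of `ℙ^26` as a set of points. -/
def sexticLocus : Set P26 := {x | sextic ∈ x.asHomogeneousIdeal}

/-- The action of `SO_7 × SL_3` on `ℙ^26`. -/
noncomputable def act : SO7 × SpecialLinearGroup (Fin 3) ℂ →* Aut P26 :=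
  (ProjSpace.projAut 27).comp repGL

/-- The triality relation `T₂(u v) = T₁(u) T₂(v)`. -/
def Triality (T₁ T₂ : SpecialLinearGroup (Fin 8) ℂ) : Prop :=
  ∀ u v : Fin 8 → ℂ, mat T₂ *ᵥ mul u v = mul (mat T₁ *ᵥ u) (mat T₂ *ᵥ v)

/-- The group of all pairs `(T₁, T₂)` in `SO_7 × SO_8` related by triality. -/
def Cover : Subgroup (SO7 × SO8) where
  carrier := {T | Triality T.1 T.2}
  one_mem' := fun u v => by simp
  mul_mem' {S T} hS hT := fun u v => by
    simp only [Prod.fst_mul, Prod.snd_mul, Subgroup.coe_mul, map_mul, ← Matrix.mulVec_mulVec]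
    rw [hT, hS]
  inv_mem' {T} hT := fun u v => by
    have h1 : ∀ (S : SpecialLinearGroup (Fin 8) ℂ) (w : Fin 8 → ℂ),
      mat S *ᵥ (mat S⁻¹ *ᵥ w) = w := fun S w => by
        rw [Matrix.mulVec_mulVec, ← map_mul, mul_inv_cancel, map_one, Matrix.one_mulVec]
    have h2 : ∀ (S : SpecialLinearGroup (Fin 8) ℂ) (w : Fin 8 → ℂ),
      mat S⁻¹ *ᵥ (mat S *ᵥ w) = w := fun S w => by
        rw [Matrix.mulVec_mulVec, mat_inv_mul, Matrix.one_mulVec]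
    have h := hT (mat (T.1.1)⁻¹ *ᵥ u) (mat (T.2.1)⁻¹ *ᵥ v)
    rw [h1, h1] at h
    exact (congrArg (mat (T.2.1)⁻¹ *ᵥ ·) h.symm).trans (h2 _ _)

/-- The projection `((T₁, T₂), C) ↦ (T₁, C)`. -/
def coverProj : Cover × SpecialLinearGroup (Fin 3) ℂ →* SO7 × SpecialLinearGroup (Fin 3) ℂ :=
  MonoidHom.prodMap ((MonoidHom.fst SO7 SO8).comp Cover.subtype) (MonoidHom.id _)

open scoped Kronecker in
/-- The representation of the cover on `ℂ^24 = ℂ^3 ⊗ 𝕆` by the matrices `ᵗ(C⁻¹) ⊗ T₂`. -/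
def rho : Cover × SpecialLinearGroup (Fin 3) ℂ →* Matrix (Fin 3 × Fin 8) (Fin 3 × Fin 8) ℂ where
  toFun g := (mat g.2⁻¹)ᵀ ⊗ₖ mat g.1.1.2.1
  map_one' := by simp
  map_mul' g h := by
    rw [← Matrix.mul_kronecker_mul, ← Matrix.transpose_mul, ← map_mul, ← map_mul,
      ← _root_.mul_inv_rev]
    rfl

end Octonion

/-! Left multiplications by imaginary octonions satisfy the Clifford relation, and apart from a few
coordinate computations this is all that is used of the octonions. Write P = L_x L_y L_z. Then P +
ᵗP is a scalar plus a symmetric traceless operator W, and W² is the scalar 4·Gram, where Gram is the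
Gram determinant of the imaginary parts of x, y, z (`triple_add_transpose`, `skewL_sq`,
`trace_skewL`). The formal 3×3 adjugate of M = M_𝕆, with the products of blocks suitably ordered,
multiplies M to a block diagonal matrix with blocks d + W_i, where d = Det − 2φ. The length of the
associator turns out to be Gram data as well, which gives S_ODM = d² − 4·Gram = (d + W_i)(d − W_i)
(`sexticForm_eq`). Multiplying by the d − W_i yields a matrix N with MN = S_ODM, so S_ODM kills the
cokernel.

Generic rank: where δ = λ₁λ₃ − |b|² is a unit, elimination of the outer blocks reduces coker M to
the cokernel of d + W on R⁸. Where d is a unit too, (d − W)/2d is idempotent modulo S_ODM with trace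
8·d/2d = 4, and its image is that cokernel (`nonempty_linearEquiv_fin_four`). These conditions hold
on a dense part of the sextic because S_ODM has no common factor with δd. The vanishing of the stalk
is governed by det M, a closed condition, so the support is the whole sextic.

Triality: SO_7 is covered by products of reflections in imaginary unit vectors u, and L_u covers the
negative of such a reflection. Two lifts differ by a matrix commuting with all L_z, which is a
scalar, and orthogonality makes it ±1.

Equivariance: M(gv) = ρ(g) M(v) ᵗρ(g), so ρ(g⁻¹) induces a morphism E → g_*E. A morphism out of E is
determined by its values on constant sections, so the cocycle condition reduces to multiplicativity
of ρ; adjunction then carries it over to g^*E → E.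

The stalks of E, defined only as a categorical cokernel, are computed by testing its universal
property on skyscraper modules. -/

namespace Octonion
open Matrix

/-! ### Left multiplications and the Clifford relation -/

section multiplication

variable {K : Type*} [CommRing K]

theorem funext_fin_eight {α : Type*} {f g : Fin 8 → α} (h0 : f 0 = g 0) (h1 : f 1 = g 1)
    (h2 : f 2 = g 2) (h3 : f 3 = g 3) (h4 : f 4 = g 4) (h5 : f 5 = g 5) (h6 : f 6 = g 6)
    (h7 : f 7 = g 7) : f = g := by
  funext i
  fin_cases i <;> assumption

theorem mul_apply (x y : Fin 8 → K) :
    mul x y 0 = x 0 * y 0 - x 1 * y 1 - x 2 * y 2 - x 3 * y 3 - x 4 * y 4 - x 5 * y 5 - x 6 * y 6 - x 7 * y 7 ∧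
    mul x y 1 = x 0 * y 1 + x 1 * y 0 + x 2 * y 3 - x 3 * y 2 + x 4 * y 5 - x 5 * y 4 - x 6 * y 7 + x 7 * y 6 ∧
    mul x y 2 = x 0 * y 2 - x 1 * y 3 + x 2 * y 0 + x 3 * y 1 + x 4 * y 6 + x 5 * y 7 - x 6 * y 4 - x 7 * y 5 ∧
    mul x y 3 = x 0 * y 3 + x 1 * y 2 - x 2 * y 1 + x 3 * y 0 + x 4 * y 7 - x 5 * y 6 + x 6 * y 5 - x 7 * y 4 ∧
    mul x y 4 = x 0 * y 4 - x 1 * y 5 - x 2 * y 6 - x 3 * y 7 + x 4 * y 0 + x 5 * y 1 + x 6 * y 2 + x 7 * y 3 ∧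
    mul x y 5 = x 0 * y 5 + x 1 * y 4 - x 2 * y 7 + x 3 * y 6 - x 4 * y 1 + x 5 * y 0 - x 6 * y 3 + x 7 * y 2 ∧
    mul x y 6 = x 0 * y 6 + x 1 * y 7 + x 2 * y 4 - x 3 * y 5 - x 4 * y 2 + x 5 * y 3 + x 6 * y 0 - x 7 * y 1 ∧
    mul x y 7 = x 0 * y 7 - x 1 * y 6 + x 2 * y 5 + x 3 * y 4 - x 4 * y 3 - x 5 * y 2 + x 6 * y 1 + x 7 * y 0 :=
  ⟨rfl, rfl, rfl, rfl, rfl, rfl, rfl, rfl⟩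

theorem conj_apply (x : Fin 8 → K) : conj x 0 = x 0 ∧ conj x 1 = -x 1 ∧ conj x 2 = -x 2 ∧
    conj x 3 = -x 3 ∧ conj x 4 = -x 4 ∧ conj x 5 = -x 5 ∧ conj x 6 = -x 6 ∧ conj x 7 = -x 7 :=
  ⟨rfl, rfl, rfl, rfl, rfl, rfl, rfl, rfl⟩

theorem scal_apply (r : K) : (scal r : Fin 8 → K) 0 = r ∧ (scal r : Fin 8 → K) 1 = 0 ∧
    (scal r : Fin 8 → K) 2 = 0 ∧ (scal r : Fin 8 → K) 3 = 0 ∧ (scal r : Fin 8 → K) 4 = 0 ∧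
    (scal r : Fin 8 → K) 5 = 0 ∧ (scal r : Fin 8 → K) 6 = 0 ∧ (scal r : Fin 8 → K) 7 = 0 :=
  ⟨rfl, rfl, rfl, rfl, rfl, rfl, rfl, rfl⟩

/-- `mul` as a bilinear map. -/
def mulBilin : (Fin 8 → K) →ₗ[K] (Fin 8 → K) →ₗ[K] (Fin 8 → K) :=
  LinearMap.mk₂ K mul
    (fun x y z => by
      apply funext_fin_eight <;> simp only [mul_apply, Pi.add_apply] <;> ring)
    (fun r x y => by
      apply funext_fin_eight <;> simp only [mul_apply, Pi.smul_apply, smul_eq_mul] <;> ring)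
    (fun x y z => by
      apply funext_fin_eight <;> simp only [mul_apply, Pi.add_apply] <;> ring)
    (fun r x y => by
      apply funext_fin_eight <;> simp only [mul_apply, Pi.smul_apply, smul_eq_mul] <;> ring)

theorem L_eq_toMatrix' (x : Fin 8 → K) : L x = LinearMap.toMatrix' (mulBilin x) := by
  ext i j
  rw [LinearMap.toMatrix'_apply]
  rfl

theorem L_mulVec (x y : Fin 8 → K) : L x *ᵥ y = mul x y := by
  rw [L_eq_toMatrix', LinearMap.toMatrix'_mulVec]
  rfl

theorem L_add (x y : Fin 8 → K) : L (x + y) = L x + L y := by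
  simp only [L_eq_toMatrix', map_add]

theorem L_smul (r : K) (x : Fin 8 → K) : L (r • x) = r • L x := by
  simp only [L_eq_toMatrix', map_smul]

theorem L_neg (x : Fin 8 → K) : L (-x) = -L x := by
  simp only [L_eq_toMatrix', map_neg]

theorem L_scal (r : K) : L (scal r) = r • (1 : Matrix (Fin 8) (Fin 8) K) := by
  refine Matrix.ext_of_mulVec_single fun j => ?_
  generalize (Pi.single j (1 : K) : Fin 8 → K) = y
  rw [L_mulVec, smul_mulVec, one_mulVec]
  apply funext_fin_eight <;>
    simp only [mul_apply, scal_apply, Pi.smul_apply, smul_eq_mul] <;> ring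

/-- The bilinear form polarizing `normSq`, on imaginary parts. -/
def dotIm (x y : Fin 8 → K) : K :=
  x 1 * y 1 + x 2 * y 2 + x 3 * y 3 + x 4 * y 4 + x 5 * y 5 + x 6 * y 6 + x 7 * y 7

theorem normSq_eq (x : Fin 8 → K) : normSq x = x 0 ^ 2 + dotIm x x := by
  simp only [normSq, dotIm, Fin.sum_univ_eight]
  ring

theorem dotIm_comm (x y : Fin 8 → K) : dotIm x y = dotIm y x := by
  simp only [dotIm]; ring

theorem L_transpose (x : Fin 8 → K) : (L x)ᵀ = L (conj x) := by
  have h : ∀ y z : Fin 8 → K, mul x y ⬝ᵥ z = y ⬝ᵥ mul (conj x) z := fun y z => by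
    simp only [dotProduct, Fin.sum_univ_eight, mul_apply, conj_apply]
    ring
  refine Matrix.ext_of_mulVec_single fun j => ?_
  generalize (Pi.single j (1 : K) : Fin 8 → K) = z
  rw [L_mulVec]
  refine (dotProduct_eq_iff.1 fun y => ?_)
  rw [dotProduct_comm, dotProduct_mulVec, vecMul_transpose, L_mulVec, h, dotProduct_comm]

theorem conj_eq (x : Fin 8 → K) : conj x = scal (2 * x 0) - x := by
  ext i
  by_cases hi : i = 0
  · subst hi; simp [conj, scal]; ring
  · simp [conj, scal, hi]

theorem L_transpose_eq (x : Fin 8 → K) : (L x)ᵀ = (2 * x 0) • 1 - L x := by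
  rw [L_transpose, conj_eq, sub_eq_add_neg, L_add, L_neg, L_scal, sub_eq_add_neg]

/-- Left alternativity x(xy) = x²y together with the quadratic equation satisfied by x. Polarizing
this identity produces the Clifford relation for imaginary octonions. -/
theorem L_mul_self (x : Fin 8 → K) : L x * L x = (2 * x 0) • L x - normSq x • 1 := by
  refine Matrix.ext_of_mulVec_single fun j => ?_
  generalize (Pi.single j (1 : K) : Fin 8 → K) = z
  simp only [← mulVec_mulVec, sub_mulVec, smul_mulVec, one_mulVec, L_mulVec]
  apply funext_fin_eight <;>
    simp only [mul_apply, normSq, Fin.sum_univ_eight, Pi.sub_apply, Pi.smul_apply, smul_eq_mul] <;>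
    ring

theorem transpose_L_mul_L (x : Fin 8 → K) : (L x)ᵀ * L x = normSq x • 1 := by
  rw [L_transpose_eq, sub_mul, L_mul_self, Matrix.smul_mul, one_mul]
  abel

theorem L_mul_transpose_L (x : Fin 8 → K) : L x * (L x)ᵀ = normSq x • 1 := by
  rw [L_transpose_eq, mul_sub, L_mul_self, Matrix.mul_smul, mul_one]
  abel

/-- The imaginary part of an octonion. -/
def im (x : Fin 8 → K) : Fin 8 → K := x - scal (x 0)

theorem L_eq_im (x : Fin 8 → K) : L x = x 0 • 1 + L (im x) := by
  conv_lhs => rw [show x = scal (x 0) + im x by simp [im]]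
  rw [L_add, L_scal]

theorem im_zero (x : Fin 8 → K) : im x 0 = 0 := by simp [im, scal]

theorem dotIm_im (x y : Fin 8 → K) : dotIm (im x) (im y) = dotIm x y := by
  simp [dotIm, im, scal]

/-- Polarization of `L_mul_self` at x + y. The form with `L y * L x` isolated serves as a rewriting
rule that sorts products. -/
theorem L_anticomm {x y : Fin 8 → K} (hx : x 0 = 0) (hy : y 0 = 0) :
    L y * L x = -(L x * L y) - (2 * dotIm x y) • 1 := by
  have h := L_mul_self (x + y)
  rw [L_add, add_mul, mul_add, mul_add, L_mul_self, L_mul_self] at h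
  have e : normSq (x + y) = normSq x + normSq y + 2 * dotIm x y := by
    simp [normSq_eq, dotIm, hx, hy]; ring
  rw [e] at h
  simp only [hx, hy, Pi.add_apply, add_zero, mul_zero, zero_smul, zero_sub, add_smul] at h
  rw [← sub_eq_zero] at h ⊢
  rw [← h]
  abel

theorem L_sq {x : Fin 8 → K} (hx : x 0 = 0) : L x * L x = -(dotIm x x) • 1 := by
  rw [L_mul_self, normSq_eq, hx]
  simp

end multiplication
end Octonion

/-! ### Triple products in an algebra with Clifford relations -/

section clifford

variable {K R : Type*} [CommRing K] [Ring R] [Algebra K R]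

/-- Half of ABC − CBA is the antisymmetrized product of A, B, C, a trivector, and a trivector
squares to the Gram determinant of its factors; hence the factor 4. -/
theorem sq_sub_reverse {A B C : R} {α β γ p q r : K} (hA : A * A = -α • (1 : R))
    (hB : B * B = -β • (1 : R)) (hC : C * C = -γ • (1 : R))
    (hBA : B * A = -(A * B) - (2 * p) • (1 : R)) (hCA : C * A = -(A * C) - (2 * q) • (1 : R))
    (hCB : C * B = -(B * C) - (2 * r) • (1 : R)) :
    (A * B * C - C * B * A) * (A * B * C - C * B * A) =
      (4 * (α * β * γ + 2 * p * q * r - α * r ^ 2 - β * q ^ 2 - γ * p ^ 2)) • (1 : R) := by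
  have lift : ∀ {X Y Z : R}, X * Y = Z → ∀ T : R, X * (Y * T) = Z * T := fun h T => by
    rw [← mul_assoc, h]
  -- Sorting CBA into the order A, B, C exhibits the trivector: the product ABC corrected by vector
  -- terms.
  have e : A * B * C - C * B * A =
      (2 : K) • (A * (B * C) + p • C - q • B + r • A) := by
    simp only [mul_assoc, hCA, hCB, lift hBA, mul_sub, sub_mul, mul_neg, neg_mul,
      smul_mul_assoc, mul_smul_comm, mul_one, one_mul]
    module
  rw [e]
  simp only [mul_assoc, hA, hB, hC, hBA, hCA, hCB, lift hBA, lift hCA, lift hCB, lift hA, lift hB,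
    mul_sub, sub_mul, mul_neg, neg_mul, smul_mul_assoc, mul_smul_comm, mul_one, one_mul,
    mul_add, add_mul]
  module

/-- The second product is the image of the first under the anti-involution negating A, B, C. In the
sum the terms linear in A, B, C cancel, the quadratic ones pair to anticommutators, hence to
scalars, and the cubic ones give ABC − CBA. -/
theorem add_reverse {A B C : R} {a b c p q r : K}
    (hBA : B * A = -(A * B) - (2 * p) • (1 : R)) (hCA : C * A = -(A * C) - (2 * q) • (1 : R))
    (hCB : C * B = -(B * C) - (2 * r) • (1 : R)) :
    (a • 1 + A) * (b • 1 + B) * (c • 1 + C) + (c • 1 - C) * (b • 1 - B) * (a • 1 - A) =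
      (2 * (a * b * c - a * r - b * q - c * p)) • (1 : R) + (A * B * C - C * B * A) := by
  simp only [mul_assoc, mul_sub, sub_mul, mul_neg, neg_mul, smul_mul_assoc, mul_smul_comm, mul_one,
    one_mul, mul_add, add_mul, hBA, hCA, hCB]
  module

end clifford

namespace Octonion
open Matrix

/-! ### Scalar and traceless parts of symmetrized triple products -/

section triple

variable {K : Type*} [CommRing K]

/-- Four times the Gram determinant of the imaginary parts. -/
def gram (x y z : Fin 8 → K) : K :=
  4 * (dotIm x x * dotIm y y * dotIm z z + 2 * dotIm x y * dotIm x z * dotIm y z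
    - dotIm x x * dotIm y z ^ 2 - dotIm y y * dotIm x z ^ 2 - dotIm z z * dotIm x y ^ 2)

/-- The scalar part of `L_x L_y L_z + ᵗ(L_x L_y L_z)`. -/
def tau (x y z : Fin 8 → K) : K :=
  2 * (x 0 * y 0 * z 0 - x 0 * dotIm y z - y 0 * dotIm x z - z 0 * dotIm x y)

theorem gram_rotate (x y z : Fin 8 → K) : gram y z x = gram x y z := by
  simp only [gram, dotIm_comm y x, dotIm_comm z x]; ring

theorem tau_rotate (x y z : Fin 8 → K) : tau y z x = tau x y z := by
  simp only [tau, dotIm_comm y x, dotIm_comm z x]; ring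

/-- The traceless part of `L_x L_y L_z + ᵗ(L_x L_y L_z)`. -/
def skewL (x y z : Fin 8 → K) : Matrix (Fin 8) (Fin 8) K :=
  L (im x) * L (im y) * L (im z) - L (im z) * L (im y) * L (im x)

theorem L_transpose_im (x : Fin 8 → K) : (L x)ᵀ = x 0 • 1 - L (im x) := by
  rw [L_transpose_eq, L_eq_im x]
  module

theorem triple_add_transpose (x y z : Fin 8 → K) :
    L x * L y * L z + (L z)ᵀ * (L y)ᵀ * (L x)ᵀ = tau x y z • 1 + skewL x y z := by
  rw [L_transpose_im, L_transpose_im, L_transpose_im, L_eq_im x, L_eq_im y, L_eq_im z,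
    add_reverse (L_anticomm (im_zero x) (im_zero y)) (L_anticomm (im_zero x) (im_zero z))
      (L_anticomm (im_zero y) (im_zero z))]
  simp only [dotIm_im, tau, skewL]

theorem skewL_sq (x y z : Fin 8 → K) : skewL x y z * skewL x y z = gram x y z • 1 := by
  rw [skewL, sq_sub_reverse (L_sq (im_zero x)) (L_sq (im_zero y)) (L_sq (im_zero z))
    (L_anticomm (im_zero x) (im_zero y)) (L_anticomm (im_zero x) (im_zero z))
    (L_anticomm (im_zero y) (im_zero z))]
  simp only [dotIm_im, gram]

/-- P + ᵗP is symmetric and differs from the operator by a scalar. -/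
theorem skewL_transpose (x y z : Fin 8 → K) : (skewL x y z)ᵀ = skewL x y z := by
  have h := congrArg transpose (triple_add_transpose x y z)
  simp only [transpose_add, transpose_mul, transpose_transpose, transpose_smul, transpose_one] at h
  rw [← add_right_inj (tau x y z • (1 : Matrix (Fin 8) (Fin 8) K)), ← h, ← triple_add_transpose,
    add_comm]
  simp only [mul_assoc]

theorem trace_triple (x y z : Fin 8 → K) :
    (L x * L y * L z).trace = 4 * tau x y z := by
  have h : ∀ A : Matrix (Fin 8) (Fin 8) K, A.trace =
      ∑ i, (A *ᵥ Pi.single i 1) i := fun A => by simp [Matrix.trace]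
  rw [h]
  simp only [← mulVec_mulVec, L_mulVec]
  rw [Fin.sum_univ_eight]
  have e : ∀ i j : Fin 8, (Pi.single i (1 : K) : Fin 8 → K) j = if j = i then 1 else 0 :=
    fun i j => Pi.single_apply _ _ _
  simp only [mul_apply, e, Fin.reduceEq, if_true, if_false, mul_one, mul_zero, add_zero, sub_zero,
    zero_add, zero_sub, tau, dotIm]
  ring

/-- Tracelessness is what makes the generic rank 4: the two eigenvalues ±√(4·Gram) share the eight
dimensions equally. -/
theorem trace_skewL (x y z : Fin 8 → K) : (skewL x y z).trace = 0 := by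
  have h := congrArg Matrix.trace (triple_add_transpose x y z)
  rw [trace_add, trace_add, trace_smul, trace_one, trace_triple,
    show (L z)ᵀ * (L y)ᵀ * (L x)ᵀ = (L x * L y * L z)ᵀ by
      simp only [transpose_mul, mul_assoc], trace_transpose, trace_triple] at h
  simp only [Fintype.card_fin, smul_eq_mul] at h
  push_cast at h
  linear_combination -h

end triple

end Octonion

namespace Octonion
open Matrix

/-! ### The sextic as a cubic squared minus a Gram determinant -/

section sexticForm

variable {K : Type*} [CommRing K]

/-- The cubic form `d = Det - 2 φ`, for which `S_ODM = d² - 4 Gram`. -/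
def cubicForm (v : Fin 27 → K) : K :=
  lPart v 0 * lPart v 1 * lPart v 2 + tau (cPart v) (aPart v) (bPart v)
    - lPart v 1 * normSq (bPart v) - lPart v 0 * normSq (aPart v) - lPart v 2 * normSq (cPart v)

/-- The form `4 Gram(Im c, Im a, Im b)`. -/
def gramForm (v : Fin 27 → K) : K := gram (cPart v) (aPart v) (bPart v)

theorem re_triple_sub (c b a : Fin 8 → K) :
    2 * re (mul c (mul a b)) - re (mul (mul c (conj b) - mul (conj b) c) a) = tau c a b := by
  simp only [re, mul_apply, conj_apply, Pi.sub_apply, tau, dotIm]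
  ring

/-- Apply W to the octonion 1. As W is symmetric with scalar square, W·1 has squared length 4·Gram.
Its real part is 2φ, and its imaginary part is the associator, which is purely imaginary. -/
theorem normSq_assoc (c b a : Fin 8 → K) :
    normSq (assoc c b a) =
      gram c a b - re (mul (mul c (conj b) - mul (conj b) c) a) ^ 2 := by
  set w := skewL c a b *ᵥ scal 1 with hw
  have h1 : w ⬝ᵥ w = gram c a b := by
    conv_lhs =>
      rw [hw, dotProduct_mulVec, ← mulVec_transpose, skewL_transpose, mulVec_mulVec, skewL_sq,
        smul_mulVec, one_mulVec]
    simp [scal]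
  have h2 : w = mul c (mul a b) + mul (conj b) (mul (conj a) (conj c)) - scal (tau c a b) := by
    have h := congrArg (· *ᵥ scal 1) (triple_add_transpose c a b)
    simp only [add_mulVec, smul_mulVec, one_mulVec, L_transpose, ← mulVec_mulVec, L_mulVec] at h
    have e : ∀ x : Fin 8 → K, mul x (scal 1) = x := fun x => by
      apply funext_fin_eight <;> simp only [mul_apply, scal_apply] <;> ring
    have e' : scal (tau c a b) = tau c a b • (scal 1 : Fin 8 → K) := by
      ext i; by_cases hi : i = 0 <;> simp [scal, hi]
    rw [e, e] at h
    rw [h, e', hw]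
    abel
  have h3 : ∀ i, assoc c b a i = if i = 0 then 0 else w i := by
    intro i
    rw [h2]
    revert i
    refine congrFun (funext_fin_eight ?_ ?_ ?_ ?_ ?_ ?_ ?_ ?_)
    · simp only [if_true, assoc, mul_apply, Pi.sub_apply]; ring
    all_goals
      simp only [Fin.reduceEq, if_false, assoc, mul_apply, conj_apply, scal_apply, Pi.add_apply,
        Pi.sub_apply]
      ring
  have h4 : w 0 = re (mul (mul c (conj b) - mul (conj b) c) a) := by
    rw [h2]
    simp only [re, mul_apply, conj_apply, scal_apply, Pi.sub_apply, Pi.add_apply, tau, dotIm]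
    ring
  rw [← h1, ← h4, normSq]
  simp only [h3, dotProduct, Fin.sum_univ_eight, Fin.reduceEq, if_false, if_true]
  ring

theorem sexticForm_eq [Algebra ℂ K] (v : Fin 27 → K) :
    sexticForm v = cubicForm v ^ 2 - gramForm v := by
  have h1 := re_triple_sub (cPart v) (bPart v) (aPart v)
  have h2 := normSq_assoc (cPart v) (bPart v) (aPart v)
  have h3 : ∀ z : K, 2 * ((1 / 2 : ℂ) • z) = z := fun z => by
    rw [two_mul, ← add_smul]; norm_num
  have h4 := h3 (re (mul (mul (cPart v) (conj (bPart v)) - mul (conj (bPart v)) (cPart v))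
    (aPart v)))
  rw [sexticForm, h2, phi, cubicForm, gramForm, detO, ← h1]
  generalize re (mul (mul (cPart v) (conj (bPart v)) - mul (conj (bPart v)) (cPart v))
    (aPart v)) = z at *
  linear_combination (-2 * (lPart v 0 * lPart v 1 * lPart v 2 +
    2 * re (mul (cPart v) (mul (aPart v) (bPart v)))
    - lPart v 1 * normSq (bPart v) - lPart v 0 * normSq (aPart v)
    - lPart v 2 * normSq (cPart v))) * h4

end sexticForm

/-! ### The adjugate and cofactor matrices of M -/

section adjugate

variable {K : Type*} [CommRing K]

/-- The minor `λ₁ λ₃ - |b|²`. -/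
def minorForm (v : Fin 27 → K) : K := lPart v 0 * lPart v 2 - normSq (bPart v)

/-- The block matrix `M² - tr M + σ`, a one-sided adjugate of `M_𝕆`. -/
def adjBlock (v : Fin 27 → K) : Matrix (Fin 3) (Fin 3) (Matrix (Fin 8) (Fin 8) K) :=
  let lc := L (cPart v)
  let lb := L (bPart v)
  let la := L (aPart v)
  !![(lPart v 1 * lPart v 2 - normSq (aPart v)) • 1, lbᵀ * laᵀ - lPart v 2 • lc,
      lc * la - lPart v 1 • lbᵀ;
     la * lb - lPart v 2 • lcᵀ, minorForm v • 1, lcᵀ * lbᵀ - lPart v 0 • la;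
     laᵀ * lcᵀ - lPart v 1 • lb, lb * lc - lPart v 0 • laᵀ,
      (lPart v 0 * lPart v 1 - normSq (cPart v)) • 1]

/-- `M_𝕆` as a matrix of blocks. -/
def blockM (v : Fin 27 → K) : Matrix (Fin 3) (Fin 3) (Matrix (Fin 8) (Fin 8) K) :=
  !![lPart v 0 • 1, L (cPart v), (L (bPart v))ᵀ;
     (L (cPart v))ᵀ, lPart v 1 • 1, L (aPart v);
     L (bPart v), (L (aPart v))ᵀ, lPart v 2 • 1]

/-- The traceless operators of the three diagonal blocks of `M (M² - tr M + σ) - Det + 2 φ`. -/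
def skewBlock (v : Fin 27 → K) : Fin 3 → Matrix (Fin 8) (Fin 8) K :=
  ![skewL (cPart v) (aPart v) (bPart v), skewL (aPart v) (bPart v) (cPart v),
    skewL (bPart v) (cPart v) (aPart v)]

theorem skewBlock_sq (v : Fin 27 → K) (i : Fin 3) :
    skewBlock v i * skewBlock v i = gramForm v • 1 := by
  fin_cases i
  · exact skewL_sq _ _ _
  · exact (skewL_sq _ _ _).trans (by rw [gram_rotate]; rfl)
  · exact (skewL_sq _ _ _).trans (by rw [gram_rotate, gram_rotate]; rfl)

/-- Off the diagonal everything cancels through `ᵗL_x L_x = L_x ᵗL_x = |x|²`. On the diagonal the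
triple product of c, a, b survives together with its transpose, cyclically rotated from block to
block; the scalar part is invariant under rotation, whereas W depends on the block. -/
theorem blockM_mul_adjBlock (v : Fin 27 → K) :
    blockM v * adjBlock v = diagonal fun i => cubicForm v • 1 + skewBlock v i := by
  have lift : ∀ {X Y Z : Matrix (Fin 8) (Fin 8) K}, X * Y = Z →
      ∀ T : Matrix (Fin 8) (Fin 8) K, X * (Y * T) = Z * T := fun h T => by
    rw [← mul_assoc, h]
  have ha := transpose_L_mul_L (aPart v)
  have hb := transpose_L_mul_L (bPart v)
  have hc := transpose_L_mul_L (cPart v)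
  have ha' := L_mul_transpose_L (aPart v)
  have hb' := L_mul_transpose_L (bPart v)
  have hc' := L_mul_transpose_L (cPart v)
  have hla := lift ha
  have hlb := lift hb
  have hlc := lift hc
  have hla' := lift ha'
  have hlb' := lift hb'
  have hlc' := lift hc'
  have h1 := triple_add_transpose (cPart v) (aPart v) (bPart v)
  have h2 := triple_add_transpose (aPart v) (bPart v) (cPart v)
  have h3 := triple_add_transpose (bPart v) (cPart v) (aPart v)
  rw [tau_rotate] at h2
  rw [tau_rotate, tau_rotate] at h3
  rw [mul_assoc, mul_assoc] at h1 h2 h3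
  -- Solved for the traceless operators, so that they can be replaced by products of the L's below.
  rw [← sub_eq_iff_eq_add'] at h1 h2 h3
  ext1 i j
  rw [Matrix.mul_apply, Fin.sum_univ_three]
  fin_cases i <;> fin_cases j <;>
    simp [blockM, adjBlock, skewBlock, cubicForm, minorForm] <;>
    simp only [← h1, ← h2, ← h3, mul_sub, ha, hb, hc, ha', hb', hc', hla, hlb, hlc, hla', hlb',
      hlc', Matrix.mul_smul, Matrix.smul_mul, one_mul] <;>
    module

theorem MO_eq_comp (v : Fin 27 → K) : MO v = compRingEquiv (Fin 3) (Fin 8) K (blockM v) := rfl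

/-- `M² - tr M + σ` as a matrix of size 24. -/
def adjM (v : Fin 27 → K) : Matrix (Fin 3 × Fin 8) (Fin 3 × Fin 8) K :=
  compRingEquiv (Fin 3) (Fin 8) K (adjBlock v)

/-- The block diagonal matrix with blocks `d + W_i`. -/
def diagM (v : Fin 27 → K) : Matrix (Fin 3 × Fin 8) (Fin 3 × Fin 8) K :=
  compRingEquiv (Fin 3) (Fin 8) K (diagonal fun i => cubicForm v • 1 + skewBlock v i)

theorem MO_mul_adjM (v : Fin 27 → K) : MO v * adjM v = diagM v := by
  rw [MO_eq_comp, adjM, ← map_mul, blockM_mul_adjBlock, diagM]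

theorem transpose_compRingEquiv (B : Matrix (Fin 3) (Fin 3) (Matrix (Fin 8) (Fin 8) K)) :
    (compRingEquiv (Fin 3) (Fin 8) K B)ᵀ = compRingEquiv (Fin 3) (Fin 8) K (Bᵀ.map (·ᵀ)) := rfl

theorem MO_transpose (v : Fin 27 → K) : (MO v)ᵀ = MO v := by
  rw [MO_eq_comp, transpose_compRingEquiv]
  congr 1
  ext1 i j
  fin_cases i <;> fin_cases j <;> simp [blockM]

theorem adjM_transpose (v : Fin 27 → K) : (adjM v)ᵀ = adjM v := by
  rw [adjM, transpose_compRingEquiv]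
  congr 1
  ext1 i j
  fin_cases i <;> fin_cases j <;> simp [adjBlock]

theorem skewBlock_transpose (v : Fin 27 → K) (i : Fin 3) : (skewBlock v i)ᵀ = skewBlock v i := by
  fin_cases i <;> exact skewL_transpose _ _ _

theorem diagM_transpose (v : Fin 27 → K) : (diagM v)ᵀ = diagM v := by
  rw [diagM, transpose_compRingEquiv]
  congr 1
  ext1 i j
  rw [map_apply, transpose_apply]
  by_cases h : i = j
  · subst h
    simp [skewBlock_transpose]
  · rw [diagonal_apply_ne' _ h, diagonal_apply_ne _ h, transpose_zero]

/-- All three matrices are symmetric, so transposing the product in the other order suffices. -/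
theorem adjM_mul_MO (v : Fin 27 → K) : adjM v * MO v = diagM v := by
  rw [← adjM_transpose, ← MO_transpose, ← transpose_mul, MO_mul_adjM, diagM_transpose]

/-- The cofactor matrix `N` with `M N = S_ODM`. -/
def cofactorM (v : Fin 27 → K) : Matrix (Fin 3 × Fin 8) (Fin 3 × Fin 8) K :=
  adjM v * compRingEquiv (Fin 3) (Fin 8) K (diagonal fun i => cubicForm v • 1 - skewBlock v i)

theorem cubic_add_mul_cubic_sub (v : Fin 27 → K) (i : Fin 3) :
    (cubicForm v • 1 + skewBlock v i) * (cubicForm v • 1 - skewBlock v i) =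
      (cubicForm v ^ 2 - gramForm v) • (1 : Matrix (Fin 8) (Fin 8) K) := by
  simp only [mul_sub, add_mul, skewBlock_sq, Matrix.smul_mul, Matrix.mul_smul, one_mul, mul_one]
  module

/-- Each diagonal block becomes (d + W)(d − W) = d² − 4·Gram, the sextic by `sexticForm_eq`. -/
theorem MO_mul_cofactorM [Algebra ℂ K] (v : Fin 27 → K) :
    MO v * cofactorM v = sexticForm v • 1 := by
  rw [cofactorM, ← mul_assoc, MO_mul_adjM, diagM, ← map_mul, diagonal_mul_diagonal]
  simp only [cubic_add_mul_cubic_sub, ← sexticForm_eq]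
  ext ⟨i, k⟩ ⟨j, l⟩
  rw [compRingEquiv_apply, comp_apply, Matrix.smul_apply, one_apply]
  by_cases h : i = j
  · subst h
    rw [diagonal_apply_eq, Matrix.smul_apply, one_apply]
    simp only [Prod.mk.injEq, true_and]
  · rw [diagonal_apply_ne _ h, if_neg (by simp [h]), Matrix.zero_apply, smul_zero]

theorem diagM_mulVec (v : Fin 27 → K) (y : Fin 3 × Fin 8 → K) (i : Fin 3) (k : Fin 8) :
    (diagM v *ᵥ y) (i, k) =
      ((cubicForm v • 1 + skewBlock v i) *ᵥ fun l => y (i, l)) k := by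
  rw [mulVec, dotProduct, Fintype.sum_prod_type, Finset.sum_eq_single i]
  · simp only [diagM, compRingEquiv_apply, comp_apply, diagonal_apply_eq]
    rfl
  · intro j _ hj
    simp only [diagM, compRingEquiv_apply, comp_apply, diagonal_apply_ne _ hj.symm, Matrix.zero_apply,
      zero_mul, Finset.sum_const_zero]
  · simp

end adjugate

/-! ### Base change of the forms and matrices -/

section functoriality

variable {K K' : Type*} [CommRing K] [CommRing K'] (f : K →+* K')

theorem mul_map (x y : Fin 8 → K) : mul (f ∘ x) (f ∘ y) = f ∘ mul x y := by
  apply funext_fin_eight <;>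
    simp only [mul_apply, Function.comp_apply, map_add, map_sub, map_mul]

theorem L_map (x : Fin 8 → K) : L (f ∘ x) = (L x).map f := by
  ext i j
  have : (Pi.single j (1 : K') : Fin 8 → K') = f ∘ Pi.single j 1 := by
    ext k; by_cases h : k = j
    · subst h; simp
    · simp [h]
  rw [L, of_apply, this, mul_map]
  rfl

theorem MO_map (v : Fin 27 → K) : MO (f ∘ v) = (MO v).map f := by
  have h : blockM (f ∘ v) = (blockM v).map (·.map f) := by
    have hc : cPart (f ∘ v) = f ∘ cPart v := rfl
    have hb : bPart (f ∘ v) = f ∘ bPart v := rfl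
    have ha : aPart (f ∘ v) = f ∘ aPart v := rfl
    have hl : ∀ i, lPart (f ∘ v) i = f (lPart v i) := fun _ => rfl
    have h1 : ∀ r : K, (f r • 1 : Matrix (Fin 8) (Fin 8) K') =
        (r • (1 : Matrix (Fin 8) (Fin 8) K)).map f := fun r => by
      ext i j; by_cases h : i = j
      · subst h; simp
      · simp [h]
    ext1 i j
    simp only [blockM, hc, hb, ha, hl, L_map, h1]
    fin_cases i <;> fin_cases j <;> rfl
  rw [MO_eq_comp, h]
  rfl

theorem dotIm_map (x y : Fin 8 → K) : dotIm (f ∘ x) (f ∘ y) = f (dotIm x y) := by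
  simp only [dotIm, Function.comp_apply, map_add, map_mul]

theorem normSq_map (x : Fin 8 → K) : normSq (f ∘ x) = f (normSq x) := by
  simp only [normSq, Function.comp_apply, map_sum, map_pow]

theorem tau_map (x y z : Fin 8 → K) : tau (f ∘ x) (f ∘ y) (f ∘ z) = f (tau x y z) := by
  simp only [tau, dotIm_map, Function.comp_apply, map_sub, map_mul, map_ofNat]

theorem gram_map (x y z : Fin 8 → K) : gram (f ∘ x) (f ∘ y) (f ∘ z) = f (gram x y z) := by
  simp only [gram, dotIm_map, map_add, map_sub, map_mul, map_ofNat, map_pow]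

theorem cubicForm_map (v : Fin 27 → K) : cubicForm (f ∘ v) = f (cubicForm v) := by
  simp only [cubicForm, map_sub, map_add, map_mul, ← tau_map, ← normSq_map]
  rfl

theorem gramForm_map (v : Fin 27 → K) : gramForm (f ∘ v) = f (gramForm v) := gram_map f _ _ _

theorem minorForm_map (v : Fin 27 → K) : minorForm (f ∘ v) = f (minorForm v) := by
  simp only [minorForm, map_sub, map_mul, ← normSq_map]
  rfl

theorem sexticForm_map [Algebra ℂ K] [Algebra ℂ K'] (v : Fin 27 → K) :
    sexticForm (f ∘ v) = f (sexticForm v) := by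
  simp only [sexticForm_eq, cubicForm_map, gramForm_map, map_sub, map_pow]

end functoriality
end Octonion

namespace Octonion
open Matrix

/-! ### Transformation of M under the double cover -/

section equivariance

/-- The triality relation in terms of left multiplications. -/
theorem triality_iff {T₁ T₂ : SpecialLinearGroup (Fin 8) ℂ} :
    Triality T₁ T₂ ↔ ∀ z, mat T₂ * L z = L (mat T₁ *ᵥ z) * mat T₂ := by
  constructor
  · intro h z
    refine Matrix.ext_of_mulVec_single fun j => ?_
    simp only [← mulVec_mulVec, L_mulVec]
    exact h _ _
  · intro h u v
    rw [← L_mulVec, mulVec_mulVec, h, ← mulVec_mulVec, L_mulVec]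

theorem SO8_transpose_mul (T : SO8) : (mat T.1)ᵀ * mat T.1 = 1 := mul_eq_one_comm.1 T.2

theorem Cover_L (T : Cover) (z : Fin 8 → ℂ) :
    L (mat T.1.1.1 *ᵥ z) = mat T.1.2.1 * L z * (mat T.1.2.1)ᵀ := by
  have h : mat T.1.2.1 * (mat T.1.2.1)ᵀ = 1 := T.1.2.2
  rw [triality_iff.1 T.2 z, mul_assoc, h, mul_one]

/-- Since `ᵗL_x = L_x̄`, the matrix M is the hermitian matrix A with every entry replaced by its
left multiplication. Hence T₁ acts by conjugating each block with T₂, and C acts on the block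
indices only. -/
theorem MO_apply (v : Fin 27 → ℂ) (p q : Fin 3 × Fin 8) :
    MO v p q = L (herm v p.1 q.1) p.2 q.2 := by
  have h : ∀ i j, blockM v i j = L (herm v i j) := by
    intro i j
    fin_cases i <;> fin_cases j <;>
      simp [blockM, herm, L_scal, L_transpose]
  rw [← h]
  rfl

open scoped Kronecker

theorem MO_actSO (T : Cover) (v : Fin 27 → ℂ) :
    MO (actSO (mat T.1.1.1) v) =
      ((1 : Matrix (Fin 3) (Fin 3) ℂ) ⊗ₖ mat T.1.2.1) * MO v *
        ((1 : Matrix (Fin 3) (Fin 3) ℂ) ⊗ₖ mat T.1.2.1)ᵀ := by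
  ext ⟨i, k⟩ ⟨j, l⟩
  rw [MO_apply, herm_actSO, of_apply, Cover_L]
  simp only [Matrix.mul_apply, Fintype.sum_prod_type, transpose_apply, kroneckerMap_apply,
    one_apply, MO_apply, ite_mul, mul_ite, one_mul, zero_mul, mul_zero, Finset.sum_ite_eq,
    Finset.sum_const_zero, Finset.sum_ite_irrel, Finset.mem_univ, if_true, Finset.sum_mul]

theorem MO_actSL (C : Matrix (Fin 3) (Fin 3) ℂ) (v : Fin 27 → ℂ) :
    MO (actSL C v) = (Cᵀ ⊗ₖ (1 : Matrix (Fin 8) (Fin 8) ℂ)) * MO v *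
      (Cᵀ ⊗ₖ (1 : Matrix (Fin 8) (Fin 8) ℂ))ᵀ := by
  ext ⟨i, k⟩ ⟨j, l⟩
  have h : herm (actSL C v) = congrMat C (herm v) := herm_readOff (congrMat_conj C (herm_conj v))
  rw [MO_apply, h, congrMat, of_apply, L_eq_toMatrix']
  simp only [map_sum, map_smul, ← L_eq_toMatrix', Matrix.sum_apply, Matrix.smul_apply, smul_eq_mul]
  simp only [Matrix.mul_apply, Fintype.sum_prod_type, transpose_apply, kroneckerMap_apply,
    one_apply, MO_apply, ite_mul, mul_ite, mul_one, zero_mul, mul_zero, Finset.sum_ite_eq,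
    Finset.mem_univ, if_true, Finset.sum_mul]
  rw [Finset.sum_comm]
  refine Finset.sum_congr rfl fun a _ => Finset.sum_congr rfl fun b _ => ?_
  ring

theorem MO_rep (g : Cover × SpecialLinearGroup (Fin 3) ℂ) (v : Fin 27 → ℂ) :
    MO (rep (coverProj g) v) = rho g * MO v * (rho g)ᵀ := by
  have h : rep (coverProj g) = actSO (mat g.1.1.1.1) * actSL (mat g.2⁻¹) := rfl
  have h2 : rho g = ((1 : Matrix (Fin 3) (Fin 3) ℂ) ⊗ₖ mat g.1.1.2.1) *
      ((mat g.2⁻¹)ᵀ ⊗ₖ (1 : Matrix (Fin 8) (Fin 8) ℂ)) := by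
    rw [← Matrix.mul_kronecker_mul, one_mul, mul_one]
    rfl
  rw [h, Module.End.mul_apply, MO_actSO g.1, MO_actSL, h2]
  simp only [transpose_mul, mul_assoc]

theorem subst_MOGen (g : Cover × SpecialLinearGroup (Fin 3) ℂ) :
    MOGen.map (ProjSpace.subst (repGL (coverProj g)).1) =
      (rho g).map MvPolynomial.C * MOGen * ((rho g)ᵀ).map MvPolynomial.C := by
  ext1 p q
  -- Over the infinite field ℂ it is enough to compare values at points, where `MO_rep` applies.
  refine MvPolynomial.funext fun w => ?_
  have h1 : ∀ A : Matrix (Fin 3 × Fin 8) (Fin 3 × Fin 8) ℂ,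
      (A.map (MvPolynomial.C (σ := Fin 27))).map (MvPolynomial.eval w) = A := fun A => by
    ext; simp
  have h2 : MOGen.map (MvPolynomial.eval w) = MO w := by
    rw [MOGen, ← MO_map]
    congr 1; ext i; simp
  have h3 : (MOGen.map (ProjSpace.subst (repGL (coverProj g)).1)).map (MvPolynomial.eval w) =
      MO (rep (coverProj g) w) := by
    have e : MOGen.map (ProjSpace.subst (repGL (coverProj g)).1) =
      MO ((ProjSpace.subst (repGL (coverProj g)).1).toRingHom ∘ MvPolynomial.X) :=
        (MO_map _ _).symm
    rw [e, ← MO_map]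
    congr 1
    have e2 : rep (coverProj g) w = (repGL (coverProj g)).1 *ᵥ w := by
      have : (repGL (coverProj g)).1 = LinearMap.toMatrix' (rep (coverProj g)) := rfl
      rw [this, LinearMap.toMatrix'_mulVec]
    rw [e2]
    ext i
    simp [ProjSpace.subst, mulVec, dotProduct]
  have h4 := congrFun₂ h3 p q
  rw [map_apply] at h4
  rw [h4, MO_rep]
  have h5 : ((rho g).map (MvPolynomial.C (σ := Fin 27)) * MOGen *
      (rho g)ᵀ.map MvPolynomial.C).map (MvPolynomial.eval w) = rho g * MO w * (rho g)ᵀ := by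
    rw [Matrix.map_mul, Matrix.map_mul, h1, h1, h2]
  exact (congrFun₂ h5 p q).symm

end equivariance
end Octonion

namespace Octonion
open Matrix

/-! ### Existence and uniqueness of triality lifts -/

section spin

theorem normSq_eq_dotProduct {K : Type*} [CommRing K] (x : Fin 8 → K) : normSq x = x ⬝ᵥ x := by
  simp only [normSq, dotProduct, sq]

/-- `L ᵗL = |x|²` determines the square of the determinant. For generic x the coordinate ring is a
domain, so one sign is valid for all x at once, and x = 1 decides it. -/
theorem det_L_generic : (L (MvPolynomial.X : Fin 8 → MvPolynomial (Fin 8) ℂ)).det =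
    normSq (MvPolynomial.X : Fin 8 → MvPolynomial (Fin 8) ℂ) ^ 4 := by
  set n := normSq (MvPolynomial.X : Fin 8 → MvPolynomial (Fin 8) ℂ) with hn
  set D := (L (MvPolynomial.X : Fin 8 → MvPolynomial (Fin 8) ℂ)).det with hD
  have h : D * D = n ^ 8 := by
    have := congrArg Matrix.det (L_mul_transpose_L (MvPolynomial.X : Fin 8 → MvPolynomial (Fin 8) ℂ))
    rw [det_mul, det_transpose, det_smul, det_one, mul_one, Fintype.card_fin] at this
    exact this
  have h2 : (D - n ^ 4) * (D + n ^ 4) = 0 := by linear_combination h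
  rcases mul_eq_zero.1 h2 with h3 | h3
  · exact sub_eq_zero.1 h3
  · exfalso
    have e : ⇑(MvPolynomial.eval (scal (1 : ℂ) : Fin 8 → ℂ)) ∘ MvPolynomial.X = scal 1 := by
      ext i; simp
    have h4 := congrArg (MvPolynomial.eval (scal (1 : ℂ))) h3
    rw [map_add, map_pow, hD, RingHom.map_det, RingHom.mapMatrix_apply, ← L_map, hn, ← normSq_map,
      e, L_scal, one_smul, det_one, normSq_eq_dotProduct] at h4
    norm_num [scal] at h4

theorem det_L (x : Fin 8 → ℂ) : (L x).det = normSq x ^ 4 := by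
  have e : ⇑(MvPolynomial.eval x) ∘ MvPolynomial.X = x := by
    ext i; simp
  have h := congrArg (MvPolynomial.eval x) det_L_generic
  rwa [RingHom.map_det, RingHom.mapMatrix_apply, ← L_map, map_pow, ← normSq_map, e] at h

/-- The reflection `z ↦ z - 2 ⟨u, z⟩ u` in a unit vector `u`. -/
def reflect (u : Fin 8 → ℂ) : Matrix (Fin 8) (Fin 8) ℂ := 1 - (2 : ℂ) • vecMulVec u u

theorem reflect_mulVec (u z : Fin 8 → ℂ) : reflect u *ᵥ z = z - (2 * (u ⬝ᵥ z)) • u := by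
  rw [reflect, sub_mulVec, one_mulVec, smul_mulVec, vecMulVec_mulVec]
  ext i
  simp
  ring

theorem reflect_transpose (u : Fin 8 → ℂ) : (reflect u)ᵀ = reflect u := by
  simp [reflect, transpose_vecMulVec]

theorem reflect_mul_self {u : Fin 8 → ℂ} (hu : u ⬝ᵥ u = 1) : reflect u * reflect u = 1 := by
  refine Matrix.ext_of_mulVec_single fun j => ?_
  rw [← mulVec_mulVec, reflect_mulVec, reflect_mulVec, dotProduct_sub, dotProduct_smul, hu,
    one_mulVec]
  ext i
  simp
  ring

theorem det_reflect {u : Fin 8 → ℂ} (hu : u ⬝ᵥ u = 1) : (reflect u).det = -1 := by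
  have h : reflect u = 1 + replicateCol Unit ((-2 : ℂ) • u) * replicateRow Unit u := by
    ext i j
    simp [reflect, vecMulVec_apply, Matrix.mul_apply]
    ring
  rw [h, det_one_add_replicateCol_mul_replicateRow, dotProduct_smul, hu]
  norm_num

/-- `A` is covered, up to its determinant, by an element of the spin group. -/
def HasSpinLift (A : Matrix (Fin 8) (Fin 8) ℂ) : Prop :=
  ∃ B : Matrix (Fin 8) (Fin 8) ℂ, B * Bᵀ = 1 ∧ B.det = 1 ∧
    ∀ z : Fin 8 → ℂ, z 0 = 0 → B * L z = L (A.det • (A *ᵥ z)) * B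

theorem hasSpinLift_one : HasSpinLift 1 :=
  ⟨1, by simp, by simp, fun z _ => by simp⟩

/-- For an imaginary unit vector u the Clifford relation gives L_u L_z = L_{z'} L_u with z' the
negative of the reflected vector; the determinant −1 of the reflection accounts for this sign. -/
theorem hasSpinLift_reflect {u : Fin 8 → ℂ} (hu : u ⬝ᵥ u = 1) (hu0 : u 0 = 0) :
    HasSpinLift (reflect u) := by
  refine ⟨L u, ?_, ?_, fun z hz => ?_⟩
  · rw [L_mul_transpose_L, normSq_eq_dotProduct, hu, one_smul]
  · rw [det_L, normSq_eq_dotProduct, hu, one_pow]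
  · have e : u ⬝ᵥ z = dotIm z u := by
      simp [dotProduct, Fin.sum_univ_eight, dotIm, hu0]; ring
    have e' : dotIm u u = 1 := by
      rw [← hu, dotProduct, Fin.sum_univ_eight, dotIm, hu0]; ring
    rw [det_reflect hu, reflect_mulVec, neg_one_smul, neg_sub, sub_eq_add_neg, L_add, L_neg,
      L_smul, add_mul, neg_mul, Matrix.smul_mul, L_sq hu0, L_anticomm hz hu0, e, e']
    module

theorem HasSpinLift.mul {A A' : Matrix (Fin 8) (Fin 8) ℂ} (h : HasSpinLift A)
    (h' : HasSpinLift A') (h0 : ∀ z : Fin 8 → ℂ, z 0 = 0 → (A' *ᵥ z) 0 = 0) :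
    HasSpinLift (A * A') := by
  obtain ⟨B, h1, h2, h3⟩ := h
  obtain ⟨B', h1', h2', h3'⟩ := h'
  refine ⟨B * B', ?_, ?_, fun z hz => ?_⟩
  · rw [transpose_mul, mul_assoc, ← mul_assoc B', h1', one_mul, h1]
  · rw [det_mul, h2, h2', one_mul]
  · rw [mul_assoc, h3' z hz, ← mul_assoc, h3 _ (by simp [h0 z hz]), mul_assoc, det_mul,
      mulVec_smul, smul_smul, mulVec_mulVec]

theorem reflect_zero {u : Fin 8 → ℂ} (hu0 : u 0 = 0) {z : Fin 8 → ℂ} (hz : z 0 = 0) :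
    (reflect u *ᵥ z) 0 = 0 := by
  simp [reflect_mulVec, hu0, hz]

/-- The usual reflection exchanging two vectors of equal length. Normalizing v − e needs a complex
square root, and it is possible exactly when v − e is not isotropic. -/
theorem exists_reflect {v e : Fin 8 → ℂ} (hv : v ⬝ᵥ v = 1) (he : e ⬝ᵥ e = 1)
    (h : (v - e) ⬝ᵥ (v - e) ≠ 0) :
    ∃ (u : Fin 8 → ℂ) (s : ℂ), u = s • (v - e) ∧ u ⬝ᵥ u = 1 ∧ reflect u *ᵥ v = e := by
  obtain ⟨s, hs⟩ := IsAlgClosed.exists_pow_nat_eq ((v - e) ⬝ᵥ (v - e))⁻¹ (n := 2) (by norm_num)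
  have h1 : s ^ 2 * ((v - e) ⬝ᵥ (v - e)) = 1 := by rw [hs, inv_mul_cancel₀ h]
  refine ⟨s • (v - e), s, rfl, ?_, ?_⟩
  · rw [dotProduct_smul, smul_dotProduct, smul_eq_mul, smul_eq_mul, ← h1]; ring
  · have h2 : (v - e) ⬝ᵥ (v - e) = 2 - 2 * (e ⬝ᵥ v) := by
      simp only [dotProduct_sub, sub_dotProduct, hv, he, dotProduct_comm v e]; ring
    have h3 : (v - e) ⬝ᵥ v = 1 - e ⬝ᵥ v := by rw [sub_dotProduct, hv]
    have h4 : 2 * (s * (1 - e ⬝ᵥ v)) * s = 1 := by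
      rw [h2] at h1
      linear_combination h1
    rw [reflect_mulVec, smul_dotProduct, smul_smul, h3, smul_eq_mul, h4, one_smul, sub_sub_cancel]

/-- Cartan–Dieudonné by induction on the number n of basis vectors not assumed fixed: reflections
bring the image of the basis vector with index 7 − n back to that vector without disturbing the
earlier ones. As n ≤ 7, the octonion 1 is always fixed, so all reflecting vectors are imaginary. -/
theorem hasSpinLift_of_fixes (n : ℕ) (hn : n ≤ 7) (A : Matrix (Fin 8) (Fin 8) ℂ)
    (hA : A * Aᵀ = 1)
    (hfix : ∀ i : Fin 8, i.1 + n ≤ 7 → A *ᵥ Pi.single i 1 = Pi.single i 1) : HasSpinLift A := by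
  induction n generalizing A with
  | zero =>
    have : A = 1 := Matrix.ext_of_mulVec_single fun i => by
      rw [hfix i (by omega), one_mulVec]
    rw [this]
    exact hasSpinLift_one
  | succ n ih =>
    have hA' : Aᵀ * A = 1 := mul_eq_one_comm.1 hA
    have hdot : ∀ x y : Fin 8 → ℂ, (A *ᵥ x) ⬝ᵥ (A *ᵥ y) = x ⬝ᵥ y := fun x y => by
      rw [dotProduct_mulVec, ← mulVec_transpose, mulVec_mulVec, hA', one_mulVec]
    have hsingle : ∀ i j : Fin 8, (Pi.single i (1 : ℂ) : Fin 8 → ℂ) ⬝ᵥ Pi.single j 1 =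
        if i = j then 1 else 0 := fun i j => by simp [Pi.single_apply, eq_comm]
    let k : Fin 8 := ⟨7 - n, by omega⟩
    let e : Fin 8 → ℂ := Pi.single k 1
    let v := A *ᵥ e
    have he : e ⬝ᵥ e = 1 := by simp [e]
    have hv : v ⬝ᵥ v = 1 := (hdot _ _).trans he
    have hvi : ∀ i : Fin 8, i.1 + (n + 1) ≤ 7 → v ⬝ᵥ Pi.single i 1 = 0 := fun i hi => by
      have hki : k ≠ i := fun h => by
        have : (7 - n) = i.1 := congrArg Fin.val h
        omega
      rw [← hfix i hi, hdot, hsingle, if_neg hki]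
    have hei : ∀ i : Fin 8, i.1 + (n + 1) ≤ 7 → e ⬝ᵥ Pi.single i 1 = 0 := fun i hi => by
      have hki : k ≠ i := fun h => by
        have : (7 - n) = i.1 := congrArg Fin.val h
        omega
      rw [hsingle, if_neg hki]
    -- Any orthogonal correction B that moves v to e and keeps the earlier basis vectors reduces A
    -- to the induction hypothesis. Orthogonality and the fixed vector 1 make B * A preserve
    -- imaginary octonions.
    have key : ∀ B : Matrix (Fin 8) (Fin 8) ℂ, B * Bᵀ = 1 → B *ᵥ v = e →
        (∀ i : Fin 8, i.1 + (n + 1) ≤ 7 → B *ᵥ Pi.single i 1 = Pi.single i 1) →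
        HasSpinLift (B * A) ∧ ∀ z : Fin 8 → ℂ, z 0 = 0 → ((B * A) *ᵥ z) 0 = 0 := by
      intro B hB hBv hBi
      have ho : B * A * (B * A)ᵀ = 1 := by
        rw [transpose_mul, mul_assoc, ← mul_assoc A, hA, one_mul, hB]
      have hf : ∀ i : Fin 8, i.1 + n ≤ 7 → (B * A) *ᵥ Pi.single i 1 = Pi.single i 1 := by
        intro i hi
        rw [← mulVec_mulVec]
        by_cases h : i.1 + (n + 1) ≤ 7
        · rw [hfix i h, hBi i h]
        · have : i = k := Fin.ext (show i.1 = 7 - n by omega)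
          rw [this]
          exact hBv
      refine ⟨ih (by omega) _ ho hf, fun z hz => ?_⟩
      have h1 : (B * A)ᵀ * (B * A) = 1 := mul_eq_one_comm.1 ho
      have h2 := hf 0 (by simp; omega)
      have h3 : ((B * A) *ᵥ z) 0 = Pi.single 0 1 ⬝ᵥ ((B * A) *ᵥ z) := by simp
      rw [h3]
      conv_lhs => enter [1]; rw [← h2]
      rw [dotProduct_mulVec, ← mulVec_transpose, mulVec_mulVec, h1, one_mulVec]
      simp [hz]
    have hk0 : e 0 = 0 := by
      have : (0 : Fin 8) ≠ k := fun h => by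
        have : 0 = 7 - n := congrArg Fin.val h
        omega
      simp [e, this]
    have hv0 : v 0 = 0 := by
      have := hvi 0 (by simp; omega)
      simpa using this
    have hrefl : ∀ u : Fin 8 → ℂ, u ⬝ᵥ u = 1 → reflect u * (reflect u)ᵀ = 1 := fun u hu => by
      rw [reflect_transpose, reflect_mul_self hu]
    have hri : ∀ (u : Fin 8 → ℂ) (i : Fin 8), u ⬝ᵥ Pi.single i 1 = 0 →
        reflect u *ᵥ Pi.single i 1 = Pi.single i 1 := fun u i h => by
      rw [reflect_mulVec, h, mul_zero, zero_smul, sub_zero]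
    -- Over ℂ the vector v − e can be isotropic. The squared lengths of v − e and v + e add up to 4,
    -- so then v + e is not isotropic; its reflection sends v to −e, and a reflection in e corrects
    -- the sign.
    by_cases h : (v - e) ⬝ᵥ (v - e) = 0
    · have h' : (v - -e) ⬝ᵥ (v - -e) ≠ 0 := by
        have e1 : (v - -e) ⬝ᵥ (v - -e) + (v - e) ⬝ᵥ (v - e) = 4 := by
          simp only [dotProduct_sub, sub_dotProduct, dotProduct_neg, neg_dotProduct, hv, he]; ring
        rw [h, add_zero] at e1
        rw [e1]; norm_num
      obtain ⟨u, s, hus, hu, huv⟩ := exists_reflect hv (by simpa using he) h'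
      have hu0 : u 0 = 0 := by simp [hus, hv0, hk0]
      have hui : ∀ i : Fin 8, i.1 + (n + 1) ≤ 7 → u ⬝ᵥ Pi.single i 1 = 0 := fun i hi => by
        rw [hus, smul_dotProduct, sub_dotProduct, neg_dotProduct, hvi i hi, hei i hi]; simp
      obtain ⟨l, hl⟩ := key (reflect e * reflect u)
        (by rw [transpose_mul, mul_assoc, ← mul_assoc (reflect u), hrefl u hu, one_mul, hrefl e he])
        (by
          rw [← mulVec_mulVec, huv, reflect_mulVec, dotProduct_neg, he]
          module)
        (fun i hi => by rw [← mulVec_mulVec, hri u i (hui i hi), hri e i (hei i hi)])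
      have : A = reflect u * (reflect e * (reflect e * reflect u * A)) := by
        rw [← mul_assoc (reflect e), ← mul_assoc (reflect e), reflect_mul_self he, one_mul,
          ← mul_assoc, reflect_mul_self hu, one_mul]
      rw [this]
      refine (hasSpinLift_reflect hu hu0).mul ((hasSpinLift_reflect he hk0).mul l hl) fun z hz => ?_
      rw [← mulVec_mulVec]
      exact reflect_zero hk0 (hl z hz)
    · obtain ⟨u, s, hus, hu, huv⟩ := exists_reflect hv he h
      have hu0 : u 0 = 0 := by simp [hus, hv0, hk0]
      have hui : ∀ i : Fin 8, i.1 + (n + 1) ≤ 7 → u ⬝ᵥ Pi.single i 1 = 0 := fun i hi => by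
        rw [hus, smul_dotProduct, sub_dotProduct, hvi i hi, hei i hi]; simp
      obtain ⟨l, hl⟩ := key (reflect u) (hrefl u hu) huv fun i hi => hri u i (hui i hi)
      have : A = reflect u * (reflect u * A) := by
        rw [← mul_assoc, reflect_mul_self hu, one_mul]
      rw [this]
      exact (hasSpinLift_reflect hu hu0).mul l hl

/-- The determinant of T₁ is 1, so the sign in the lift disappears. The lift handles imaginary
octonions, and real ones act by scalars fixed by T₁. -/
theorem exists_triality (T₁ : SO7) : ∃ T₂ : SO8, Triality T₁.1 T₂.1 := by
  obtain ⟨B, h1, h2, h3⟩ := hasSpinLift_of_fixes 7 le_rfl (mat T₁.1) T₁.2.1 fun i hi => by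
    have : i = 0 := Fin.ext (by simpa using hi)
    rw [this]
    exact T₁.2.2
  refine ⟨⟨⟨B, h2⟩, h1⟩, triality_iff.2 fun z => ?_⟩
  have hd : (mat T₁.1).det = 1 := T₁.1.2
  have h4 := h3 (im z) (im_zero z)
  rw [hd, one_smul] at h4
  change B * L z = L _ * B
  have e : mat T₁.1 *ᵥ z = scal (z 0) + mat T₁.1 *ᵥ im z := by
    rw [im, mulVec_sub, SO7_scal]; abel
  rw [e, L_add, L_scal, L_eq_im z, mul_add, add_mul, h4, Matrix.mul_smul, Matrix.smul_mul, mul_one,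
    one_mul]

/-- Such a Z is right multiplication by w = Z(1), and commutation says (xy)w = x(yw) for all x, y.
The only octonions w with this property are scalars. -/
theorem eq_smul_one_of_commute {Z : Matrix (Fin 8) (Fin 8) ℂ} (h : ∀ z, Z * L z = L z * Z) :
    ∃ r : ℂ, Z = r • 1 := by
  set w := Z *ᵥ scal 1 with hw
  have e : ∀ x : Fin 8 → ℂ, mul x (scal 1) = x := fun x => by
    apply funext_fin_eight <;> simp only [mul_apply, scal_apply] <;> ring
  have h1 : ∀ x, Z *ᵥ x = mul x w := fun x => by
    conv_lhs => rw [← e x, ← L_mulVec, mulVec_mulVec, h, ← mulVec_mulVec, L_mulVec]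
  have h2 : ∀ x y, mul (mul x y) w = mul x (mul y w) := fun x y => by
    rw [← h1, ← L_mulVec, mulVec_mulVec, h, ← mulVec_mulVec, L_mulVec, h1]
  have s : ∀ i j : Fin 8, (Pi.single i (1 : ℂ) : Fin 8 → ℂ) j = if j = i then 1 else 0 :=
    fun i j => Pi.single_apply _ _ _
  have h3 : ∀ i j k, mul (mul (Pi.single i 1) (Pi.single j 1)) w k =
      mul (Pi.single i 1) (mul (Pi.single j 1) w) k := fun i j k => congrFun (h2 _ _) k
  -- The pairs (i, j), (i, e), (j, e) suffice: coordinates of their associators with w are ±2 times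
  -- the imaginary coordinates of w, and each of the seven occurs.
  have h12 := h3 1 2
  have h14 := h3 1 4
  have a4 := h12 7
  have a5 := h12 6
  have a6 := h12 5
  have a7 := h12 4
  have a2 := h14 7
  have a3 := h14 6
  have a1 := h3 2 4 7
  simp only [mul_apply, s, Fin.reduceEq, if_true, if_false, mul_one, mul_zero, add_zero, sub_zero,
    zero_add, zero_sub, zero_mul, one_mul] at a1 a2 a3 a4 a5 a6 a7
  have hw' : w = scal (w 0) := by
    apply funext_fin_eight <;> simp only [scal_apply]
    · linear_combination (1 / 2) * a1
    · linear_combination -(1 / 2) * a2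
    · linear_combination (1 / 2) * a3
    · linear_combination (1 / 2) * a4
    · linear_combination -(1 / 2) * a5
    · linear_combination (1 / 2) * a6
    · linear_combination -(1 / 2) * a7
  refine ⟨w 0, Matrix.ext_of_mulVec_single fun j => ?_⟩
  rw [h1, hw', smul_mulVec, one_mulVec]
  apply funext_fin_eight <;>
    simp only [mul_apply, scal_apply, Pi.smul_apply, smul_eq_mul] <;> ring

theorem exists_triality_unique (T₁ : SO7) : ∃ T₂ : SO8, (T₁, T₂) ∈ Cover ∧
    (∀ z : Fin 8 → ℂ, L (mat T₁.1 *ᵥ z) = mat T₂.1 * L z * (mat T₂.1)⁻¹) ∧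
    ∀ T : SO8, (T₁, T) ∈ Cover ↔ (mat T.1 = mat T₂.1 ∨ mat T.1 = -mat T₂.1) := by
  obtain ⟨T₂, h⟩ := exists_triality T₁
  have h' := triality_iff.1 h
  have ho : mat T₂.1 * (mat T₂.1)ᵀ = 1 := T₂.2
  have ho' := SO8_transpose_mul T₂
  refine ⟨T₂, h, fun z => ?_, fun T => ⟨fun hT => ?_, ?_⟩⟩
  · rw [inv_eq_right_inv ho, h', mul_assoc, ho, mul_one]
  · have hT' := triality_iff.1 hT
    -- Both lifts intertwine L_z with the same operator, so T₂⁻¹T, which is ᵗT₂ T, commutes with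
    -- every L_z.
    obtain ⟨r, hr⟩ := eq_smul_one_of_commute (Z := (mat T₂.1)ᵀ * mat T.1) fun z => by
      have h5 : (mat T₂.1)ᵀ * L (mat T₁.1 *ᵥ z) = L z * (mat T₂.1)ᵀ := by
        rw [← mul_one (L (mat T₁.1 *ᵥ z)), ← ho, ← mul_assoc (L (mat T₁.1 *ᵥ z)), ← h',
          mul_assoc (mat T₂.1), ← mul_assoc, ho', one_mul]
      rw [mul_assoc, hT', ← mul_assoc, h5, mul_assoc]
    have hT2 : mat T.1 = r • mat T₂.1 := by
      rw [← one_mul (mat T.1), ← ho, mul_assoc, hr, Matrix.mul_smul, mul_one]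
    have hTo : mat T.1 * (mat T.1)ᵀ = 1 := T.2
    rw [hT2, transpose_smul, Matrix.smul_mul, Matrix.mul_smul, ho, smul_smul] at hTo
    have hr2 : r * r = 1 := by simpa using congrFun₂ hTo 0 0
    rcases mul_self_eq_one_iff.1 hr2 with rfl | rfl
    · left; rw [hT2, one_smul]
    · right; rw [hT2, neg_one_smul]
  · rintro (hT | hT)
    · exact triality_iff.2 fun z => by rw [hT]; exact h' z
    · exact triality_iff.2 fun z => by rw [hT, neg_mul, mul_neg]; exact congrArg _ (h' z)

end spin
end Octonion

/-! ### Ranks of idempotents over a local ring -/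

section idempotent

variable {k : Type*} [CommRing k] {M : Type*} [AddCommGroup M] [Module k M]

theorem isProj_range_of_isIdempotentElem {f : M →ₗ[k] M} (hf : IsIdempotentElem f) :
    LinearMap.IsProj (LinearMap.range f) f where
  map_mem x := ⟨x, rfl⟩
  map_id := by
    rintro _ ⟨y, rfl⟩
    exact LinearMap.congr_fun hf y

theorem free_range_of_isIdempotentElem [IsLocalRing k] [Module.Free k M] [Module.Finite k M]
    {f : M →ₗ[k] M} (hf : IsIdempotentElem f) :
    Module.Free k (LinearMap.range f) ∧ Module.Finite k (LinearMap.range f) := by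
  have hfin : Module.Finite k (LinearMap.range f) := Module.Finite.range f
  have hproj : Module.Projective k (LinearMap.range f) :=
    Module.Projective.of_split (LinearMap.range f).subtype f.rangeRestrict
      (LinearMap.ext fun x => Subtype.ext ((isProj_range_of_isIdempotentElem hf).map_id x.1 x.2))
  exact ⟨Module.free_of_flat_of_isLocalRing, hfin⟩

/-- The module is the direct sum of image and kernel. Both are images of idempotents, hence free
over the local ring, and the trace can be computed in a basis adapted to the sum. -/
theorem trace_eq_finrank_range_of_isIdempotentElem [IsLocalRing k] [Module.Free k M]
    [Module.Finite k M] {f : M →ₗ[k] M} (hf : IsIdempotentElem f) :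
    LinearMap.trace k M f = Module.finrank k (LinearMap.range f) := by
  have hker : LinearMap.ker f = LinearMap.range (1 - f) := by
    ext x
    constructor
    · intro hx
      exact ⟨x, by simp [LinearMap.mem_ker.1 hx]⟩
    · rintro ⟨y, rfl⟩
      have := LinearMap.congr_fun hf y
      simp only [Module.End.mul_apply] at this
      simp [this]
  obtain ⟨h1, h2⟩ := free_range_of_isIdempotentElem hf
  obtain ⟨h3, h4⟩ := free_range_of_isIdempotentElem hf.one_sub
  rw [← hker] at h3 h4
  exact (isProj_range_of_isIdempotentElem hf).trace

end idempotent

namespace Octonion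
open Matrix

/-! ### The cokernel of M over a local ring at a generic point of the sextic -/

section rankFour

variable {R : Type*} [CommRing R]

/-- The inclusion of the middle summand `R^8` into `R^24`. -/
def midIncl : (Fin 8 → R) →ₗ[R] (Fin 3 × Fin 8 → R) where
  toFun u p := if p.1 = 1 then u p.2 else 0
  map_add' u w := by ext p; by_cases h : p.1 = 1 <;> simp [h]
  map_smul' r u := by ext p; by_cases h : p.1 = 1 <;> simp [h]

/-- The middle block of `M (M² - tr M + σ)`. -/
def midBlock (v : Fin 27 → R) : Matrix (Fin 8) (Fin 8) R := cubicForm v • 1 + skewBlock v 1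

theorem diagM_mulVec_midIncl (v : Fin 27 → R) (u : Fin 8 → R) :
    diagM v *ᵥ midIncl u = midIncl (midBlock v *ᵥ u) := by
  ext ⟨i, k⟩
  rw [diagM_mulVec]
  by_cases h : i = 1
  · subst h; simp [midIncl, midBlock]
  · have : (fun l => midIncl u (i, l)) = 0 := by ext l; simp [midIncl, h]
    rw [this, mulVec_zero]; simp [midIncl, h]

theorem adjM_mulVec_midIncl (v : Fin 27 → R) (u : Fin 8 → R) (k : Fin 8) :
    (adjM v *ᵥ midIncl u) (1, k) = minorForm v * u k := by
  rw [mulVec, dotProduct, Fintype.sum_prod_type, Finset.sum_eq_single 1]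
  · simp [adjM, comp_apply, adjBlock, midIncl, one_apply]
  · intro j _ hj; simp [midIncl, hj]
  · simp

/-- If M y = (0, u, 0), multiplying by the adjugate and reading the middle component gives (d + W)y₁
= δu. Conversely, M maps adj·(0, y, 0) to (0, (d + W)y, 0). -/
theorem midIncl_mem_range_iff (v : Fin 27 → R) (hδ : IsUnit (minorForm v)) (u : Fin 8 → R) :
    midIncl u ∈ LinearMap.range (MO v).mulVecLin ↔ u ∈ LinearMap.range (midBlock v).mulVecLin := by
  constructor
  · rintro ⟨y, hy⟩
    rw [mulVecLin_apply] at hy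
    obtain ⟨δ, hδ⟩ := hδ
    refine ⟨(δ⁻¹.1) • fun l => y (1, l), ?_⟩
    have h := congrArg (adjM v *ᵥ ·) hy
    simp only [mulVec_mulVec, adjM_mul_MO] at h
    rw [mulVecLin_apply, mulVec_smul]
    ext k
    have h2 := congrFun h (1, k)
    rw [diagM_mulVec, adjM_mulVec_midIncl, ← hδ] at h2
    rw [Pi.smul_apply, midBlock, h2, smul_eq_mul, Units.inv_mul_cancel_left]
  · rintro ⟨y, rfl⟩
    refine ⟨adjM v *ᵥ midIncl y, ?_⟩
    rw [mulVecLin_apply, mulVec_mulVec, MO_mul_adjM, diagM_mulVec_midIncl, mulVecLin_apply]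

/-- The outer block matrix with rows (λ₁, ᵗL_b) and (L_b, λ₃) has inverse δ⁻¹ times the one with
rows (λ₃, −ᵗL_b) and (−L_b, λ₁), so the first and third components can be cleared modulo the image
of M. -/
theorem exists_midIncl_add (v : Fin 27 → R) (hδ : IsUnit (minorForm v)) (u : Fin 3 × Fin 8 → R) :
    ∃ (y : Fin 8 → R) (w : Fin 3 × Fin 8 → R), u = midIncl y + MO v *ᵥ w := by
  obtain ⟨δ, hδ⟩ := hδ
  let B := (L (bPart v))
  let u1 : Fin 8 → R := fun l => u (0, l)
  let u3 : Fin 8 → R := fun l => u (2, l)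
  let w1 : Fin 8 → R := δ⁻¹.1 • (lPart v 2 • u1 - Bᵀ *ᵥ u3)
  let w3 : Fin 8 → R := δ⁻¹.1 • (lPart v 0 • u3 - B *ᵥ u1)
  let w : Fin 3 × Fin 8 → R := fun p => ![w1, 0, w3] p.1 p.2
  have hw : ∀ i k, (MO v *ᵥ w) (i, k) =
      (blockM v i 0 *ᵥ w1) k + (blockM v i 2 *ᵥ w3) k := by
    intro i k
    rw [mulVec, dotProduct, Fintype.sum_prod_type, Fin.sum_univ_three]
    simp only [w, MO_eq_comp, compRingEquiv_apply, comp_apply]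
    simp [mulVec, dotProduct]
  have hu1 : lPart v 0 • w1 + Bᵀ *ᵥ w3 = u1 := by
    simp only [w1, w3, mulVec_smul, mulVec_sub, mulVec_mulVec, B, transpose_L_mul_L, smul_mulVec,
      one_mulVec]
    have : (minorForm v) • (δ⁻¹.1 • u1) = u1 := by
      rw [← hδ, smul_smul, Units.mul_inv, one_smul]
    conv_rhs => rw [← this]
    simp only [minorForm]
    module
  have hu3 : B *ᵥ w1 + lPart v 2 • w3 = u3 := by
    simp only [w1, w3, mulVec_smul, mulVec_sub, mulVec_mulVec, B, L_mul_transpose_L, smul_mulVec,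
      one_mulVec]
    have : (minorForm v) • (δ⁻¹.1 • u3) = u3 := by
      rw [← hδ, smul_smul, Units.mul_inv, one_smul]
    conv_rhs => rw [← this]
    simp only [minorForm]
    module
  refine ⟨fun l => u (1, l) - (MO v *ᵥ w) (1, l), w, ?_⟩
  ext ⟨i, k⟩
  rw [Pi.add_apply]
  fin_cases i
  · have := congrFun hu1 k
    simp [midIncl, hw, blockM, smul_mulVec]
    exact this.symm
  · simp [midIncl]
  · have := congrFun hu3 k
    simp [midIncl, hw, blockM, smul_mulVec]
    exact this.symm

/-- Put P = d + W and Q = d − W, so that PQ = S and P + Q = 2d is a unit. Then Q/2d is idempotent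
modulo S, and the map u ↦ Qu/2d mod S has kernel exactly im P. So coker M ≅ coker P is the image of
an idempotent over R/S, free of rank equal to its trace 4. -/
theorem nonempty_linearEquiv_fin_four [IsLocalRing R] [Algebra ℂ R] (v : Fin 27 → R)
    (hδ : IsUnit (minorForm v)) (hd : IsUnit (cubicForm v)) (hs : ¬ IsUnit (sexticForm v))
    {E : Type*} [AddCommGroup E] [Module R E] (π : (Fin 3 × Fin 8 → R) →ₗ[R] E)
    (hπ : Function.Surjective π) (hker : LinearMap.ker π = LinearMap.range (MO v).mulVecLin) :
    Nonempty (E ≃ₗ[R] (Fin 4 → R ⧸ Ideal.span {sexticForm v})) := by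
  set I := Ideal.span {sexticForm v} with hI
  have hIne : I ≠ ⊤ := by rwa [hI, Ne, Ideal.span_singleton_eq_top]
  have : Nontrivial (R ⧸ I) := Ideal.Quotient.nontrivial_iff.2 hIne
  have : IsLocalRing (R ⧸ I) :=
    IsLocalRing.of_surjective' (Ideal.Quotient.mk I) Ideal.Quotient.mk_surjective
  have h2 : IsUnit (2 : R) := by
    have := (IsUnit.mk0 (2 : ℂ) two_ne_zero).map (algebraMap ℂ R)
    rwa [map_ofNat] at this
  obtain ⟨c, hc⟩ := h2.mul hd
  set W := skewBlock v 1 with hW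
  set d := cubicForm v with hd'
  have hprod : midBlock v * (d • 1 - W) = sexticForm v • 1 := by
    rw [midBlock, sexticForm_eq]; exact cubic_add_mul_cubic_sub v 1
  have hsum : midBlock v + (d • 1 - W) = c.1 • 1 := by
    rw [midBlock, hc]; simp only [← hd', ← hW]; module
  let q := Ideal.Quotient.mk I
  let A : Matrix (Fin 8) (Fin 8) R := c⁻¹.1 • (d • 1 - W)
  let F := A.map q
  -- Substituting Q = 2d − P in one factor gives A² = A − (2d)⁻²·S.
  have hid : IsIdempotentElem (toLin' F) := by
    have e1 : A * A = A - (c⁻¹.1 * c⁻¹.1 * sexticForm v) • 1 := by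
      have : A * A = (c⁻¹.1 • (c.1 • 1 - midBlock v)) * A := by
        rw [← hsum, add_sub_cancel_left]
      rw [this, smul_sub, smul_smul, Units.inv_mul, one_smul, sub_mul, one_mul]
      simp only [A, Matrix.smul_mul, Matrix.mul_smul, hprod, smul_smul, mul_assoc]
    have e2 : F * F = F := by
      rw [← Matrix.map_mul, e1]
      ext i j
      have : q (sexticForm v) = 0 :=
        Ideal.Quotient.eq_zero_iff_mem.2 (Ideal.mem_span_singleton_self _)
      simp [F, this]
    rw [IsIdempotentElem, Module.End.mul_eq_comp, ← toLin'_mul, e2]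
  obtain ⟨hfree, hfin⟩ := free_range_of_isIdempotentElem hid
  have hrank : Module.finrank (R ⧸ I) (LinearMap.range (toLin' F)) = 4 := by
    have h := trace_eq_finrank_range_of_isIdempotentElem hid
    have ht : A.trace = 4 := by
      have hW0 : W.trace = 0 := trace_skewL _ _ _
      rw [trace_smul, trace_sub, trace_smul, trace_one, hW0, sub_zero, Fintype.card_fin,
        smul_eq_mul, smul_eq_mul]
      have : c⁻¹.1 * (2 * d) = 1 := by rw [← hc, Units.inv_mul]
      push_cast
      linear_combination 4 * this
    have ht' : F.trace = 4 := by
      rw [← AddMonoidHom.map_trace, ht, map_ofNat]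
    rw [Matrix.trace_toLin'_eq, ht'] at h
    -- The trace determines the rank only as an element of the ring; characteristic zero recovers
    -- the integer.
    have h0 : CharZero (R ⧸ I) := charZero_of_injective_algebraMap (algebraMap ℂ (R ⧸ I)).injective
    exact_mod_cast h.symm
  let e : LinearMap.range (toLin' F) ≃ₗ[R ⧸ I] (Fin 4 → R ⧸ I) :=
    (Module.finBasisOfFinrankEq (R ⧸ I) _ hrank).equivFun
  let g : (Fin 8 → R) →ₗ[R] (Fin 8 → R ⧸ I) :=
    ((toLin' F).restrictScalars R) ∘ₗ (LinearMap.compLeft (Algebra.linearMap R (R ⧸ I)) (Fin 8))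
  have hg : ∀ u, g u = q ∘ (A *ᵥ u) := fun u => by
    ext i
    simp [g, F, mulVec, dotProduct, q]
  have hg' : ∀ u, g u = toLin' F (fun i => q (u i)) := fun u => rfl
  have hrange : LinearMap.range g = (LinearMap.range (toLin' F)).restrictScalars R := by
    ext y
    constructor
    · rintro ⟨u, rfl⟩; exact ⟨_, (hg' u).symm⟩
    · rintro ⟨u, rfl⟩
      choose u' hu' using fun i => Ideal.Quotient.mk_surjective (u i)
      refine ⟨u', ?_⟩
      rw [hg']
      exact congrArg (toLin' F) (funext hu')
  have hkerg : LinearMap.ker g = LinearMap.range (midBlock v).mulVecLin := by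
    ext u
    rw [LinearMap.mem_ker, hg]
    constructor
    · intro h
      have h' : ∀ i, ∃ t, (A *ᵥ u) i = sexticForm v * t := fun i => by
        have := congrFun h i
        exact Ideal.mem_span_singleton.1 (Ideal.Quotient.eq_zero_iff_mem.1 this)
      choose t ht using h'
      have h3 : A *ᵥ u = midBlock v *ᵥ ((d • 1 - W) *ᵥ t) := by
        rw [mulVec_mulVec, hprod, smul_mulVec (sexticForm v), one_mulVec]
        exact funext ht
      -- From u = (P + Q)u/2d and Qu/2d = St = P(Qt) it follows that u = P(u/2d + Qt).
      refine ⟨c⁻¹.1 • u + (d • 1 - W) *ᵥ t, ?_⟩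
      rw [mulVecLin_apply, mulVec_add, ← h3]
      simp only [A]
      rw [mulVec_smul, smul_mulVec, ← smul_add, ← add_mulVec, hsum, smul_mulVec, one_mulVec,
        smul_smul, Units.inv_mul, one_smul]
    · rintro ⟨y, rfl⟩
      have hcomm : (d • 1 - W) * midBlock v = sexticForm v • 1 := by
        rw [← hprod, midBlock]
        simp only [← hd', ← hW, sub_mul, mul_sub, add_mul, mul_add, Matrix.smul_mul,
          Matrix.mul_smul, one_mul, mul_one]
        abel
      ext i
      rw [mulVecLin_apply, mulVec_mulVec]
      simp only [A, Matrix.smul_mul, hcomm, smul_mulVec, one_mulVec]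
      refine Ideal.Quotient.eq_zero_iff_mem.2 (Ideal.mem_span_singleton.2 ⟨c⁻¹.1 * y i, ?_⟩)
      simp only [Pi.smul_apply, smul_eq_mul]
      ring
  let p := π ∘ₗ midIncl
  have hp : Function.Surjective p := by
    intro x
    obtain ⟨u, rfl⟩ := hπ x
    obtain ⟨y, w, rfl⟩ := exists_midIncl_add v hδ u
    have : π (MO v *ᵥ w) = 0 := by
      rw [← LinearMap.mem_ker, hker]; exact ⟨w, rfl⟩
    exact ⟨y, by rw [map_add, this, add_zero]; rfl⟩
  have hkerp : LinearMap.ker p = LinearMap.ker g := by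
    rw [hkerg]
    ext u
    rw [← midIncl_mem_range_iff v hδ, ← hker]
    rfl
  exact ⟨((p.quotKerEquivOfSurjective hp).symm.trans (Submodule.quotEquivOfEq _ _ hkerp)).trans
    ((g.quotKerEquivRange.trans (LinearEquiv.ofEq _ _ hrange)).trans (e.restrictScalars R))⟩

end rankFour

end Octonion

namespace Octonion
open Matrix

/-! ### Homogeneity of the forms, and coprimality along a test line -/

section forms

open MvPolynomial

theorem isHomogeneous_dotIm {x y : Fin 8 → MvPolynomial (Fin 27) ℂ} {m n : ℕ}
    (hx : ∀ i, (x i).IsHomogeneous m) (hy : ∀ i, (y i).IsHomogeneous n) :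
    (dotIm x y).IsHomogeneous (m + n) := by
  have h : ∀ i, (x i * y i).IsHomogeneous (m + n) := fun i => (hx i).mul (hy i)
  exact ((((((h 1).add (h 2)).add (h 3)).add (h 4)).add (h 5)).add (h 6)).add (h 7)

theorem isHomogeneous_normSq {x : Fin 8 → MvPolynomial (Fin 27) ℂ} {n : ℕ}
    (hx : ∀ i, (x i).IsHomogeneous n) : (normSq x).IsHomogeneous (n * 2) :=
  IsHomogeneous.sum _ _ _ fun i _ => (hx i).pow 2

theorem isHomogeneous_ofNat_mul {p : MvPolynomial (Fin 27) ℂ} {n : ℕ} (k : ℕ) [k.AtLeastTwo]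
    (hp : p.IsHomogeneous n) : (OfNat.ofNat k * p).IsHomogeneous n := by
  rw [show (OfNat.ofNat k : MvPolynomial (Fin 27) ℂ) = C (OfNat.ofNat k) from (map_ofNat _ k).symm]
  exact hp.C_mul _

theorem isHomogeneous_minorForm :
    (minorForm (X : Fin 27 → MvPolynomial (Fin 27) ℂ)).IsHomogeneous 2 :=
  ((isHomogeneous_X ℂ _).mul (isHomogeneous_X ℂ _)).sub
    (isHomogeneous_normSq fun _ => isHomogeneous_X ℂ _)

theorem isHomogeneous_cubicForm :
    (cubicForm (X : Fin 27 → MvPolynomial (Fin 27) ℂ)).IsHomogeneous 3 := by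
  have hc : ∀ i, (cPart (X : Fin 27 → MvPolynomial (Fin 27) ℂ) i).IsHomogeneous 1 :=
    fun _ => isHomogeneous_X ℂ _
  have hb : ∀ i, (bPart (X : Fin 27 → MvPolynomial (Fin 27) ℂ) i).IsHomogeneous 1 :=
    fun _ => isHomogeneous_X ℂ _
  have ha : ∀ i, (aPart (X : Fin 27 → MvPolynomial (Fin 27) ℂ) i).IsHomogeneous 1 :=
    fun _ => isHomogeneous_X ℂ _
  have hl : ∀ i, (lPart (X : Fin 27 → MvPolynomial (Fin 27) ℂ) i).IsHomogeneous 1 :=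
    fun _ => isHomogeneous_X ℂ _
  have htau := isHomogeneous_ofNat_mul 2 (((((hc 0).mul (ha 0)).mul (hb 0)).sub
    ((hc 0).mul (isHomogeneous_dotIm ha hb))).sub ((ha 0).mul (isHomogeneous_dotIm hc hb)) |>.sub
      ((hb 0).mul (isHomogeneous_dotIm hc ha)))
  exact ((((((hl 0).mul (hl 1)).mul (hl 2)).add htau).sub
    ((hl 1).mul (isHomogeneous_normSq hb))).sub ((hl 0).mul (isHomogeneous_normSq ha))).sub
      ((hl 2).mul (isHomogeneous_normSq hc))

theorem isHomogeneous_gramForm :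
    (gramForm (X : Fin 27 → MvPolynomial (Fin 27) ℂ)).IsHomogeneous 6 := by
  have hc : ∀ i, (cPart (X : Fin 27 → MvPolynomial (Fin 27) ℂ) i).IsHomogeneous 1 :=
    fun _ => isHomogeneous_X ℂ _
  have hb : ∀ i, (bPart (X : Fin 27 → MvPolynomial (Fin 27) ℂ) i).IsHomogeneous 1 :=
    fun _ => isHomogeneous_X ℂ _
  have ha : ∀ i, (aPart (X : Fin 27 → MvPolynomial (Fin 27) ℂ) i).IsHomogeneous 1 :=
    fun _ => isHomogeneous_X ℂ _
  have cc := isHomogeneous_dotIm hc hc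
  have aa := isHomogeneous_dotIm ha ha
  have bb := isHomogeneous_dotIm hb hb
  have ca := isHomogeneous_dotIm hc ha
  have cb := isHomogeneous_dotIm hc hb
  have ab := isHomogeneous_dotIm ha hb
  exact isHomogeneous_ofNat_mul 4 ((((((cc.mul aa).mul bb).add
    (((isHomogeneous_ofNat_mul 2 ca).mul cb).mul ab)).sub (cc.mul (ab.pow 2))).sub
      (aa.mul (cb.pow 2))).sub (bb.mul (ca.pow 2)))

theorem sextic_eq : sextic = cubicForm X ^ 2 - gramForm X := sexticForm_eq X

theorem isHomogeneous_sextic : sextic.IsHomogeneous 6 := by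
  rw [sextic_eq]
  exact (isHomogeneous_cubicForm.pow 2).sub isHomogeneous_gramForm

/-- An affine line in `ℂ^27` along which `sextic` keeps its degree. -/
noncomputable def testLine : Fin 27 → Polynomial ℂ :=
  coords (Pi.single 1 1) (Pi.single 3 1) (Pi.single 2 1)
    ![Polynomial.X, Polynomial.X, -Polynomial.X]

theorem dotIm_single (i j : Fin 8) (hi : i ≠ 0) :
    dotIm (Pi.single i (1 : Polynomial ℂ) : Fin 8 → Polynomial ℂ) (Pi.single j 1) =
      if i = j then 1 else 0 := by
  have h : dotIm (Pi.single i (1 : Polynomial ℂ) : Fin 8 → Polynomial ℂ) (Pi.single j 1) =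
      (Pi.single i (1 : Polynomial ℂ) : Fin 8 → Polynomial ℂ) ⬝ᵥ Pi.single j 1 := by
    rw [dotProduct, Fin.sum_univ_eight, Pi.single_eq_of_ne (M := fun _ => Polynomial ℂ) hi.symm 1,
      dotIm]
    ring
  rw [h]
  simp [Pi.single_apply, eq_comm]

theorem normSq_single (i : Fin 8) (hi : i ≠ 0) :
    normSq (Pi.single i (1 : Polynomial ℂ) : Fin 8 → Polynomial ℂ) = 1 := by
  rw [normSq_eq, dotIm_single i i hi, if_pos rfl,
    Pi.single_eq_of_ne (M := fun _ => Polynomial ℂ) hi.symm 1]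
  ring

theorem minorForm_testLine : minorForm testLine = -Polynomial.X ^ 2 - 1 := by
  rw [minorForm, testLine, lPart_coords, bPart_coords, normSq_single _ (by decide)]
  simp
  ring

/-- On the line c, a, b are orthonormal imaginary units, so `tau` vanishes and 4·Gram is 4. With λ =
(t, t, −t) the cubic becomes tδ and the sextic (tδ)² − 4, which cannot vanish together with tδ. -/
theorem cubicForm_testLine : cubicForm testLine = Polynomial.X * minorForm testLine := by
  rw [minorForm_testLine, cubicForm, testLine, lPart_coords, bPart_coords, cPart_coords,
    aPart_coords, normSq_single _ (by decide), normSq_single _ (by decide),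
    normSq_single _ (by decide), tau, dotIm_single _ _ (by decide), dotIm_single _ _ (by decide),
    dotIm_single _ _ (by decide)]
  simp
  ring

theorem gramForm_testLine : gramForm testLine = 4 := by
  simp [gramForm, testLine, gram, bPart_coords, cPart_coords, aPart_coords, dotIm_single]

theorem aeval_sextic_testLine : aeval testLine sextic =
    (Polynomial.X * minorForm testLine) ^ 2 - 4 := by
  have h : ⇑((aeval testLine : MvPolynomial (Fin 27) ℂ →ₐ[ℂ] Polynomial ℂ) :
      MvPolynomial (Fin 27) ℂ →+* Polynomial ℂ) ∘ X = testLine := by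
    ext1 i; simp
  have h2 := sexticForm_map ((aeval testLine : MvPolynomial (Fin 27) ℂ →ₐ[ℂ] Polynomial ℂ) :
      MvPolynomial (Fin 27) ℂ →+* Polynomial ℂ) X
  rw [h, sexticForm_eq, cubicForm_testLine, gramForm_testLine] at h2
  exact h2.symm

theorem natDegree_sextic_testLine : (aeval testLine sextic).natDegree = 6 := by
  rw [aeval_sextic_testLine, minorForm_testLine]
  compute_degree!

theorem natDegree_testLine_le (i : Fin 27) : (testLine i).natDegree ≤ 1 := by
  have h1 : ∀ i j : Fin 8, ((Pi.single i 1 : Fin 8 → Polynomial ℂ) j).natDegree ≤ 1 := by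
    intro i j
    rw [Pi.single_apply]
    split_ifs <;> simp
  simp only [testLine, coords]
  split_ifs
  · exact h1 _ _
  · exact h1 _ _
  · exact h1 _ _
  · generalize (⟨i.1 - 24, _⟩ : Fin 3) = j
    fin_cases j <;> simp

theorem sextic_ne_zero : sextic ≠ 0 := fun h => by
  have := natDegree_sextic_testLine
  rw [h, map_zero] at this
  simp at this

theorem natDegree_aeval_le (p : MvPolynomial (Fin 27) ℂ) :
    (aeval testLine p).natDegree ≤ p.totalDegree := by
  simpa using MvPolynomial.aeval_natDegree_le p le_rfl testLine natDegree_testLine_le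

/-- The sextic keeps its degree on the test line, so each of its factors does. A nonconstant common
factor with δd would then have a root on the line, and there (tδ)² = 4 and tδ² = 0 would both hold.
-/
theorem isRelPrime_sextic : IsRelPrime sextic
    (minorForm (X : Fin 27 → MvPolynomial (Fin 27) ℂ) * cubicForm X) := by
  intro d hd hd'
  obtain ⟨q, hq⟩ := hd
  have hd0 : d ≠ 0 := fun h => sextic_ne_zero (by rw [hq, h, zero_mul])
  have hq0 : q ≠ 0 := fun h => sextic_ne_zero (by rw [hq, h, mul_zero])
  have h1 : d.totalDegree + q.totalDegree = 6 := by
    rw [← totalDegree_mul_of_isDomain hd0 hq0, ← hq,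
      isHomogeneous_sextic.totalDegree sextic_ne_zero]
  have h2 : (aeval testLine d).natDegree + (aeval testLine q).natDegree = 6 := by
    have h3 : aeval testLine d * aeval testLine q ≠ 0 := by
      rw [← map_mul, ← hq]
      intro h
      have := natDegree_sextic_testLine
      rw [h] at this
      simp at this
    rw [← Polynomial.natDegree_mul (left_ne_zero_of_mul h3) (right_ne_zero_of_mul h3), ← map_mul,
      ← hq, natDegree_sextic_testLine]
  have h3 := natDegree_aeval_le d
  have h4 := natDegree_aeval_le q
  by_contra hu
  have h5 : d.totalDegree ≠ 0 := fun h => by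
    rw [totalDegree_eq_zero_iff_eq_C.1 h] at hu hd0
    refine hu ((isUnit_iff_ne_zero.2 fun h0 => hd0 ?_).map C)
    rw [h0, C_0]
  -- Restriction can only lower the two degrees, and their sum is 6 both before and after; so
  -- neither drops.
  have h6 : (aeval testLine d).degree ≠ 0 := fun h => by
    have : (aeval testLine d).natDegree = 0 := Polynomial.natDegree_eq_of_degree_eq_some h
    omega
  obtain ⟨t, ht⟩ := IsAlgClosed.exists_root _ h6
  have hroot : ∀ {p : MvPolynomial (Fin 27) ℂ}, d ∣ p → (aeval testLine p).eval t = 0 := by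
    rintro p ⟨r, rfl⟩
    rw [map_mul, Polynomial.eval_mul, ht.eq_zero, zero_mul]
  have hs := hroot ⟨q, hq⟩
  have hm := hroot hd'
  have hX : ⇑((aeval testLine : MvPolynomial (Fin 27) ℂ →ₐ[ℂ] Polynomial ℂ) :
      MvPolynomial (Fin 27) ℂ →+* Polynomial ℂ) ∘ X = testLine := by
    ext1 i; simp
  have hm1 := minorForm_map ((aeval testLine : MvPolynomial (Fin 27) ℂ →ₐ[ℂ] Polynomial ℂ) :
      MvPolynomial (Fin 27) ℂ →+* Polynomial ℂ) X
  have hc1 := cubicForm_map ((aeval testLine : MvPolynomial (Fin 27) ℂ →ₐ[ℂ] Polynomial ℂ) :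
      MvPolynomial (Fin 27) ℂ →+* Polynomial ℂ) X
  rw [hX] at hm1 hc1
  simp only [RingHom.coe_coe] at hm1 hc1
  rw [map_mul, ← hm1, ← hc1, cubicForm_testLine] at hm
  rw [aeval_sextic_testLine] at hs
  simp only [Polynomial.eval_mul, Polynomial.eval_sub, Polynomial.eval_pow, Polynomial.eval_X,
    Polynomial.eval_ofNat] at hm hs
  have h7 : t * ((minorForm testLine).eval t) ^ 2 = 0 := by linear_combination hm
  have h8 : (4 : ℂ) = 0 := by linear_combination t * h7 - hs
  norm_num at h8

end forms

/-! ### Density of the generic points in the sextic -/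

section density

open MvPolynomial

/-- The open set where `λ₁ λ₃ - |b|²` and `Det - 2 φ` do not vanish. -/
noncomputable def genericOpen : P26.Opens :=
  ProjectiveSpectrum.basicOpen (ProjSpace.grading 27) (minorForm X * cubicForm X)

/-- A basic open neighbourhood of y, given by f, needs a homogeneous prime containing S but not
f·δd. One exists unless S divides a power of f·δd; by coprimality S would then divide a power of f,
which is absurd since S vanishes at y and f does not. -/
theorem locus_subset_closure :
    sexticLocus ⊆ closure ((genericOpen : Set P26) ∩ sexticLocus) := by
  intro y hy
  refine mem_closure_iff.2 fun V hV hyV => ?_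
  obtain ⟨_, ⟨f, rfl⟩, hfy, hfV⟩ := (ProjectiveSpectrum.isTopologicalBasis_basic_opens
    (ProjSpace.grading 27)).exists_subset_of_mem_open hyV hV
  set h := minorForm (X : Fin 27 → MvPolynomial (Fin 27) ℂ) * cubicForm X with hh
  set I : Ideal (MvPolynomial (Fin 27) ℂ) := Ideal.span {sextic} with hI
  have hIhom : I.IsHomogeneous (ProjSpace.grading 27) :=
    Ideal.homogeneous_span _ _ (by rintro _ rfl; exact ⟨6, isHomogeneous_sextic⟩)
  have hrad : f * h ∉ I.radical := by
    rintro ⟨n, hn⟩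
    rw [hI, Ideal.mem_span_singleton, mul_pow] at hn
    have h1 : sextic ∣ f ^ n := isRelPrime_sextic.pow_right.dvd_of_dvd_mul_right hn
    have h2 : f ^ n ∈ y.asHomogeneousIdeal := by
      obtain ⟨q, hq⟩ := h1
      rw [hq]
      exact Ideal.mul_mem_right _ _ hy
    exact hfy (y.isPrime.mem_of_pow_mem _ h2)
  -- The radical of a homogeneous ideal is the intersection of the homogeneous primes above it. The
  -- prime found is relevant because it misses δd, of degree 5.
  rw [hIhom.radical_eq, Ideal.mem_sInf] at hrad
  push Not at hrad
  obtain ⟨J, ⟨hJ1, hJ2, hJ3⟩, hJ4⟩ := hrad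
  have hhJ : h ∉ J := fun h' => hJ4 (J.mul_mem_left _ h')
  refine ⟨⟨⟨J, hJ1⟩, hJ3, fun hle => hhJ (hle ?_)⟩, hfV ?_, ?_, ?_⟩
  · exact HomogeneousIdeal.mem_irrelevant_of_mem _ (i := 5) (by norm_num)
      (isHomogeneous_minorForm.mul isHomogeneous_cubicForm)
  · exact fun h' => hJ4 (J.mul_mem_right _ h')
  · exact hhJ
  · exact hJ2 (Ideal.mem_span_singleton_self _)

end density
end Octonion

namespace SerreTwist

universe u

/-! ### Morphisms out of the structure sheaf -/

section unit

variable {X : Scheme.{u}}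

/-- Restriction of a global section. -/
noncomputable def res {M : X.Modules} (U : X.Opens) (m : Γ(M, ⊤)) : Γ(M, U) :=
  M.presheaf.map (homOfLE le_top).op m

theorem map_res {M : X.Modules} {U V : X.Opens} (i : U ⟶ V) (m : Γ(M, ⊤)) :
    M.presheaf.map i.op (res V m) = res U m := by
  unfold res
  rw [← ConcreteCategory.comp_apply, ← Functor.map_comp]
  rfl

theorem app_map {M N : X.Modules} (f : M ⟶ N) {U V : X.Opens} (i : U ⟶ V) (m : Γ(M, V)) :
    f.app U (M.presheaf.map i.op m) = N.presheaf.map i.op (f.app V m) :=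
  ConcreteCategory.congr_hom (f.mapPresheaf.naturality i.op) m

theorem app_res {M N : X.Modules} (f : M ⟶ N) (U : X.Opens) (m : Γ(M, ⊤)) :
    f.app U (res U m) = res U (f.app ⊤ m) := app_map _ _ _

theorem res_top {M : X.Modules} (m : Γ(M, ⊤)) : res ⊤ m = m :=
  ConcreteCategory.congr_hom (M.presheaf.map_id _) m

/-- A function as a section of the structure module. -/
def toUnit {U : X.Opens} (r : Γ(X, U)) : Γ(structureModule X, U) := r

/-- A section of the structure module as a function. -/
def ofUnit {U : X.Opens} (r : Γ(structureModule X, U)) : Γ(X, U) := r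

theorem smul_toUnit {U : X.Opens} (r s : Γ(X, U)) : r • toUnit s = toUnit (r * s) := rfl

theorem res_toUnit_one (U : X.Opens) : res U (toUnit (1 : Γ(X, ⊤))) = toUnit 1 :=
  map_one (X.presheaf.map (homOfLE le_top : U ⟶ ⊤).op).hom

/-- The morphism `𝒪 ⟶ M` with `1 ↦ m`. -/
noncomputable def unitHom (M : X.Modules) (m : Γ(M, ⊤)) : structureModule X ⟶ M where
  val := PresheafOfModules.homMk
    { app := fun U => AddCommGrpCat.ofHom (X := Γ(structureModule X, U.unop)) (Y := Γ(M, U.unop))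
        { toFun := fun r => ofUnit r • res U.unop m
          map_zero' := zero_smul Γ(X, U.unop) (res U.unop m : Γ(M, U.unop))
          map_add' := fun r s => add_smul (ofUnit r) (ofUnit s) (res U.unop m) }
      naturality := fun U V i => by
        refine AddCommGrpCat.hom_ext (AddMonoidHom.ext fun r => ?_)
        refine Eq.trans ?_ (Scheme.Modules.map_smul M i.unop (ofUnit r) (res U.unop m)).symm
        rw [map_res]
        rfl }
    (fun U r s => mul_smul (show Γ(X, U.unop) from r) (ofUnit s) (res U.unop m))

theorem unitHom_app (M : X.Modules) (m : Γ(M, ⊤)) (U : X.Opens) (r : Γ(X, U)) :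
    (unitHom M m).app U (toUnit r) = r • res U m := rfl

theorem unitHom_app_top_one (M : X.Modules) (m : Γ(M, ⊤)) :
    (unitHom M m).app ⊤ (toUnit 1) = m := by
  rw [unitHom_app, one_smul, res_top]

theorem app_toUnit {M : X.Modules} (f : structureModule X ⟶ M) (U : X.Opens) (r : Γ(X, U)) :
    f.app U (toUnit r) = r • res U (f.app ⊤ (toUnit 1)) := by
  rw [← app_res, ← Scheme.Modules.Hom.app_smul, res_toUnit_one, smul_toUnit, mul_one]

theorem unit_hom_ext {M : X.Modules} {f g : structureModule X ⟶ M}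
    (h : f.app ⊤ (toUnit 1) = g.app ⊤ (toUnit 1)) : f = g := by
  ext U r
  have e := app_toUnit f U (ofUnit r)
  rw [h] at e
  exact e.trans (app_toUnit g U (ofUnit r)).symm

theorem sum_app {M N : X.Modules} {ι : Type*} (s : Finset ι) (f : ι → (M ⟶ N)) (U : X.Opens)
    (m : Γ(M, U)) : (∑ i ∈ s, f i).app U m = ∑ i ∈ s, (f i).app U m :=
  map_sum (AddMonoidHom.mk' (fun g : M ⟶ N => g.app U m) fun _ _ => rfl) f s

end unit

end SerreTwist

/-! ### Generators and relations for E_ODM -/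

namespace Octonion
open SerreTwist Limits

/-- The projection `ℂ^24 ⊗ 𝒪 ⟶ E_ODM`. -/
noncomputable def projE : (⨁ fun _ : Fin 3 × Fin 8 => structureModule P26) ⟶ EODM :=
  cokernel.π phiM

instance : Epi projE := inferInstanceAs (Epi (cokernel.π phiM))

/-- The projection of the `p`-th summand of `ℂ^24 ⊗ 𝒪` to `E_ODM`. -/
noncomputable def basisHom (p : Fin 3 × Fin 8) : structureModule P26 ⟶ EODM :=
  biproduct.ι (fun _ : Fin 3 × Fin 8 => structureModule P26) p ≫ projE

/-- The class in `Γ(ℙ^26, E_ODM)` of the `p`-th basis vector. -/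
noncomputable def basisClass (p : Fin 3 × Fin 8) : Γ(EODM, ⊤) :=
  (basisHom p).app ⊤ (toUnit 1)

/-- The sheaf `𝒪(-1)`. -/
noncomputable abbrev tautSheaf : P26.Modules := twist (ProjSpace.grading 27) (-((1 : ℕ) : ℤ))

/-- The entries of `M_𝕆` as morphisms `𝒪(-1) ⟶ 𝒪`. -/
noncomputable abbrev entry (p q : Fin 3 × Fin 8) : tautSheaf ⟶ structureModule P26 :=
  mulHom (ProjSpace.grading 27) 1 ⟨MOGen p q, MOGen_mem p q⟩

theorem phiM_projE : phiM ≫ projE = 0 := cokernel.condition phiM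

theorem exists_projE_comp {N : P26.Modules}
    (f : (⨁ fun _ : Fin 3 × Fin 8 => structureModule P26) ⟶ N) (h : phiM ≫ f = 0) :
    ∃ g : EODM ⟶ N, projE ≫ g = f :=
  ⟨cokernel.desc phiM f h, cokernel.π_desc phiM f h⟩

theorem EODM_hom_ext {N : P26.Modules} {f g : EODM ⟶ N}
    (h : ∀ p, f.app ⊤ (basisClass p) = g.app ⊤ (basisClass p)) : f = g := by
  have h2 : ∀ p, basisHom p ≫ f = basisHom p ≫ g := fun p => unit_hom_ext (h p)
  simp only [basisHom, Category.assoc] at h2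
  exact (cancel_epi projE).1 (biproduct.hom_ext' _ _ h2)

theorem ι_phiM (q : Fin 3 × Fin 8) : biproduct.ι _ q ≫ phiM =
    ∑ p, entry p q ≫ biproduct.ι (fun _ : Fin 3 × Fin 8 => structureModule P26) p := by
  rw [phiM, biproduct.ι_matrix, biproduct.lift_eq]

theorem entry_comp_basisHom (q : Fin 3 × Fin 8) : ∑ p, entry p q ≫ basisHom p = 0 := by
  simp only [basisHom, ← Category.assoc]
  rw [← Preadditive.sum_comp, ← ι_phiM, Category.assoc, phiM_projE, comp_zero]

theorem relation_basisClass (q : Fin 3 × Fin 8) (U : P26.Opens) (s : Γ(tautSheaf, U)) :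
    ∑ p, ofUnit ((entry p q).app U s) • (res U (basisClass p) : Γ(EODM, U)) = 0 := by
  have h := congrArg (fun f => f.app U s) (entry_comp_basisHom q)
  simp only [sum_app] at h
  refine Eq.trans (Finset.sum_congr rfl fun p _ => ?_) h
  exact (app_toUnit (basisHom p) U (ofUnit ((entry p q).app U s))).symm

/-- The universal property of the cokernel in terms of sections. The relations are imposed for local
sections of 𝒪(−1), since this sheaf has no nonzero global ones. -/
theorem exists_EODM_hom (N : P26.Modules) (n : Fin 3 × Fin 8 → Γ(N, ⊤))
    (h : ∀ (q : Fin 3 × Fin 8) (U : P26.Opens) (s : Γ(tautSheaf, U)),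
      ∑ p, ofUnit ((entry p q).app U s) • (res U (n p) : Γ(N, U)) = 0) :
    ∃ f : EODM ⟶ N, ∀ p, f.app ⊤ (basisClass p) = n p := by
  have h0 : phiM ≫ biproduct.desc (fun p => unitHom N (n p)) = 0 := by
    refine biproduct.hom_ext' _ _ fun q => ?_
    rw [← Category.assoc, ι_phiM, Preadditive.sum_comp, comp_zero]
    simp only [Category.assoc, biproduct.ι_desc]
    ext U s
    exact (sum_app Finset.univ (fun p => entry p q ≫ unitHom N (n p)) U s).trans (h q U s)
  obtain ⟨f, hf⟩ := exists_projE_comp _ h0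
  refine ⟨f, fun p => ?_⟩
  have e : basisHom p ≫ f = unitHom N (n p) := by
    rw [basisHom, Category.assoc, hf, biproduct.ι_desc]
  rw [← unitHom_app_top_one N (n p), ← e]
  rfl

end Octonion

namespace SerreTwist

universe u

/-! ### Skyscraper modules as test objects for stalks -/

section skyscraper

variable {X : Scheme.{u}}

theorem germ_smul (M : X.Modules) (x : X) (U : X.Opens) (hx : x ∈ U) (r : Γ(X, U)) (m : Γ(M, U)) :
    M.presheaf.germ U x hx (r • m) = X.presheaf.germ U x hx r • M.presheaf.germ U x hx m :=
  PresheafOfModules.germ_smul (R := X.presheaf) M.val x U hx r m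

variable (x : X) (C : Type u) [AddCommGroup C]

/-- Sections over `U` of the skyscraper module at `x` with stalk `C`. -/
abbrev SkySections (U : X.Opens) : Type u := ∀ y : U, PLift (y.1 = x) → C

noncomputable instance skyModule [Module (X.presheaf.stalk x) C] (U : X.Opens) : Module Γ(X, U) (SkySections x C U) where
  smul r f := fun y h => X.presheaf.germ U x (h.down ▸ y.2) r • f y h
  one_smul f := by
    funext y h
    exact (congrArg (· • f y h) (map_one (X.presheaf.germ U x (h.down ▸ y.2)).hom)).trans (one_smul _ _)
  mul_smul r s f := by
    funext y h
    exact (congrArg (· • f y h) (map_mul (X.presheaf.germ U x (h.down ▸ y.2)).hom r s)).trans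
      (mul_smul _ _ _)
  smul_zero r := by funext y h; exact smul_zero _
  smul_add r f g := by funext y h; exact smul_add _ _ _
  add_smul r s f := by
    funext y h
    exact (congrArg (· • f y h) (map_add (X.presheaf.germ U x (h.down ▸ y.2)).hom r s)).trans
      (add_smul _ _ _)
  zero_smul f := by
    funext y h
    exact (congrArg (· • f y h) (map_zero (X.presheaf.germ U x (h.down ▸ y.2)).hom)).trans
      (zero_smul _ _)

/-- The underlying presheaf of the skyscraper module. -/
def skyPresheaf : TopCat.Presheaf Ab X where
  obj U := AddCommGrpCat.of (SkySections x C U.unop)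
  map {U V} i := AddCommGrpCat.ofHom
    { toFun := fun f y h => f (i.unop y) h
      map_zero' := rfl
      map_add' := fun _ _ => rfl }

/-- A section is an arbitrary dependent function on the open set, with values in `C` at x and in a
one-point type elsewhere, so gluing is automatic. -/
theorem skyPresheaf_isSheaf : (skyPresheaf x C).IsSheaf := by
  rw [TopCat.Presheaf.isSheaf_iff_isSheaf_comp (forget Ab)]
  exact TopCat.Presheaf.isSheaf_of_iso
    (NatIso.ofComponents (fun _ => Iso.refl _) (by intros; rfl) :
      TopCat.presheafToTypes X (fun y : X => (PLift (y = x) → C)) ≅ skyPresheaf x C ⋙ forget Ab)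
    (TopCat.Presheaf.toTypes_isSheaf _ _)

variable [Module (X.presheaf.stalk x) C]

noncomputable instance (U : (Opens X)ᵒᵖ) : Module (X.ringCatSheaf.obj.obj U) ((skyPresheaf x C).obj U) :=
  skyModule x C U.unop

/-- The skyscraper module at `x` with stalk `C`. -/
noncomputable def sky : X.Modules where
  val := PresheafOfModules.ofPresheaf (skyPresheaf x C) (fun U V i r f => by
    funext y h
    refine congrArg (fun t : X.presheaf.stalk x =>
      t • (show SkySections x C U.unop from f) (i.unop y) h) ?_
    exact (TopCat.Presheaf.germ_res_apply X.presheaf i.unop x _ r).symm)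
  isSheaf := skyPresheaf_isSheaf x C

/-- The value at `x` of a section of the skyscraper module. -/
def skyEval {U : X.Opens} (hx : x ∈ U) : Γ(sky x C, U) →+ C where
  toFun f := (show SkySections x C U from f) ⟨x, hx⟩ ⟨rfl⟩
  map_zero' := rfl
  map_add' _ _ := rfl

/-- The constant global section of the skyscraper module. -/
def skyConst (c : C) : Γ(sky x C, ⊤) := fun (_ : (⊤ : X.Opens)) _ => c

theorem skyEval_res_skyConst (c : C) {U : X.Opens} (hx : x ∈ U) :
   skyEval x C hx (res U (skyConst x C c)) = c := rfl

theorem skyEval_smul {U : X.Opens} (hx : x ∈ U) (r : Γ(X, U)) (f : Γ(sky x C, U)) :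
   skyEval x C hx (r • f) = X.presheaf.germ U x hx r • skyEval x C hx f := rfl

theorem sky_ext {U : X.Opens} (f g : Γ(sky x C, U))
   (h : ∀ hx : x ∈ U, skyEval x C hx f = skyEval x C hx g) : f = g := by
  funext y hy
  obtain ⟨y, hyU⟩ := y
  obtain ⟨hy⟩ := hy
  subst hy
  exact h hyU

/-- A linear map from the stalk gives a morphism to the skyscraper module. -/
noncomputable def toSky {M : X.Modules} (φ : M.presheaf.stalk x →ₗ[X.presheaf.stalk x] C) :
    M ⟶ sky x C where
  val := PresheafOfModules.homMk
    { app := fun U => AddCommGrpCat.ofHom (X := Γ(M, U.unop)) (Y := Γ(sky x C, U.unop))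
        { toFun := fun m (y : U.unop) h => φ (M.presheaf.germ U.unop x (h.down ▸ y.2) m)
          map_zero' := by
            funext y h
            exact (congrArg φ (map_zero _)).trans (map_zero φ)
          map_add' := fun r s => by
            funext y h
            exact (congrArg φ (map_add _ _ _)).trans (map_add φ _ _) }
      naturality := fun U V i => by
        refine AddCommGrpCat.hom_ext (AddMonoidHom.ext fun m => ?_)
        funext y h
        refine congrArg φ ?_
        exact TopCat.Presheaf.germ_res_apply M.presheaf i.unop x _ m }
    (fun U r m => by
        funext y h
        exact (congrArg φ (germ_smul M x U.unop _ r m)).trans (map_smul φ _ _))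

theorem skyEval_toSky {M : X.Modules} (φ : M.presheaf.stalk x →ₗ[X.presheaf.stalk x] C)
    {U : X.Opens} (hx : x ∈ U) (m : Γ(M, U)) :
    skyEval x C hx ((toSky x C φ).app U m) = φ (M.presheaf.germ U x hx m) := rfl

end skyscraper

end SerreTwist

namespace Octonion
open SerreTwist Matrix

/-! ### Homogeneity under scaling of the coordinates -/

section scaling

variable {K : Type*} [CommRing K]

theorem minorForm_smul (u : K) (v : Fin 27 → K) : minorForm (u • v) = u ^ 2 * minorForm v := by
  simp only [minorForm, normSq_eq, dotIm, lPart, bPart, Pi.smul_apply, smul_eq_mul]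
  ring

theorem cubicForm_smul (u : K) (v : Fin 27 → K) : cubicForm (u • v) = u ^ 3 * cubicForm v := by
  simp only [cubicForm, tau, normSq_eq, dotIm, lPart, bPart, aPart, cPart, Pi.smul_apply,
    smul_eq_mul]
  ring

theorem gramForm_smul (u : K) (v : Fin 27 → K) : gramForm (u • v) = u ^ 6 * gramForm v := by
  have h : ∀ x y : Fin 8 → K, dotIm (u • x) (u • y) = u ^ 2 * dotIm x y := fun x y => by
    simp only [dotIm, Pi.smul_apply, smul_eq_mul]; ring
  have hc : cPart (u • v) = u • cPart v := rfl
  have hb : bPart (u • v) = u • bPart v := rfl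
  have ha : aPart (u • v) = u • aPart v := rfl
  simp only [gramForm, gram, hc, hb, ha, h]
  ring

theorem MO_smul (u : K) (v : Fin 27 → K) : MO (u • v) = u • MO v := by
  have hL : ∀ x : Fin 8 → K, L (u • x) = u • L x := L_smul u
  have hc : cPart (u • v) = u • cPart v := rfl
  have hb : bPart (u • v) = u • bPart v := rfl
  have ha : aPart (u • v) = u • aPart v := rfl
  have hl : ∀ i, lPart (u • v) i = u * lPart v i := fun _ => rfl
  ext ⟨i, k⟩ ⟨j, l⟩
  simp only [MO, comp_apply, hc, hb, ha, hl, hL, transpose_smul, mul_smul, Matrix.smul_apply]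
  fin_cases i <;> fin_cases j <;> rfl

end scaling

/-! ### Local rings of the projective space and the ideal of the sextic -/

section localRing

/-- The local ring of `ℙ^26` at `x`. -/
abbrev StalkRing (x : P26) : Type := P26.presheaf.stalk x

instance (x : P26) : x.asHomogeneousIdeal.toIdeal.IsPrime := x.isPrime

/-- The embedding of the local ring at `x` in the localization of the coordinate ring. -/
noncomputable def stalkVal (x : P26) : StalkRing x →+* Loc (ProjSpace.grading 27) x :=
  (algebraMap (HLoc (ProjSpace.grading 27) x) _).comp
    (Proj.stalkIso (ProjSpace.grading 27) x).hom.hom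

theorem mem_sexticIdeal {x : P26} {f : StalkRing x} : f ∈ sexticIdeal x ↔
    stalkVal x f ∈ Ideal.span {algebraMap _ (Loc (ProjSpace.grading 27) x) sextic} := Iff.rfl

theorem stalkIso_hom_bijective (x : P26) :
    Function.Bijective (Proj.stalkIso (ProjSpace.grading 27) x).hom.hom :=
  (Proj.stalkIso' (ProjSpace.grading 27) x).bijective

theorem stalkVal_injective (x : P26) : Function.Injective (stalkVal x) :=
  (HomogeneousLocalization.val_injective _).comp (stalkIso_hom_bijective x).1

theorem stalkVal_germ (x : P26) (U : P26.Opens) (hx : x ∈ U)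
    (s : (ProjectiveSpectrum.Proj.structureSheaf (ProjSpace.grading 27)).1.obj (op U)) :
    stalkVal x (P26.presheaf.germ U x hx s) = (s.1 ⟨x, hx⟩).val :=
  congrArg HomogeneousLocalization.val (Proj.stalkIso'_germ (ProjSpace.grading 27) U x hx s)

theorem exists_stalkVal_eq (x : P26) {n : ℕ} {a b : MvPolynomial (Fin 27) ℂ}
    (ha : a ∈ ProjSpace.grading 27 n) (hb : b ∈ ProjSpace.grading 27 n)
    (hbx : b ∉ x.asHomogeneousIdeal) :
    ∃ f : StalkRing x, stalkVal x f = Localization.mk a ⟨b, hbx⟩ := by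
  obtain ⟨f, hf⟩ := (stalkIso_hom_bijective x).2 (HomogeneousLocalization.mk ⟨n, ⟨a, ha⟩, ⟨b, hb⟩, hbx⟩)
  exact ⟨f, congrArg HomogeneousLocalization.val hf⟩

theorem exists_eq_stalkVal (x : P26) (f : StalkRing x) :
    ∃ (n : ℕ) (a b : MvPolynomial (Fin 27) ℂ) (_ : a ∈ ProjSpace.grading 27 n)
      (_ : b ∈ ProjSpace.grading 27 n) (hbx : b ∉ x.asHomogeneousIdeal),
      stalkVal x f = Localization.mk a ⟨b, hbx⟩ := by
  obtain ⟨c, hc⟩ := HomogeneousLocalization.mk_surjective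
    ((Proj.stalkIso (ProjSpace.grading 27) x).hom.hom f)
  exact ⟨c.deg, c.num, c.den, c.num.2, c.den.2, c.den_mem,
    congrArg HomogeneousLocalization.val hc.symm⟩

theorem isUnit_stalkVal {x : P26} {f : StalkRing x} : IsUnit (stalkVal x f) ↔ IsUnit f := by
  refine Iff.trans (HomogeneousLocalization.isUnit_iff_isUnit_val (ProjSpace.grading 27)
    x.asHomogeneousIdeal.toIdeal
    (show HLoc (ProjSpace.grading 27) x from
      (Proj.stalkIso (ProjSpace.grading 27) x).hom.hom f)) ?_
  exact MulEquiv.isUnit_map (Proj.stalkIso' (ProjSpace.grading 27) x)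

/-- The constants in the local ring at `x`. -/
noncomputable def stalkConst (x : P26) : ℂ →+* StalkRing x :=
  (Proj.stalkIso' (ProjSpace.grading 27) x).symm.toRingHom.comp
    ((HomogeneousLocalization.fromZeroRingHom (ProjSpace.grading 27) _).comp
      (algebraMap ℂ (ProjSpace.grading 27 0)))

noncomputable instance (x : P26) : Algebra ℂ (StalkRing x) := (stalkConst x).toAlgebra

theorem exists_coordinate (x : P26) :
    ∃ i, (MvPolynomial.X i : MvPolynomial (Fin 27) ℂ) ∉ x.asHomogeneousIdeal := by
  by_contra! h
  refine x.not_irrelevant_le ((HomogeneousIdeal.irrelevant_le _).2 fun n hn p hp => ?_)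
  change p ∈ x.asHomogeneousIdeal.toIdeal
  rw [MvPolynomial.as_sum p]
  refine Ideal.sum_mem _ fun d hd => ?_
  have hd0 : d ≠ 0 := fun h0 => by
    have := hp (MvPolynomial.mem_support_iff.1 hd)
    rw [h0] at this
    simp at this
    omega
  obtain ⟨i, hi⟩ := Finsupp.ne_iff.1 hd0
  have h1 : (MvPolynomial.X i : MvPolynomial (Fin 27) ℂ) ∣ MvPolynomial.monomial d (p.coeff d) := by
    rw [MvPolynomial.X_dvd_monomial]
    exact Or.inr hi
  exact Ideal.mem_of_dvd _ h1 (h i)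

/-- A nonvanishing homogeneous coordinate at `x`. -/
noncomputable def chartIndex (x : P26) : Fin 27 := (exists_coordinate x).choose

/-- A nonvanishing homogeneous coordinate at `x`, as a denominator. -/
noncomputable def chartDen (x : P26) : x.asHomogeneousIdeal.toIdeal.primeCompl :=
  ⟨MvPolynomial.X (chartIndex x), (exists_coordinate x).choose_spec⟩

theorem exists_affineCoord (x : P26) (k : Fin 27) :
    ∃ f : StalkRing x, stalkVal x f = Localization.mk (MvPolynomial.X k) (chartDen x) :=
  exists_stalkVal_eq x (MvPolynomial.isHomogeneous_X ℂ k) (MvPolynomial.isHomogeneous_X ℂ _) _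

/-- Affine coordinates in the local ring at `x`. -/
noncomputable def affineCoord (x : P26) (k : Fin 27) : StalkRing x :=
  (exists_affineCoord x k).choose

/-- The inverse of the chosen coordinate. -/
noncomputable def chartInv (x : P26) : Loc (ProjSpace.grading 27) x :=
  Localization.mk 1 (chartDen x)

theorem isUnit_chartInv (x : P26) : IsUnit (chartInv x) := by
  refine IsUnit.of_mul_eq_one (algebraMap (MvPolynomial (Fin 27) ℂ) _ (chartDen x).1) ?_
  rw [chartInv, ← Localization.mk_one_eq_algebraMap, Localization.mk_mul, one_mul, mul_one,
    Localization.mk_self]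

theorem stalkVal_comp_affineCoord (x : P26) : stalkVal x ∘ affineCoord x =
    chartInv x • (algebraMap (MvPolynomial (Fin 27) ℂ) (Loc (ProjSpace.grading 27) x) ∘
      MvPolynomial.X) := by
  funext k
  refine (exists_affineCoord x k).choose_spec.trans ?_
  simp only [Pi.smul_apply, Function.comp_apply, smul_eq_mul]
  rw [chartInv, ← Localization.mk_one_eq_algebraMap, Localization.mk_mul, one_mul, mul_one]

variable (x : P26)

theorem stalkVal_minorForm : stalkVal x (minorForm (affineCoord x)) =
    chartInv x ^ 2 * algebraMap _ _ (minorForm (MvPolynomial.X : _ → MvPolynomial (Fin 27) ℂ)) := by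
  rw [← minorForm_map, stalkVal_comp_affineCoord, minorForm_smul, minorForm_map]

theorem stalkVal_cubicForm : stalkVal x (cubicForm (affineCoord x)) =
    chartInv x ^ 3 * algebraMap _ _ (cubicForm (MvPolynomial.X : _ → MvPolynomial (Fin 27) ℂ)) := by
  rw [← cubicForm_map, stalkVal_comp_affineCoord, cubicForm_smul, cubicForm_map]

theorem stalkVal_sexticForm :
    stalkVal x (sexticForm (affineCoord x)) = chartInv x ^ 6 * algebraMap _ _ sextic := by
  rw [sextic, sexticForm_eq, sexticForm_eq, map_sub, map_pow, ← cubicForm_map, ← gramForm_map,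
    stalkVal_comp_affineCoord, cubicForm_smul, gramForm_smul, cubicForm_map, gramForm_map, map_sub,
    map_pow]
  ring

theorem stalkVal_MO (p q : Fin 3 × Fin 8) : stalkVal x (MO (affineCoord x) p q) =
    chartInv x * algebraMap _ _ (MOGen p q) := by
  have h := congrFun (congrFun (MO_map (stalkVal x) (affineCoord x)) p) q
  rw [stalkVal_comp_affineCoord, MO_smul, MO_map] at h
  exact h.symm

theorem stalkVal_det_MO : stalkVal x (MO (affineCoord x)).det =
    chartInv x ^ 24 * algebraMap _ _ MOGen.det := by
  rw [RingHom.map_det, RingHom.mapMatrix_apply, ← MO_map, stalkVal_comp_affineCoord, MO_smul,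
    det_smul, MO_map, RingHom.map_det]
  rfl

theorem isUnit_algebraMap_loc {p : MvPolynomial (Fin 27) ℂ} :
    IsUnit (algebraMap _ (Loc (ProjSpace.grading 27) x) p) ↔ p ∉ x.asHomogeneousIdeal :=
  IsLocalization.AtPrime.isUnit_to_map_iff _ x.asHomogeneousIdeal.toIdeal p

theorem isUnit_iff_notMem {f : StalkRing x} {n : ℕ} {p : MvPolynomial (Fin 27) ℂ}
    (h : stalkVal x f = chartInv x ^ n * algebraMap _ _ p) :
    IsUnit f ↔ p ∉ x.asHomogeneousIdeal := by
  rw [← isUnit_stalkVal, h, IsUnit.mul_iff, and_iff_right ((isUnit_chartInv x).pow n),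
    isUnit_algebraMap_loc]

/-- Membership after localization gives t·a = S·r with t outside the prime, but with t and r
possibly inhomogeneous. Some homogeneous component of t lies outside the prime, and comparing
components replaces r as well. The alternative r = 0 covers the case where the degree is below 6. -/
theorem exists_homogeneous_multiple {n : ℕ} {a : MvPolynomial (Fin 27) ℂ}
    (ha : a ∈ ProjSpace.grading 27 n)
    (h : algebraMap _ (Loc (ProjSpace.grading 27) x) a ∈
      Ideal.span {algebraMap _ (Loc (ProjSpace.grading 27) x) sextic}) :
    ∃ (j m : ℕ) (t r : MvPolynomial (Fin 27) ℂ), t ∈ ProjSpace.grading 27 j ∧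
      r ∈ ProjSpace.grading 27 m ∧ t ∉ x.asHomogeneousIdeal ∧ t * a = sextic * r ∧
      (j + n = m + 6 ∨ r = 0) := by
  rw [← Set.image_singleton, ← Ideal.map_span,
    IsLocalization.algebraMap_mem_map_algebraMap_iff x.asHomogeneousIdeal.toIdeal.primeCompl] at h
  obtain ⟨t, ht, hta⟩ := h
  obtain ⟨r, hr⟩ := Ideal.mem_span_singleton.1 hta
  obtain ⟨j, hj⟩ : ∃ j, (DirectSum.decompose (ProjSpace.grading 27) t j : MvPolynomial _ ℂ) ∉
      x.asHomogeneousIdeal := by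
    by_contra! hall
    refine ht ?_
    rw [SetLike.mem_coe, ← DirectSum.sum_support_decompose (ProjSpace.grading 27) t]
    exact Ideal.sum_mem _ fun j _ => hall j
  have h1 := DirectSum.coe_decompose_mul_add_of_right_mem (ProjSpace.grading 27) (i := j) (a := t) ha
  rw [hr] at h1
  by_cases h6 : 6 ≤ j + n
  · rw [DirectSum.coe_decompose_mul_of_left_mem_of_le (ProjSpace.grading 27)
      isHomogeneous_sextic h6] at h1
    exact ⟨j, j + n - 6, _, _, SetLike.coe_mem _, SetLike.coe_mem _, hj, h1.symm,
      Or.inl (by omega)⟩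
  · rw [DirectSum.coe_decompose_mul_of_left_mem_of_not_le (ProjSpace.grading 27)
      isHomogeneous_sextic h6] at h1
    exact ⟨j, 0, _, 0, SetLike.coe_mem _, zero_mem _, hj, by rw [← h1, mul_zero], Or.inr rfl⟩

/-- The ideal is defined by contraction from the full localization. That it is principal, generated
by the dehomogenized sextic, requires the quotient by this generator to be a fraction of degree
zero. -/
theorem sexticIdeal_eq : sexticIdeal x = Ideal.span {sexticForm (affineCoord x)} := by
  refine le_antisymm (fun f hf => ?_) ?_
  · rw [mem_sexticIdeal] at hf
    obtain ⟨n, a, b, ha, hb, hbx, hab⟩ := exists_eq_stalkVal x f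
    have hf' : algebraMap _ (Loc (ProjSpace.grading 27) x) a ∈
        Ideal.span {algebraMap _ (Loc (ProjSpace.grading 27) x) sextic} := by
      have : algebraMap _ (Loc (ProjSpace.grading 27) x) a =
          algebraMap _ (Loc (ProjSpace.grading 27) x) b * stalkVal x f := by
        rw [hab, ← Localization.mk_one_eq_algebraMap, ← Localization.mk_one_eq_algebraMap,
          Localization.mk_mul, Localization.mk_eq_mk_iff, Localization.r_iff_exists]
        exact ⟨1, by simp⟩
      rw [this]
      exact Ideal.mul_mem_left _ _ hf
    obtain ⟨j, m, t, r, ht, hr, htx, heq, hdeg⟩ := exists_homogeneous_multiple x ha hf'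
    have htb : t * b ∉ x.asHomogeneousIdeal := fun hh =>
      (x.isPrime.mem_or_mem hh).elim htx hbx
    -- If a/b is the element and ta = Sr, the quotient of a/b by S/X⁶ is X⁶r/(tb), X being the
    -- chosen coordinate; the degrees 6 + m and j + n agree.
    obtain ⟨g, hg⟩ : ∃ g : StalkRing x, stalkVal x g =
        Localization.mk ((chartDen x).1 ^ 6 * r) ⟨t * b, htb⟩ := by
      rcases hdeg with hdeg | rfl
      · refine exists_stalkVal_eq x (n := j + n) ?_ (SetLike.mul_mem_graded ht hb) htb
        have := SetLike.mul_mem_graded (SetLike.pow_mem_graded 6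
          (MvPolynomial.isHomogeneous_X ℂ (chartIndex x) : _ ∈ ProjSpace.grading 27 1)) hr
        rwa [show 6 • 1 + m = j + n by rw [smul_eq_mul]; omega] at this
      · exact ⟨0, by rw [mul_zero, Localization.mk_zero, map_zero]⟩
    refine Ideal.mem_span_singleton.2 ⟨g, stalkVal_injective x ?_⟩
    rw [map_mul, stalkVal_sexticForm, hab, hg, chartInv, Localization.mk_pow, one_pow,
      ← Localization.mk_one_eq_algebraMap, Localization.mk_mul, Localization.mk_mul,
      Localization.mk_eq_mk_iff, Localization.r_iff_exists]
    refine ⟨1, ?_⟩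
    simp only [OneMemClass.coe_one, one_mul, Submonoid.coe_mul, mul_one, SubmonoidClass.coe_pow]
    linear_combination (b * (chartDen x).1 ^ 6) * heq
  · rw [Ideal.span_singleton_le_iff_mem, mem_sexticIdeal, stalkVal_sexticForm]
    exact Ideal.mul_mem_left _ _ (Ideal.mem_span_singleton_self _)

end localRing

end Octonion

namespace Octonion
open SerreTwist Matrix

/-! ### Presentation of the stalks, annihilator and support -/

section stalk

/-- A section of `𝒪(-1)` as a family of fractions. -/
def fractions {U : P26.Opens} (s : Γ(tautSheaf, U)) :
    Sections (ProjSpace.grading 27) (-((1 : ℕ) : ℤ)) U := s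

theorem entry_app {U : P26.Opens} (s : Γ(tautSheaf, U)) (p q : Fin 3 × Fin 8) :
    ofUnit ((entry p q).app U s) =
      mulSection (ProjSpace.grading 27) 1 ⟨MOGen p q, MOGen_mem p q⟩ (fractions s) := rfl

variable (x : P26)

theorem stalkVal_germ_mulSection {U : P26.Opens} (hx : x ∈ U) (s : Γ(tautSheaf, U))
    (f : ProjSpace.grading 27 1) :
    stalkVal x (P26.presheaf.germ U x hx (mulSection (ProjSpace.grading 27) 1 f (fractions s))) =
      algebraMap _ _ f.1 * (fractions s).1 ⟨x, hx⟩ :=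
  (stalkVal_germ x U hx _).trans (mulSection_val _ _ _ _ _)

/-- With X the chosen coordinate, s is X⁻¹ times the function Xs, so every local relation is a
multiple of a column of M in affine coordinates. -/
theorem germ_entry_app {U : P26.Opens} (hx : x ∈ U) (s : Γ(tautSheaf, U)) (p q : Fin 3 × Fin 8) :
    P26.presheaf.germ U x hx (ofUnit ((entry p q).app U s)) = MO (affineCoord x) p q *
      P26.presheaf.germ U x hx (mulSection (ProjSpace.grading 27) 1
        ⟨_, MvPolynomial.isHomogeneous_X ℂ (chartIndex x)⟩ (fractions s)) := by
  refine stalkVal_injective x ?_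
  rw [map_mul, entry_app, stalkVal_germ_mulSection, stalkVal_germ_mulSection, stalkVal_MO]
  have h : chartInv x * algebraMap (MvPolynomial (Fin 27) ℂ) _ (chartDen x).1 = 1 := by
    rw [chartInv, ← Localization.mk_one_eq_algebraMap, Localization.mk_mul, one_mul, mul_one,
      Localization.mk_self]
  change _ = chartInv x * _ * (algebraMap (MvPolynomial (Fin 27) ℂ) _ (chartDen x).1 * _)
  linear_combination (-(algebraMap _ (Loc (ProjSpace.grading 27) x) (MOGen p q) *
    (fractions s).1 ⟨x, hx⟩)) * h

/-- The open set where the coordinate chosen at `x` does not vanish. -/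
noncomputable def chartOpen : P26.Opens :=
  ProjectiveSpectrum.basicOpen (ProjSpace.grading 27) (chartDen x).1

theorem mem_chartOpen : x ∈ chartOpen x := (chartDen x).2

/-- The section `1 / X_i` of `𝒪(-1)` where the coordinate chosen at `x` does not vanish. -/
noncomputable def chartSection : Γ(tautSheaf, chartOpen x) :=
  show Sections (ProjSpace.grading 27) (-((1 : ℕ) : ℤ)) _ from
  ⟨fun y => Localization.mk 1 ⟨(chartDen x).1, y.2⟩, fun y => ⟨_, y.2, 𝟙 _, 0, 1,
    ⟨1, MvPolynomial.isHomogeneous_one _ _⟩,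
    ⟨(chartDen x).1, MvPolynomial.isHomogeneous_X ℂ (chartIndex x)⟩, fun z => z.2, by simp,
    fun z => rfl⟩⟩

theorem germ_entry_chartSection (p q : Fin 3 × Fin 8) :
    P26.presheaf.germ _ x (mem_chartOpen x) (ofUnit ((entry p q).app _ (chartSection x))) =
      MO (affineCoord x) p q := by
  refine stalkVal_injective x ?_
  rw [entry_app, stalkVal_germ_mulSection, stalkVal_MO, mul_comm]
  rfl

/-- The basis classes in the stalk at `x`. -/
noncomputable def stalkBasis (p : Fin 3 × Fin 8) : EODM.presheaf.stalk x :=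
  EODM.presheaf.germ ⊤ x trivial (basisClass p)

theorem germ_res_basisClass {U : P26.Opens} (hx : x ∈ U) (p : Fin 3 × Fin 8) :
    EODM.presheaf.germ U x hx (res U (basisClass p)) = stalkBasis x p :=
  TopCat.Presheaf.germ_res_apply EODM.presheaf _ x hx _

theorem germ_relation {U : P26.Opens} (hx : x ∈ U) (r : Fin 3 × Fin 8 → Γ(P26, U)) :
    EODM.presheaf.germ U x hx (∑ p, r p • res U (basisClass p)) =
      ∑ p, P26.presheaf.germ U x hx (r p) • stalkBasis x p := by
  rw [map_sum]
  exact Finset.sum_congr rfl fun p _ => (germ_smul _ _ _ _ _ _).trans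
    (congrArg _ (germ_res_basisClass x hx p))

/-- The presentation of the stalk. -/
noncomputable def stalkPresentation :
    (Fin 3 × Fin 8 → StalkRing x) →ₗ[StalkRing x] EODM.presheaf.stalk x :=
  Fintype.linearCombination (StalkRing x) (stalkBasis x)

theorem stalkPresentation_apply (u : Fin 3 × Fin 8 → StalkRing x) :
    stalkPresentation x u = ∑ p, u p • stalkBasis x p := rfl

theorem stalkPresentation_col (q : Fin 3 × Fin 8) :
    ∑ p, MO (affineCoord x) p q • stalkBasis x p = 0 := by
  have h := germ_relation x (mem_chartOpen x)
    fun p => ofUnit ((entry p q).app _ (chartSection x))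
  rw [relation_basisClass, map_zero] at h
  rw [h]
  exact Finset.sum_congr rfl fun p _ => by rw [germ_entry_chartSection]

theorem exists_germ_eq_of_finite {ι : Type*} [Finite ι] (u : ι → StalkRing x) :
    ∃ (U : P26.Opens) (hx : x ∈ U) (r : ι → Γ(P26, U)), ∀ i, P26.presheaf.germ U x hx (r i) = u i := by
  classical
  choose V hV s hs using fun i => TopCat.Presheaf.exists_germ_eq P26.presheaf (u i)
  refine ⟨⟨⋂ i, V i, isOpen_iInter_of_finite fun i => (V i).2⟩, Set.mem_iInter.2 hV,
    fun i => P26.presheaf.map (homOfLE (Set.iInter_subset _ i) : _ ⟶ V i).op (s i), fun i => ?_⟩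
  exact (TopCat.Presheaf.germ_res_apply P26.presheaf _ x _ (s i)).trans (hs i)

/-- The quotient of the stalk by the span of the basis classes defines a morphism from E to a
skyscraper. It kills all basis classes, hence is zero, so the quotient vanishes. -/
theorem stalkPresentation_surjective : Function.Surjective (stalkPresentation x) := by
  set N := LinearMap.range (stalkPresentation x)
  have hN : ∀ p, N.mkQ (stalkBasis x p) = 0 := fun p => by
    rw [Submodule.mkQ_apply, Submodule.Quotient.mk_eq_zero]
    refine ⟨Pi.single p 1, ?_⟩
    classical
    exact (Fintype.linearCombination_apply_single _ _ _ _).trans (one_smul _ _)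
  have h0 : toSky x _ N.mkQ = (0 : EODM ⟶ _) := EODM_hom_ext fun p =>
    sky_ext x _ _ _ fun hx => (skyEval_toSky x _ N.mkQ hx (basisClass p)).trans (hN p)
  intro m
  obtain ⟨U, hx, s, rfl⟩ := TopCat.Presheaf.exists_germ_eq EODM.presheaf m
  have h1 := skyEval_toSky x _ N.mkQ hx s
  rw [h0] at h1
  exact (Submodule.Quotient.mk_eq_zero N).1 h1.symm

/-- For the hard inclusion, E maps to the skyscraper with stalk R²⁴/im M by sending basis classes to
basis vectors. A relation among germs already holds on a neighbourhood, and its image says that the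
coefficient vector lies in im M. -/
theorem ker_stalkPresentation : LinearMap.ker (stalkPresentation x) =
    LinearMap.range (MO (affineCoord x)).mulVecLin := by
  classical
  set N := LinearMap.range (MO (affineCoord x)).mulVecLin with hNdef
  refine le_antisymm (fun u hu => ?_) ?_
  · obtain ⟨f, hf⟩ := exists_EODM_hom (sky x ((Fin 3 × Fin 8 → StalkRing x) ⧸ N))
      (fun p => skyConst x _ (N.mkQ (Pi.single p 1))) fun q U s => sky_ext x _ _ _ fun hx => by
        rw [map_sum, map_zero]
        have h : ∀ p, skyEval x _ hx (ofUnit ((entry p q).app U s) •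
            res U (skyConst x _ (N.mkQ (Pi.single p 1)))) =
            N.mkQ (Pi.single p (P26.presheaf.germ U x hx (ofUnit ((entry p q).app U s)))) := by
          intro p
          refine (skyEval_smul x _ hx _ _).trans ?_
          rw [skyEval_res_skyConst, ← map_smul, ← Pi.single_smul', smul_eq_mul, mul_one]
        simp only [h]
        rw [← map_sum, Finset.univ_sum_single, Submodule.mkQ_apply, Submodule.Quotient.mk_eq_zero]
        refine ⟨Pi.single q (P26.presheaf.germ U x hx (mulSection (ProjSpace.grading 27) 1
          ⟨_, MvPolynomial.isHomogeneous_X ℂ (chartIndex x)⟩ (fractions s))), ?_⟩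
        funext p
        rw [mulVecLin_apply, mulVec_single, germ_entry_app]
        simp
    obtain ⟨U, hx, r, hr⟩ := exists_germ_eq_of_finite x u
    have h1 : EODM.presheaf.germ U x hx (∑ p, r p • res U (basisClass p)) =
        EODM.presheaf.germ U x hx 0 := by
      rw [germ_relation, map_zero]
      simp only [hr]
      exact hu
    obtain ⟨V, hxV, iU, iV, h2⟩ := TopCat.Presheaf.germ_eq EODM.presheaf x hx hx _ _ h1
    rw [map_zero, map_sum] at h2
    have h3 := congrArg (skyEval x _ hxV) (congrArg (f.app V) h2)
    rw [map_zero, map_zero, map_sum, map_sum] at h3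
    have h4 : ∀ p, skyEval x _ hxV (f.app V (EODM.presheaf.map iU.op (r p • res U (basisClass p))))
        = N.mkQ (Pi.single p (u p)) := fun p => by
      rw [app_map, Scheme.Modules.Hom.app_smul, Scheme.Modules.map_smul]
      refine (skyEval_smul x _ hxV _ _).trans ?_
      rw [app_res, map_res, hf, skyEval_res_skyConst, ← map_smul, ← Pi.single_smul', smul_eq_mul,
        mul_one, TopCat.Presheaf.germ_res_apply, hr]
    simp only [h4] at h3
    rw [← map_sum, Finset.univ_sum_single, Submodule.mkQ_apply, Submodule.Quotient.mk_eq_zero] at h3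
    exact h3
  · rintro _ ⟨w, rfl⟩
    rw [LinearMap.mem_ker, stalkPresentation_apply]
    simp only [mulVecLin_apply, mulVec, dotProduct, Finset.sum_smul]
    rw [Finset.sum_comm]
    refine Finset.sum_eq_zero fun q _ => ?_
    simp only [mul_comm _ (w q), mul_smul, ← Finset.smul_sum, stalkPresentation_col, smul_zero]

theorem sexticForm_smul_stalk (m : EODM.presheaf.stalk x) :
    sexticForm (affineCoord x) • m = 0 := by
  obtain ⟨u, rfl⟩ := stalkPresentation_surjective x m
  rw [← map_smul, ← LinearMap.mem_ker, ker_stalkPresentation]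
  refine ⟨cofactorM (affineCoord x) *ᵥ u, ?_⟩
  rw [mulVecLin_apply, mulVec_mulVec, MO_mul_cofactorM, smul_mulVec, one_mulVec]

theorem smul_eq_zero_of_mem_sexticIdeal {f : StalkRing x} (hf : f ∈ sexticIdeal x)
    (m : EODM.presheaf.stalk x) : f • m = 0 := by
  rw [sexticIdeal_eq] at hf
  obtain ⟨g, rfl⟩ := Ideal.mem_span_singleton'.1 hf
  rw [mul_smul, sexticForm_smul_stalk, smul_zero]

theorem nonempty_stalk_linearEquiv (hx : x ∈ (genericOpen : Set P26) ∩ sexticLocus) :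
    Nonempty (EODM.presheaf.stalk x ≃ₗ[StalkRing x] (Fin 4 → StalkRing x ⧸ sexticIdeal x)) := by
  have hU : minorForm MvPolynomial.X * cubicForm MvPolynomial.X ∉ x.asHomogeneousIdeal := hx.1
  rw [sexticIdeal_eq]
  refine nonempty_linearEquiv_fin_four _
    ((isUnit_iff_notMem x (stalkVal_minorForm x)).2 fun h => hU (Ideal.mul_mem_right _ _ h))
    ((isUnit_iff_notMem x (stalkVal_cubicForm x)).2 fun h => hU (Ideal.mul_mem_left _ _ h))
    (fun h => (isUnit_iff_notMem x (stalkVal_sexticForm x)).1 h hx.2)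
    (stalkPresentation x) (stalkPresentation_surjective x) (ker_stalkPresentation x)

theorem nontrivial_stalk_of_generic (hx : x ∈ (genericOpen : Set P26) ∩ sexticLocus) :
    Nontrivial (EODM.presheaf.stalk x) := by
  obtain ⟨e⟩ := nonempty_stalk_linearEquiv x hx
  have : Nontrivial (StalkRing x ⧸ sexticIdeal x) := by
    rw [Ideal.Quotient.nontrivial_iff, sexticIdeal_eq, Ne, Ideal.span_singleton_eq_top]
    exact fun h => (isUnit_iff_notMem x (stalkVal_sexticForm x)).1 h hx.2
  exact e.toEquiv.nontrivial

theorem subsingleton_stalk_of_isUnit_det (h : MOGen.det ∉ x.asHomogeneousIdeal) :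
    Subsingleton (EODM.presheaf.stalk x) := by
  have h1 : IsUnit (MO (affineCoord x)).det := (isUnit_iff_notMem x (stalkVal_det_MO x)).2 h
  refine subsingleton_of_forall_eq 0 fun m => ?_
  obtain ⟨u, rfl⟩ := stalkPresentation_surjective x m
  rw [← LinearMap.mem_ker, ker_stalkPresentation]
  refine ⟨(MO (affineCoord x))⁻¹ *ᵥ u, ?_⟩
  rw [mulVecLin_apply, mulVec_mulVec, mul_nonsing_inv _ h1, one_mulVec]

theorem det_mem_of_nontrivial_stalk (h : Nontrivial (EODM.presheaf.stalk x)) :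
    MOGen.det ∈ x.asHomogeneousIdeal := by
  by_contra hd
  exact not_subsingleton _ (subsingleton_stalk_of_isUnit_det x hd)

theorem isUnit_of_subsingleton_stalk (h : Subsingleton (EODM.presheaf.stalk x)) :
    MOGen.det ∉ x.asHomogeneousIdeal := by
  classical
  refine (isUnit_iff_notMem x (stalkVal_det_MO x)).1 ?_
  rw [← isUnit_iff_isUnit_det, ← mulVec_surjective_iff_isUnit]
  intro u
  have : u ∈ LinearMap.ker (stalkPresentation x) := Subsingleton.elim _ _
  rw [ker_stalkPresentation] at this
  exact this

/-- Off the sextic a unit kills the stalk. If the stalk vanished at a point of the sextic, det M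
would be invertible there and hence nearby; but arbitrarily close lie generic points of the sextic,
with stalks of rank 4. -/
theorem nontrivial_stalk_iff : Nontrivial (EODM.presheaf.stalk x) ↔ x ∈ sexticLocus := by
  refine ⟨fun h => ?_, fun h => ?_⟩
  · by_contra hx
    obtain ⟨m, hm⟩ := exists_ne (0 : EODM.presheaf.stalk x)
    have h1 : IsUnit (sexticForm (affineCoord x)) :=
      (isUnit_iff_notMem x (stalkVal_sexticForm x)).2 hx
    exact hm (h1.smul_eq_zero.1 (sexticForm_smul_stalk x m))
  · by_contra hn
    have hdx := isUnit_of_subsingleton_stalk x (not_nontrivial_iff_subsingleton.1 hn)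
    let D : P26.Opens := ProjectiveSpectrum.basicOpen (ProjSpace.grading 27) MOGen.det
    obtain ⟨y, hyd, hy⟩ := mem_closure_iff.1 (locus_subset_closure h) (D : Set P26) D.2 hdx
    exact hyd (det_mem_of_nontrivial_stalk y (nontrivial_stalk_of_generic y hy))

end stalk
end Octonion

/-! ### Transposing the cocycle condition across pullback and pushforward -/

namespace SerreTwist
universe u

/-- Mates under composed adjunctions: transposing a composite amounts to composing transposes, up to
the comparison β that corresponds to α. -/
theorem homEquiv_comp_of_conjugateEquiv {C D D' : Type*} [Category* C] [Category* D]
    [Category* D'] {La : C ⥤ D} {Ra : D ⥤ C} {Lb : D ⥤ D'} {Rb : D' ⥤ D} {Lc : C ⥤ D'}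
    {Rc : D' ⥤ C} (adja : La ⊣ Ra) (adjb : Lb ⊣ Rb) (adjc : Lc ⊣ Rc) {α : Lc ⟶ La ⋙ Lb}
    {β : Rb ⋙ Ra ⟶ Rc} (h : conjugateEquiv (adja.comp adjb) adjc α = β) {X : C} {Y : D} {Z : D'}
    (f : La.obj X ⟶ Y) (g : Lb.obj Y ⟶ Z) :
    adjc.homEquiv X Z (α.app X ≫ Lb.map f ≫ g) =
      adja.homEquiv X Y f ≫ Ra.map (adjb.homEquiv Y Z g) ≫ β.app Z := by
  have h3 := unit_conjugateEquiv (adja.comp adjb) adjc α X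
  rw [h] at h3
  have h4 := β.naturality (Lb.map f ≫ g)
  simp only [Adjunction.homEquiv_unit, Functor.map_comp, Category.assoc, Functor.comp_map,
    Adjunction.comp_unit_app, Functor.comp_obj] at h3 h4 ⊢
  rw [← reassoc_of% h3, ← h4, ← Functor.map_comp_assoc Ra f, ← Adjunction.unit_naturality,
    Functor.map_comp_assoc]

section linearize

variable {X : Scheme.{u}}

theorem isIso_homEquiv_symm {E : X.Modules} (a : X ⟶ X) [IsIso a]
    (ψ : E ⟶ (Scheme.Modules.pushforward a).obj E) [IsIso ψ] :
    IsIso (((Scheme.Modules.pullbackPushforwardAdjunction a).homEquiv E E).symm ψ) := by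
  rw [Adjunction.homEquiv_counit]
  infer_instance

/-- It allows the cocycle condition to be checked on morphisms E → a_*E, where sections are directly
accessible. -/
theorem homEquiv_symm_comp {E : X.Modules} {a b c : X ⟶ X} (hc : c = b ≫ a)
    (ψa : E ⟶ (Scheme.Modules.pushforward a).obj E)
    (ψb : E ⟶ (Scheme.Modules.pushforward b).obj E)
    (ψc : E ⟶ (Scheme.Modules.pushforward c).obj E)
    (h : ψc ≫ (Scheme.Modules.pushforwardCongr hc).hom.app E =
      ψa ≫ (Scheme.Modules.pushforward a).map ψb ≫ (Scheme.Modules.pushforwardComp b a).hom.app E) :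
    ((Scheme.Modules.pullbackPushforwardAdjunction c).homEquiv E E).symm ψc =
      (Scheme.Modules.pullbackCongr hc).hom.app E ≫
      (Scheme.Modules.pullbackComp b a).inv.app E ≫
        (Scheme.Modules.pullback b).map
          (((Scheme.Modules.pullbackPushforwardAdjunction a).homEquiv E E).symm ψa) ≫
        ((Scheme.Modules.pullbackPushforwardAdjunction b).homEquiv E E).symm ψb := by
  subst hc
  have h1 : (Scheme.Modules.pushforwardCongr (rfl : b ≫ a = b ≫ a)).hom.app E = 𝟙 _ := by
    ext U m
    exact ConcreteCategory.congr_hom (E.presheaf.map_id (op ((b ≫ a) ⁻¹ᵁ U))) m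
  have h2 : (Scheme.Modules.pullbackCongr (rfl : b ≫ a = b ≫ a)).hom.app E = 𝟙 _ := rfl
  rw [h1, Category.comp_id] at h
  rw [h2, Category.id_comp, Equiv.symm_apply_eq, h]
  refine Eq.trans ?_ (homEquiv_comp_of_conjugateEquiv _ _ _
    (Scheme.Modules.conjugateEquiv_pullbackComp_inv b a) _ _).symm
  rw [Equiv.apply_symm_apply, Equiv.apply_symm_apply]

end linearize
end SerreTwist

namespace Octonion
open SerreTwist Matrix ProjSpace

/-! ### Pulling back sections and relations along linear maps -/

section pull

variable (g : GL (Fin 27) ℂ)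

/-- The morphism `[v] ↦ [g v]` of `ℙ^26`. -/
noncomputable def coordMap : P26 ⟶ P26 := projMap g

theorem coordMap_mem {g : GL (Fin 27) ℂ} {U : P26.Opens} {y : P26} (hy : y ∈ coordMap g ⁻¹ᵁ U) :
    coordMap g y ∈ U := hy

/-- The pull back of functions along `coordMap g`. -/
noncomputable def pullFun (U : P26.Opens) : Γ(P26, U) →+* Γ(P26, coordMap g ⁻¹ᵁ U) :=
  ((coordMap g).app U).hom

/-- The substitution as a map of local rings. -/
noncomputable def pullLoc (y : P26) :
    Loc (grading 27) (coordMap g y) →+* Loc (grading 27) y :=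
  Localization.localRingHom _ _ (gradedSubst g.1).toRingHom rfl

theorem pullLoc_algebraMap (y : P26) (p : MvPolynomial (Fin 27) ℂ) :
    pullLoc g y (algebraMap _ _ p) = algebraMap _ _ (subst g.1 p) :=
  Localization.localRingHom_to_map _ _ _ _ _

theorem stalkVal_germ_pullFun (y : P26) {U : P26.Opens} (hy : y ∈ coordMap g ⁻¹ᵁ U) (h : Γ(P26, U)) :
    stalkVal y (P26.presheaf.germ (coordMap g ⁻¹ᵁ U) y hy (pullFun g U h)) =
      pullLoc g y (stalkVal (coordMap g y) (P26.presheaf.germ U (coordMap g y) (coordMap_mem hy) h)) := by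
  refine (stalkVal_germ y _ hy _).trans ?_
  refine Eq.trans ?_ (congrArg (pullLoc g y) (stalkVal_germ (coordMap g y) U hy h).symm)
  exact HomogeneousLocalization.val_localRingHom _

/-- The pull back of a section of `𝒪(-1)`. -/
noncomputable def pullSection {U : P26.Opens} (s : Γ(tautSheaf, U)) :
    Γ(tautSheaf, coordMap g ⁻¹ᵁ U) :=
  show Sections (grading 27) (-((1 : ℕ) : ℤ)) (coordMap g ⁻¹ᵁ U) from
  ⟨fun y => pullLoc g y.1 ((fractions s).1 ⟨coordMap g y.1, y.2⟩), fun y => by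
    obtain ⟨V, hV, iV, i, j, r, t, ht, h, w⟩ := (fractions s).2 ⟨coordMap g y.1, y.2⟩
    refine ⟨coordMap g ⁻¹ᵁ V, hV, homOfLE fun z hz => iV.le hz, i, j, ⟨_, subst_mem g.1 r.2⟩,
      ⟨_, subst_mem g.1 t.2⟩, fun z => ht ⟨coordMap g z.1, z.2⟩, h, fun z => ?_⟩
    refine (congrArg (pullLoc g z.1) (w ⟨coordMap g z.1, z.2⟩)).trans ?_
    have := z.1.isPrime
    exact Localization.localRingHom_mk _ _ _ _ _ _⟩

theorem fractions_pullSection {U : P26.Opens} (s : Γ(tautSheaf, U)) (y : P26)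
    (hy : y ∈ coordMap g ⁻¹ᵁ U) : (fractions (pullSection g s)).1 ⟨y, hy⟩ =
      pullLoc g y ((fractions s).1 ⟨coordMap g y, coordMap_mem hy⟩) := rfl

theorem section_ext {U : P26.Opens} {a b : Γ(P26, U)}
    (h : ∀ (y : P26) (hy : y ∈ U), stalkVal y (P26.presheaf.germ U y hy a) =
      stalkVal y (P26.presheaf.germ U y hy b)) : a = b :=
  structureSheaf_ext (grading 27) fun y =>
    (stalkVal_germ y.1 U y.2 a).symm.trans ((h y.1 y.2).trans (stalkVal_germ y.1 U y.2 b))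

/-- The constant `a` as a function on `U`. -/
noncomputable def constFun {U : P26.Opens} (a : ℂ) : Γ(P26, U) :=
  P26.presheaf.map (homOfLE le_top : U ⟶ ⊤).op (constSection 27 a)

theorem stalkVal_germ_constFun {U : P26.Opens} (a : ℂ) (y : P26) (hy : y ∈ U) :
    stalkVal y (P26.presheaf.germ U y hy (constFun a)) =
      algebraMap _ (Loc (grading 27) y) (MvPolynomial.C a : MvPolynomial (Fin 27) ℂ) := by
  refine (stalkVal_germ y _ hy _).trans ?_
  exact Localization.mk_one_eq_algebraMap _

theorem pullFun_constFun {U : P26.Opens} (a : ℂ) :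
    pullFun g U (constFun a) = constFun a := section_ext fun y hy => by
  rw [stalkVal_germ_pullFun, stalkVal_germ_constFun, stalkVal_germ_constFun, pullLoc_algebraMap,
    MvPolynomial.algHom_C, MvPolynomial.algebraMap_eq]

theorem constFun_mul {U : P26.Opens} (a b : ℂ) :
    (constFun (a * b) : Γ(P26, U)) = constFun a * constFun b := section_ext fun y hy => by
  simp only [map_mul, stalkVal_germ_constFun]

theorem constFun_zero {U : P26.Opens} :
    (constFun 0 : Γ(P26, U)) = 0 := section_ext fun y hy => by
  simp only [map_zero, stalkVal_germ_constFun]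

theorem constFun_one {U : P26.Opens} :
    (constFun 1 : Γ(P26, U)) = 1 := section_ext fun y hy => by
  simp only [map_one, stalkVal_germ_constFun]

theorem constFun_sum {U : P26.Opens} {ι : Type*} (s : Finset ι) (a : ι → ℂ) :
    (constFun (∑ i ∈ s, a i) : Γ(P26, U)) = ∑ i ∈ s, constFun (a i) := section_ext fun y hy => by
  simp only [map_sum, stalkVal_germ_constFun]

theorem stalkVal_germ_entry (y : P26) {U : P26.Opens} (hy : y ∈ U) (s : Γ(tautSheaf, U))
    (p q : Fin 3 × Fin 8) : stalkVal y (P26.presheaf.germ U y hy (ofUnit ((entry p q).app U s))) =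
      algebraMap _ _ (MOGen p q) * (fractions s).1 ⟨y, hy⟩ := by
  rw [entry_app, stalkVal_germ_mulSection]

theorem constClass_eq (v : Fin 3 × Fin 8 → ℂ) :
    constClass v = ∑ p, (constFun (v p) : Γ(P26, ⊤)) • basisClass p :=
  Finset.sum_congr rfl fun p _ => by
    refine (app_toUnit (basisHom p) ⊤ (constFun (v p))).trans ?_
    rw [res_top]
    rfl

theorem constClass_mulVec (A : Matrix (Fin 3 × Fin 8) (Fin 3 × Fin 8) ℂ) (v : Fin 3 × Fin 8 → ℂ) :
    constClass (A *ᵥ v) = ∑ p, (constFun (v p) : Γ(P26, ⊤)) • constClass (A.col p) := by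
  simp only [constClass_eq, Finset.smul_sum, mulVec, dotProduct, constFun_sum, Finset.sum_smul,
    smul_smul, constFun_mul]
  rw [Finset.sum_comm]
  refine Finset.sum_congr rfl fun p _ => Finset.sum_congr rfl fun q _ => ?_
  rw [mul_comm]
  rfl

theorem constClass_single (p : Fin 3 × Fin 8) : constClass (Pi.single p 1) = basisClass p := by
  rw [constClass_eq, Finset.sum_eq_single p]
  · rw [Pi.single_eq_same, constFun_one, one_smul]
  · intro q _ hq
    rw [Pi.single_eq_of_ne hq, constFun_zero, zero_smul]
  · simp

theorem res_constClass (U : P26.Opens) (v : Fin 3 × Fin 8 → ℂ) :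
    (res U (constClass v) : Γ(EODM, U)) = ∑ p, (constFun (v p) : Γ(P26, U)) • res U (basisClass p) := by
  rw [constClass_eq, res, map_sum]
  refine Finset.sum_congr rfl fun p _ => ?_
  exact Scheme.Modules.map_smul EODM _ _ _

theorem sum_smul_sum_smul {R M ι κ : Type*} [CommRing R] [AddCommGroup M] [Module R M] [Fintype ι]
    [Fintype κ] (a : ι → R) (c : κ → ι → R) (e : κ → M) :
    ∑ p, a p • ∑ r, c r p • e r = ∑ r, (∑ p, a p * c r p) • e r := by
  simp only [Finset.smul_sum, smul_smul, Finset.sum_smul]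
  exact Finset.sum_comm

theorem sum_mul_mul_eq {R ι κ : Type*} [CommRing R] [Fintype ι] [Fintype κ] {a c : ι → R}
    {b m : κ → R} (t : R) (h : ∑ p, c p * a p = ∑ k, m k * b k) :
    ∑ p, a p * t * c p = ∑ k, b k * (m k * t) := by
  rw [← sub_eq_zero] at h ⊢
  have h2 := congrArg (t * ·) h
  simp only [mul_sub, Finset.mul_sum, mul_zero] at h2
  rw [← h2]
  congr 1 <;> exact Finset.sum_congr rfl fun _ _ => by ring

/-- By A·M(gx) = M(x)·ᵗB, the pulled-back relations, rewritten through A, are constant combinations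
of the original relations evaluated on the pulled-back section. -/
theorem pull_relation {A B : Matrix (Fin 3 × Fin 8) (Fin 3 × Fin 8) ℂ}
    (hAB : A.map MvPolynomial.C * MOGen.map (subst g.1) = MOGen * Bᵀ.map MvPolynomial.C)
    (q : Fin 3 × Fin 8) (U : P26.Opens) (s : Γ(tautSheaf, U)) :
    ∑ p, pullFun g U (ofUnit ((entry p q).app U s)) •
      (res (coordMap g ⁻¹ᵁ U) (constClass (A.col p)) : Γ(EODM, coordMap g ⁻¹ᵁ U)) = 0 := by
  set s' := pullSection g s with hs'
  have key : ∀ r, ∑ p, pullFun g U (ofUnit ((entry p q).app U s)) * constFun (A r p) =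
      ∑ k, constFun (B q k) * ofUnit ((entry r k).app (coordMap g ⁻¹ᵁ U) s') := by
    intro r
    refine section_ext fun y hy => ?_
    simp only [map_sum, map_mul, stalkVal_germ_constFun, stalkVal_germ_pullFun, stalkVal_germ_entry,
      pullLoc_algebraMap, hs', fractions_pullSection]
    have h := congrArg (fun M => algebraMap _ (Loc (grading 27) y) (M r q)) hAB
    simp only [Matrix.mul_apply, Matrix.map_apply, transpose_apply, map_sum, map_mul] at h
    exact sum_mul_mul_eq _ h
  simp only [res_constClass]
  refine (sum_smul_sum_smul _ (fun r p => constFun (A r p)) _).trans ?_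
  simp only [key]
  refine (sum_smul_sum_smul _
    (fun r k => ofUnit ((entry r k).app (coordMap g ⁻¹ᵁ U) s')) _).symm.trans ?_
  exact Finset.sum_eq_zero fun k _ => by rw [relation_basisClass, smul_zero]

theorem exists_pull_hom {A B : Matrix (Fin 3 × Fin 8) (Fin 3 × Fin 8) ℂ}
    (hAB : A.map MvPolynomial.C * MOGen.map (subst g.1) = MOGen * Bᵀ.map MvPolynomial.C) :
    ∃ f : EODM ⟶ (Scheme.Modules.pushforward (coordMap g)).obj EODM,
      ∀ v, f.app ⊤ (constClass v) = constClass (A *ᵥ v) := by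
  obtain ⟨f, hf⟩ := exists_EODM_hom ((Scheme.Modules.pushforward (coordMap g)).obj EODM)
    (fun p => constClass (A.col p)) (pull_relation g hAB)
  refine ⟨f, fun v => ?_⟩
  rw [constClass_eq, map_sum, constClass_mulVec]
  refine Finset.sum_congr rfl fun p _ => ?_
  rw [Scheme.Modules.Hom.app_smul, hf]
  refine Eq.trans ?_ (congrArg (· • constClass (A.col p)) (pullFun_constFun g (U := ⊤) (v p)))
  rfl

end pull
end Octonion

namespace Octonion
open SerreTwist Matrix ProjSpace

/-! ### The linearization of E_ODM -/

section linearization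

theorem EODM_hom_ext_constClass {N : P26.Modules} {f₁ f₂ : EODM ⟶ N}
    (H : ∀ v, f₁.app ⊤ (constClass v) = f₂.app ⊤ (constClass v)) : f₁ = f₂ :=
  EODM_hom_ext fun p => by rw [← constClass_single]; exact H _

/-- The morphism `ψ : E_ODM ⟶ a_* E_ODM` is given on constant sections by the matrix `A`. -/
def InducedBy {a : P26 ⟶ P26} (ψ : EODM ⟶ (Scheme.Modules.pushforward a).obj EODM)
    (A : Matrix (Fin 3 × Fin 8) (Fin 3 × Fin 8) ℂ) : Prop :=
  ∀ v, ψ.app ⊤ (constClass v) = constClass (A *ᵥ v)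

section

variable {a b c : P26 ⟶ P26} {ψa ψa' : EODM ⟶ (Scheme.Modules.pushforward a).obj EODM}
  {ψb : EODM ⟶ (Scheme.Modules.pushforward b).obj EODM}
  {ψc : EODM ⟶ (Scheme.Modules.pushforward c).obj EODM}
  {A B : Matrix (Fin 3 × Fin 8) (Fin 3 × Fin 8) ℂ}

theorem InducedBy.unique (h : InducedBy ψa A) (h' : InducedBy ψa' A) : ψa = ψa' :=
  EODM_hom_ext_constClass fun v => (h v).trans (h' v).symm

theorem InducedBy.comp (ha : InducedBy ψa A) (hb : InducedBy ψb B) :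
    InducedBy (a := b ≫ a) (ψa ≫ (Scheme.Modules.pushforward a).map ψb ≫
      (Scheme.Modules.pushforwardComp b a).hom.app EODM) (B * A) := fun v => by
  refine (congrArg (ψb.app ⊤) (ha v)).trans ?_
  rw [hb, mulVec_mulVec]

theorem inducedBy_id : InducedBy (a := 𝟙 P26) ((Scheme.Modules.pushforwardId P26).inv.app EODM) 1 :=
  fun v => by
    rw [one_mulVec]
    rfl

theorem InducedBy.congr (h : InducedBy ψc A) (hc : c = a) :
    InducedBy (a := a) (ψc ≫ (Scheme.Modules.pushforwardCongr hc).hom.app EODM) A := by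
  subst hc
  intro v
  refine Eq.trans ?_ (h v)
  exact ConcreteCategory.congr_hom (EODM.presheaf.map_id (op ⊤)) (ψc.app ⊤ (constClass v))

/-- The composite is induced by the identity matrix, so by uniqueness it is the canonical
isomorphism. -/
theorem InducedBy.isIso_comp (ha : InducedBy ψa A) (hb : InducedBy ψb B) (hBA : B * A = 1)
    (hba : 𝟙 P26 = b ≫ a) : IsIso (ψa ≫ (Scheme.Modules.pushforward a).map ψb ≫
      (Scheme.Modules.pushforwardComp b a).hom.app EODM) := by
  have h1 := ha.comp hb
  rw [hBA] at h1
  rw [h1.unique (inducedBy_id.congr hba)]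
  infer_instance

theorem InducedBy.mono (ha : InducedBy ψa A) (hb : InducedBy ψb B) (hBA : B * A = 1)
    (hba : 𝟙 P26 = b ≫ a) : Mono ψa := by
  have := ha.isIso_comp hb hBA hba
  exact mono_of_mono ψa ((Scheme.Modules.pushforward a).map ψb ≫
    (Scheme.Modules.pushforwardComp b a).hom.app EODM)

theorem InducedBy.epi [IsIso a] (ha : InducedBy ψa A) (hb : InducedBy ψb B) (hBA : B * A = 1)
    (hba : 𝟙 P26 = b ≫ a) : Epi ψb := by
  have := ha.isIso_comp hb hBA hba
  have h1 : Epi ((Scheme.Modules.pushforward a).map ψb ≫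
      (Scheme.Modules.pushforwardComp b a).hom.app EODM) :=
    epi_of_epi ψa _
  have h2 : Epi ((Scheme.Modules.pushforward a).map ψb) :=
    (MorphismProperty.cancel_right_of_respectsIso (MorphismProperty.epimorphisms _) _
      ((Scheme.Modules.pushforwardComp b a).hom.app EODM)).1 h1
  exact (Scheme.Modules.pushforward a).epi_of_epi_map h2

/-- The composites in the two orders make ψa mono and epi, and the category of modules is balanced.
-/
theorem InducedBy.isIso [IsIso b] (ha : InducedBy ψa A) (hb : InducedBy ψb B) (hBA : B * A = 1)
    (hAB : A * B = 1) (hba : 𝟙 P26 = b ≫ a) (hab : 𝟙 P26 = a ≫ b) : IsIso ψa := by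
  have := ha.mono hb hBA hba
  have := hb.epi ha hAB hab
  exact isIso_of_mono_of_epi ψa

end

section

variable {G : Type*} [Group G] (α : G →* Aut P26)
  (ρ : G →* Matrix (Fin 3 × Fin 8) (Fin 3 × Fin 8) ℂ)

/-- The morphism of `ℙ^26` given by `g`. -/
noncomputable def actMap (g : G) : P26 ⟶ P26 := (α g).hom

instance (g : G) : IsIso (actMap α g) := Iso.isIso_hom (α g)

theorem actMap_mul (g h : G) : actMap α (g * h) = actMap α h ≫ actMap α g :=
  congrArg Iso.hom (map_mul α g h)

theorem actMap_one : actMap α 1 = 𝟙 P26 :=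
  congrArg Iso.hom (map_one α)

variable {α ρ} (H : ∀ g, ∃ ψ : EODM ⟶ (Scheme.Modules.pushforward (actMap α g)).obj EODM,
  InducedBy ψ (ρ g⁻¹)) (g h : G)

/-- The morphism `E_ODM ⟶ g_* E_ODM` induced by `ρ`. -/
noncomputable def pushHom : EODM ⟶ (Scheme.Modules.pushforward (actMap α g)).obj EODM :=
  (H g).choose

theorem inducedBy_pushHom : InducedBy (pushHom H g) (ρ g⁻¹) :=
  (H g).choose_spec

/-- Both sides are induced by ρ(h⁻¹)ρ(g⁻¹) = ρ((gh)⁻¹), so uniqueness gives the cocycle identity. -/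
theorem pushHom_mul :
    pushHom H (g * h) ≫ (Scheme.Modules.pushforwardCongr (actMap_mul α g h)).hom.app EODM =
      pushHom H g ≫ (Scheme.Modules.pushforward (actMap α g)).map (pushHom H h) ≫
        (Scheme.Modules.pushforwardComp (actMap α h) (actMap α g)).hom.app EODM := by
  have h1 := (inducedBy_pushHom H (g * h)).congr (actMap_mul α g h)
  rw [_root_.mul_inv_rev, map_mul] at h1
  exact h1.unique ((inducedBy_pushHom H g).comp (inducedBy_pushHom H h))

instance : IsIso (pushHom H g) := by
  refine (inducedBy_pushHom H g).isIso (inducedBy_pushHom H g⁻¹) ?_ ?_ ?_ ?_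
  · rw [← map_mul, inv_mul_cancel, map_one]
  · rw [← map_mul, mul_inv_cancel, map_one]
  · rw [← actMap_mul, mul_inv_cancel, actMap_one]
  · rw [← actMap_mul, inv_mul_cancel, actMap_one]

/-- The isomorphism `g^* E_ODM ⟶ E_ODM`. -/
noncomputable def pullHom : (Scheme.Modules.pullback (actMap α g)).obj EODM ⟶ EODM :=
  ((Scheme.Modules.pullbackPushforwardAdjunction (actMap α g)).homEquiv EODM EODM).symm
    (pushHom H g)

instance : IsIso (pullHom H g) := isIso_homEquiv_symm _ _

/-- The isomorphism `g^* E_ODM ≅ E_ODM`. -/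
noncomputable def pullIso : (Scheme.Modules.pullback (actMap α g)).obj EODM ≅ EODM :=
  asIso (pullHom H g)

/-- The linearization of `E_ODM` given by morphisms `E_ODM ⟶ g_* E_ODM` induced by `ρ`. -/
noncomputable def linearizationOfInducedBy : Linearization α EODM where
  iso g := pullIso H g
  iso_mul g h := homEquiv_symm_comp (actMap_mul α g h) _ _ _ (pushHom_mul H g h)

theorem linearizationOfInducedBy_app (v : Fin 3 × Fin 8 → ℂ) :
    ((Scheme.Modules.pullbackPushforwardAdjunction (α g).hom).homEquiv _ _
      ((linearizationOfInducedBy H).iso g).hom).app ⊤ (constClass v) =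
        constClass (ρ g⁻¹ *ᵥ v) := by
  refine Eq.trans ?_ (inducedBy_pushHom H g v)
  exact congrArg (fun f : EODM ⟶ (Scheme.Modules.pushforward (actMap α g)).obj EODM =>
    f.app ⊤ (constClass v)) (Equiv.apply_symm_apply
      ((Scheme.Modules.pullbackPushforwardAdjunction (actMap α g)).homEquiv EODM EODM) (pushHom H g))

end

/-- This is M(gx) = ρ(g) M(x) ᵗρ(g) with the left factor cancelled, which explains why ρ(g⁻¹) acts
on the generators. -/
theorem rho_inv_mul_subst (g : Cover × SpecialLinearGroup (Fin 3) ℂ) :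
    (rho g⁻¹).map (MvPolynomial.C (σ := Fin 27)) *
    MOGen.map (subst (repGL (coverProj g)).1) = MOGen * (rho g)ᵀ.map MvPolynomial.C := by
  rw [subst_MOGen, ← Matrix.mul_assoc, ← Matrix.mul_assoc, ← Matrix.map_mul, ← map_mul,
    inv_mul_cancel, map_one, Matrix.map_one _ (map_zero _) (map_one _), Matrix.one_mul]

theorem exists_inducedBy (g : Cover × SpecialLinearGroup (Fin 3) ℂ) :
    ∃ ψ : EODM ⟶ (Scheme.Modules.pushforward (actMap (act.comp coverProj) g)).obj EODM,
      InducedBy ψ (rho g⁻¹) :=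
  exists_pull_hom (repGL (coverProj g)) (rho_inv_mul_subst g)

/-- The linearization of `E_ODM` on the double cover. -/
noncomputable def linearization : Linearization (act.comp coverProj) EODM :=
  linearizationOfInducedBy exists_inducedBy

theorem linearization_app (g : Cover × SpecialLinearGroup (Fin 3) ℂ) (v : Fin 3 × Fin 8 → ℂ) :
    ((Scheme.Modules.pullbackPushforwardAdjunction (act (coverProj g)).hom).homEquiv _ _
      (linearization.iso g).hom).app ⊤ (constClass v) = constClass (rho g⁻¹ *ᵥ v) :=
  linearizationOfInducedBy_app exists_inducedBy g v

theorem coverProj_surjective : Function.Surjective coverProj := by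
  rintro ⟨T₁, C⟩
  obtain ⟨T₂, hT, -⟩ := exists_triality_unique T₁
  exact ⟨(⟨(T₁, T₂), hT⟩, C), rfl⟩

theorem nonempty_pullback_iso (g : SO7 × SpecialLinearGroup (Fin 3) ℂ) :
    Nonempty ((Scheme.Modules.pullback (act g).hom).obj EODM ≅ EODM) := by
  obtain ⟨g, rfl⟩ := coverProj_surjective g
  exact ⟨linearization.iso g⟩

end linearization
end Octonion

theorem mainTheorem5 :
    -- `S_ODM` is a nonzero form of degree six
    (Octonion.sextic ∈ ProjSpace.grading 27 6 ∧ Octonion.sextic ≠ 0) ∧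
    -- the support of `E_ODM` is the hypersurface `S_ODM = 0`
    (∀ x : Octonion.P26,
      Nontrivial (Octonion.EODM.presheaf.stalk x) ↔ x ∈ Octonion.sexticLocus) ∧
    -- `E_ODM` is a sheaf on the hypersurface: it is killed by the ideal sheaf of `S_ODM`
    (∀ (x : Octonion.P26), ∀ f ∈ Octonion.sexticIdeal x,
      ∀ m : Octonion.EODM.presheaf.stalk x, f • m = 0) ∧
    -- generically on the hypersurface, `E_ODM` is free of rank four over its structure sheaf
    (∃ U : Octonion.P26.Opens,
      Octonion.sexticLocus ⊆ closure ((U : Set Octonion.P26) ∩ Octonion.sexticLocus) ∧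
      ∀ x ∈ (U : Set Octonion.P26) ∩ Octonion.sexticLocus,
        Nonempty (Octonion.EODM.presheaf.stalk x ≃ₗ[Octonion.P26.presheaf.stalk x]
          (Fin 4 → Octonion.P26.presheaf.stalk x ⧸ Octonion.sexticIdeal x))) ∧
    -- every element of `SO_7 × SL_3` preserves `E_ODM` up to isomorphism
    (∀ g : Octonion.SO7 × Matrix.SpecialLinearGroup (Fin 3) ℂ,
      Nonempty ((Scheme.Modules.pullback (Octonion.act g).hom).obj Octonion.EODM ≅
        Octonion.EODM)) ∧
    -- triality: `T₂` exists, satisfies `L_{T₁ z} = T₂ L_z T₂⁻¹`, and is unique up to sign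
    (∀ T₁ : Octonion.SO7, ∃ T₂ : Octonion.SO8, (T₁, T₂) ∈ Octonion.Cover ∧
      (∀ z : Fin 8 → ℂ, Octonion.L (Octonion.mat T₁.1 *ᵥ z) =
        Octonion.mat T₂.1 * Octonion.L z * (Octonion.mat T₂.1)⁻¹) ∧
      ∀ T : Octonion.SO8, (T₁, T) ∈ Octonion.Cover ↔
        (Octonion.mat T.1 = Octonion.mat T₂.1 ∨ Octonion.mat T.1 = -Octonion.mat T₂.1)) ∧
    -- the group of pairs `(T₁, T₂)` times `SL_3` linearizes `E_ODM`, through its representation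
    -- `ᵗ(C⁻¹) ⊗ T₂` on `ℂ^24`
    (∃ lin : Linearization (Octonion.act.comp Octonion.coverProj) Octonion.EODM,
      ∀ (g : Octonion.Cover × Matrix.SpecialLinearGroup (Fin 3) ℂ) (v : Fin 3 × Fin 8 → ℂ),
        ((Scheme.Modules.pullbackPushforwardAdjunction
            (Octonion.act (Octonion.coverProj g)).hom).homEquiv _ _ (lin.iso g).hom).app ⊤
          (Octonion.constClass v) = Octonion.constClass (Octonion.rho g⁻¹ *ᵥ v)) :=
  ⟨⟨Octonion.isHomogeneous_sextic, Octonion.sextic_ne_zero⟩, Octonion.nontrivial_stalk_iff,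
    fun x _ hf => Octonion.smul_eq_zero_of_mem_sexticIdeal x hf,
    ⟨Octonion.genericOpen, Octonion.locus_subset_closure, Octonion.nonempty_stalk_linearEquiv⟩,
    Octonion.nonempty_pullback_iso, Octonion.exists_triality_unique,
    Octonion.linearization, Octonion.linearization_app⟩
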